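/- Let $n\ge 1$, let $|H|<1$, and let $\Omega$ be a domain (non-empty, open, connected) in the unit sphere $\mathbb S^n\subset\mathbb R^{n+1}$ whose closure is contained in the open upper hemisphere $\mathbb S^n_+=\{z\in\mathbb S^n: z_{n+1}>0\}$. Let $T>0$ and let $\underline v\le\overline v$ be continuous functions on $\overline\Omega$ with $\underline v=\overline v$ on $\partial\Omega$ and $|\underline v|,|\overline v|\le T$. Put $$C_T=\{e^wz: z\in\Omega,\ -T-1<w<T+1\},$$ and for a function $v$ on $\Omega$ call $\{e^wz: z\in\Omega,\ w<v(z)\}\cap C_T$ its subgraph in $C_T$. Let $\underline V,\overline V$ be the subgraphs in $C_T$ of $\underline v,\overline v$, and let $$\mathcal V=\{E\subseteq C_T: E\ \text{Lebesgue measurable},\ \underline V\subseteq E\subseteq\overline V\}.$$ For $U\in\mathcal V$ set $$\mathcal P(U)=\sup\Big\{\int_U \operatorname{div}\big(x_{n+1}^{-n}g\big)\,dx:\ g\in C^1_0(C_T;\mathbb R^{n+1}),\ |g|\le1\Big\}\in[0,\infty],$$ $$\mathcal F(U)=\mathcal P(U)+nH\int_U x_{n+1}^{-(n+1)}\,dx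 .$$ Assume that some $E_0\in\mathcal V$ has $\mathcal P(E_0)<\infty$. Then $\mathcal F$ attains its minimum over $\mathcal V$, and the minimizer is unique up to sets of Lebesgue measure zero. Moreover its boundary is a radial graph over $\Omega$: there is a function $u:\Omega\to\mathbb R$ such that the subgraph $E$ of $u$ in $C_T$ is the minimizer (that is, belongs to $\mathcal V$ and minimizes $\mathcal F$), and the topological boundary of $E$ inside $C_T$ is the radial graph of $u$, $$\partial E\cap C_T=\{e^{u(z)}z: z\in\Omega\}.$$ -/

import Mathlib

open MeasureTheory Set

noncomputable section

namespace RadialGraph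

/-- Euclidean space `ℝ^(n+1)`; the last coordinate is the height `x_{n+1}` of the
half-space model of hyperbolic space. -/
abbrev Space (n : ℕ) : Type := EuclideanSpace ℝ (Fin (n + 1))

/-- The unit sphere `S^n` of `ℝ^(n+1)`, as a topological space. -/
abbrev Sphere (n : ℕ) : Type := Metric.sphere (0 : Space n) 1

/-- The height `x_{n+1} = e · x`. -/
def height {n : ℕ} (x : Space n) : ℝ := x (Fin.last n)

/-- The open upper hemisphere `{z ∈ S^n : z_{n+1} > 0}`. -/
def upperHemisphere (n : ℕ) : Set (Sphere n) := {z | 0 < height (z : Space n)}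

/-- The truncated radial cone `C_T = {e^w z : z ∈ Ω, -T-1 < w < T+1}`. -/
def truncCone {n : ℕ} (Ω : Set (Sphere n)) (T : ℝ) : Set (Space n) :=
  {x | ∃ z ∈ Ω, ∃ w : ℝ, -T - 1 < w ∧ w < T + 1 ∧ x = Real.exp w • (z : Space n)}

/-- The subgraph in `C_T` of the radial surface `X = e^{v(z)} z`, `z ∈ Ω`, that is
`{e^w z : z ∈ Ω, w < v(z)} ∩ C_T`. -/
def subgraph {n : ℕ} (Ω : Set (Sphere n)) (T : ℝ) (v : Sphere n → ℝ) : Set (Space n) :=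
  {x | ∃ z ∈ Ω, ∃ w : ℝ, w < v z ∧ x = Real.exp w • (z : Space n)} ∩ truncCone Ω T

/-- The radial graph `{e^{u(z)} z : z ∈ Ω}` of `u` over `Ω`. -/
def radialGraph {n : ℕ} (Ω : Set (Sphere n)) (u : Sphere n → ℝ) : Set (Space n) :=
  {x | ∃ z ∈ Ω, x = Real.exp (u z) • (z : Space n)}

/-- The Euclidean divergence `∑ i, ∂ᵢ Xᵢ` of a vector field. -/
def divergence {n : ℕ} (X : Space n → Space n) (x : Space n) : ℝ :=
  ∑ i : Fin (n + 1), (fderiv ℝ X x (EuclideanSpace.single i 1)) i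

/-- `g ∈ C¹₀(A; ℝ^(n+1))` with `|g| ≤ 1`: a continuously differentiable field with compact
support inside `A` (extended by zero to the whole space) and Euclidean length at most one. -/
def IsTestField {n : ℕ} (A : Set (Space n)) (g : Space n → Space n) : Prop :=
  ContDiff ℝ 1 g ∧ HasCompactSupport g ∧ tsupport g ⊆ A ∧ ∀ x, ‖g x‖ ≤ 1

/-- The hyperbolic perimeter of `U` in `A`, with values in the extended reals: the supremum of
`∫_U div (g x_{n+1}^{-n}) dx` over the test fields `g`. -/
def perimeter {n : ℕ} (A U : Set (Space n)) : EReal :=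
  ⨆ (g : Space n → Space n) (_ : IsTestField A g),
    ((∫ x in U, divergence (fun y => ((height y) ^ n)⁻¹ • g y) x : ℝ) : EReal)

/-- The hyperbolic volume of `U` in `A`, `∫_{U ∩ A} x_{n+1}^{-(n+1)} dx`. It is used for
`A = C_T` over a domain `Ω` with closure in the open upper hemisphere, where the integrand is
bounded and `A` is bounded. -/
def vol {n : ℕ} (A U : Set (Space n)) : ℝ :=
  ∫ x in U ∩ A, ((height x) ^ (n + 1))⁻¹

/-- The functional `F(U) = P_A(U) + n H Vol(U)`. -/
def energy {n : ℕ} (H : ℝ) (A U : Set (Space n)) : EReal :=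
  perimeter A U + (((n : ℝ) * H * vol A U : ℝ) : EReal)

/-- The class of (Lebesgue) measurable sets `E ⊆ C_T` lying between the subgraphs of `v₁`
and of `v₂`. -/
def competitors {n : ℕ} (Ω : Set (Sphere n)) (T : ℝ) (v₁ v₂ : Sphere n → ℝ) :
    Set (Set (Space n)) :=
  {E | E ⊆ truncCone Ω T ∧ NullMeasurableSet E volume ∧
    subgraph Ω T v₁ ⊆ E ∧ E ⊆ subgraph Ω T v₂}

/-- `E` minimizes `F` in the class of competitors. -/
def IsMinimizer {n : ℕ} (H : ℝ) (Ω : Set (Sphere n)) (T : ℝ) (v₁ v₂ : Sphere n → ℝ)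
    (E : Set (Space n)) : Prop :=
  E ∈ competitors Ω T v₁ v₂ ∧
    ∀ E' ∈ competitors Ω T v₁ v₂, energy H (truncCone Ω T) E ≤ energy H (truncCone Ω T) E'

end RadialGraph

end

/-! ### The height coordinate and the half-space. -/

noncomputable section
namespace RadialGraph
open Filter Topology

variable {n : ℕ}

/-! Existence. The functional is extended from sets to functions `f` with `chi V₁ ≤ f ≤ chi V₂`: it
becomes the supremum over test fields `g` of the linear expressions `fieldEnergy κ A f g`, with `κ =
nH`, hence is convex and lower semicontinuous. A minimizer in L² comes from nested bounded closed
convex sets (`exists_relaxed_min`). By the coarea inequality `coarea_le`, the energies of `min f a`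
and `f - min f a` together do not exceed that of `f`. Therefore superlevel sets of relaxed
minimizers are minimizing sets (`IsRelaxedMin.superlevel`). Applied to `chi E + chi F` at level 1,
the same inequality is submodularity of the perimeter, so minimizing sets are closed under unions
and intersections, and there are a largest minimizer `U` and a smallest one `I` up to null sets
(`exists_extremal`).

Graphs. Dilations composed with horizontal translations preserve the functional. They form a group
identified with the half-space itself, acting by `act`. Let `c` be close to the dilation by `e^s`,
`s > 0`, and pull a minimizer back by `act c`, which pushes it down by roughly `s`. Since the
obstacles meet over the boundary of `Ω`, the part of this copy sticking out of another minimizer is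
contained in a compact subset of the cone. Adding it to the one and removing it from the other gives
two further minimizers (`Obstacles.exists_glue`, resting on `submodular_local`). Extremality then
forces `U`, and likewise `I`, to contain its pushed-down copies up to null sets, for an open set of
group elements `c`. Fubini's theorem over the group turns this into a pointwise statement about
essential interiors (`mem_essInterior_of_push`), and the extremal minimizers are subgraphs of
continuous functions `u₁ ≤ u₂` (`exists_subgraph`).

Uniqueness. The functions `u₁` and `u₂` are taken as new obstacles, both of which are now
minimizers. Where `u₁ < u₂`, the glued minimizers locally coincide with copies of one of the two
subgraphs, for an open set of `c`. Averages of their indicators over smooth kernels on the group are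
smooth relaxed minimizers. Minimality of two such functions and of their half sum makes the
perimeter additive on them, and this forces parallel gradients (`sameRay_gradient`). Moving kernels
by the group, all gradients near a point are parallel to one fixed direction, so the averages are
constant on a piece of a hyperplane, and the frontier contains that piece (`exists_planar`). Hence
both `e^{-u₁}` and `e^{-u₂}` are locally restrictions of linear functionals. At a positive maximum
of `u₂ - u₁` two such functionals, suitably scaled, touch and so coincide. The set where the maximum
is attained is thus open and closed in the sphere, hence the whole sphere, although it cannot
contain the south pole (`Obstacles.eq_of_min`). -/

/-- The height as a continuous linear functional. -/
def heightL (n : ℕ) : Space n →L[ℝ] ℝ := EuclideanSpace.proj (Fin.last n)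

@[simp] lemma heightL_apply (x : Space n) : heightL n x = height x := rfl

lemma contDiff_height {k : WithTop ℕ∞} : ContDiff ℝ k (height : Space n → ℝ) :=
  (heightL n).contDiff

lemma continuous_height : Continuous (height : Space n → ℝ) := (heightL n).continuous

@[simp] lemma height_add (x y : Space n) : height (x + y) = height x + height y := rfl
@[simp] lemma height_sub (x y : Space n) : height (x - y) = height x - height y := rfl
@[simp] lemma height_smul (c : ℝ) (x : Space n) : height (c • x) = c * height x := rfl

lemma abs_height_le (x : Space n) : |height x| ≤ ‖x‖ := by
  simpa [height] using PiLp.norm_apply_le x (Fin.last n)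

/-- The open upper half-space. -/
def upperHalf (n : ℕ) : Set (Space n) := {x | 0 < height x}

lemma isOpen_upperHalf : IsOpen (upperHalf n) := isOpen_lt continuous_const continuous_height

/-! ### The divergence -/

lemma divergence_add {X Y : Space n → Space n} {x : Space n} (hX : DifferentiableAt ℝ X x)
    (hY : DifferentiableAt ℝ Y x) :
    divergence (fun y => X y + Y y) x = divergence X x + divergence Y x := by
  simp [divergence, fderiv_fun_add hX hY, Finset.sum_add_distrib]

lemma sum_coord_single (v : Space n) : ∑ i, v i • EuclideanSpace.single i (1 : ℝ) = v := by
  ext j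
  simp [Finset.sum_apply, Pi.single_apply]

lemma divergence_smul {u : Space n → ℝ} {Y : Space n → Space n} {x : Space n}
    (hu : DifferentiableAt ℝ u x) (hY : DifferentiableAt ℝ Y x) :
    divergence (fun y => u y • Y y) x = u x * divergence Y x + fderiv ℝ u x (Y x) := by
  have h : fderiv ℝ u x (Y x) = ∑ i, fderiv ℝ u x (EuclideanSpace.single i 1) * Y x i := by
    conv_lhs => rw [← sum_coord_single (Y x)]
    simp [map_sum, mul_comm]
  simp [divergence, fderiv_fun_smul hu hY, h, Finset.sum_add_distrib, Finset.mul_sum]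

lemma continuous_divergence {Y : Space n → Space n} (hY : ContDiff ℝ 1 Y) :
    Continuous (divergence Y) := by
  have : Continuous (fderiv ℝ Y) := hY.continuous_fderiv one_ne_zero
  unfold divergence
  refine continuous_finsetSum _ fun i _ => ?_
  exact (EuclideanSpace.proj (𝕜 := ℝ) i).continuous.comp (this.clm_apply continuous_const)

lemma divergence_congr {X Y : Space n → Space n} {x : Space n} (h : X =ᶠ[𝓝 x] Y) :
    divergence X x = divergence Y x := by
  simp [divergence, h.fderiv_eq]

lemma divergence_eq_zero_of_notMem_tsupport {Y : Space n → Space n} {x : Space n}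
    (h : x ∉ tsupport Y) : divergence Y x = 0 := by
  rw [divergence_congr (notMem_tsupport_iff_eventuallyEq.1 h)]
  simp [divergence]

lemma tsupport_divergence_subset (Y : Space n → Space n) : tsupport (divergence Y) ⊆ tsupport Y :=
  closure_minimal (fun x hx => by
    by_contra h; exact hx (divergence_eq_zero_of_notMem_tsupport h)) (isClosed_tsupport Y)

lemma hasCompactSupport_divergence {Y : Space n → Space n} (hY : HasCompactSupport Y) :
    HasCompactSupport (divergence Y) :=
  hY.of_isClosed_subset (isClosed_tsupport _) (tsupport_divergence_subset Y)

/-- Each summand is a directional derivative of a compactly supported function, so integration by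
parts against the constant 1 removes it. -/
lemma integral_divergence_eq_zero {Y : Space n → Space n} (hY : ContDiff ℝ 1 Y)
    (hc : HasCompactSupport Y) : ∫ x, divergence Y x = 0 := by
  have hd : ∀ i : Fin (n + 1), ContDiff ℝ 1 (fun x => Y x i) := fun i =>
    (EuclideanSpace.proj (𝕜 := ℝ) i).contDiff.comp hY
  have hs : ∀ i : Fin (n + 1), HasCompactSupport (fun x => Y x i) := fun i =>
    hc.comp_left (g := fun v : Space n => v i) rfl
  have hf : ∀ (i : Fin (n + 1)) (x v : Space n),
      fderiv ℝ (fun x => Y x i) x v = (fderiv ℝ Y x v) i := fun i x v => by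
    have := ((EuclideanSpace.proj (𝕜 := ℝ) i : Space n →L[ℝ] ℝ).hasFDerivAt.comp x
      (hY.differentiable one_ne_zero x).hasFDerivAt).fderiv
    exact DFunLike.congr_fun this v
  have hi : ∀ i : Fin (n + 1), Integrable
      (fun x => fderiv ℝ (fun x => Y x i) x (EuclideanSpace.single i 1)) := fun i =>
    (((hd i).continuous_fderiv one_ne_zero).clm_apply continuous_const).integrable_of_hasCompactSupport
      ((hs i).fderiv_apply (𝕜 := ℝ) _)
  simp only [divergence, ← hf]
  rw [integral_finsetSum _ fun i _ => hi i]
  refine Finset.sum_eq_zero fun i _ => ?_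
  have := integral_mul_fderiv_eq_neg_fderiv_mul_of_integrable (μ := (volume : Measure (Space n)))
    (f := fun _ => (1 : ℝ)) (g := fun x => Y x i) (v := EuclideanSpace.single i 1)
    (by simp) (by simpa using hi i)
    (by simpa using (hd i).continuous.integrable_of_hasCompactSupport (hs i))
    (fun _ _ => differentiableAt_const _) (fun x _ => (hd i).differentiable one_ne_zero x)
  simpa using this

lemma tsupport_smul_field_subset (η : Space n → ℝ) (g : Space n → Space n) :
    tsupport (fun x => η x • g x) ⊆ tsupport g :=
  closure_mono fun x hx hg => hx (by simp [hg])

lemma hasCompactSupport_smul_field (η : Space n → ℝ) {g : Space n → Space n}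
    (hg : HasCompactSupport g) : HasCompactSupport (fun x => η x • g x) :=
  hg.of_isClosed_subset (isClosed_tsupport _) (tsupport_smul_field_subset η g)

/-- Integration by parts against a compactly supported field, for a function that is `C¹` near the
support of the field. -/
lemma integral_mul_divergence {u : Space n → ℝ} {Y : Space n → Space n} {O : Set (Space n)}
    (hO : IsOpen O) (hu : ContDiffOn ℝ 1 u O) (hY : ContDiff ℝ 1 Y) (hc : HasCompactSupport Y)
    (hs : tsupport Y ⊆ O) :
    ∫ x, u x * divergence Y x = - ∫ x, fderiv ℝ u x (Y x) := by
  have huY : ContDiff ℝ 1 (fun x => u x • Y x) := by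
    rw [contDiff_iff_contDiffAt]
    intro x
    by_cases hx : x ∈ tsupport Y
    · exact ((hu x (hs hx)).contDiffAt (hO.mem_nhds (hs hx))).smul hY.contDiffAt
    · have : (fun x => u x • Y x) =ᶠ[𝓝 x] fun _ => 0 := by
        filter_upwards [notMem_tsupport_iff_eventuallyEq.1 hx] with y hy
        simp [hy]
      exact contDiffAt_const.congr_of_eventuallyEq this
  have hcu : HasCompactSupport (fun x => u x • Y x) := hasCompactSupport_smul_field u hc
  have hz := integral_divergence_eq_zero huY hcu
  have hpt : ∀ x, divergence (fun y => u y • Y y) x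
      = u x * divergence Y x + fderiv ℝ u x (Y x) := by
    intro x
    by_cases hx : x ∈ tsupport Y
    · exact divergence_smul (((hu x (hs hx)).contDiffAt (hO.mem_nhds (hs hx))).differentiableAt
        one_ne_zero) (hY.differentiable one_ne_zero x)
    · have h1 : (fun x => u x • Y x) =ᶠ[𝓝 x] fun _ => 0 := by
        filter_upwards [notMem_tsupport_iff_eventuallyEq.1 hx] with y hy
        simp [hy]
      rw [divergence_congr h1, divergence_eq_zero_of_notMem_tsupport hx,
        image_eq_zero_of_notMem_tsupport hx]
      simp [divergence]
  have hcont : Continuous (fun x => u x * divergence Y x) := by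
    rw [continuous_iff_continuousAt]
    intro x
    by_cases hx : x ∈ tsupport Y
    · exact ((hu.continuousOn.continuousAt (hO.mem_nhds (hs hx)))).mul
        (continuous_divergence hY).continuousAt
    · have : (fun x => u x * divergence Y x) =ᶠ[𝓝 x] fun _ => 0 := by
        filter_upwards [(isClosed_tsupport Y).isOpen_compl.mem_nhds hx] with y hy
        simp [divergence_eq_zero_of_notMem_tsupport hy]
      exact continuousAt_const.congr this.symm
  have hi1 : Integrable (fun x => u x * divergence Y x) :=
    hcont.integrable_of_hasCompactSupport (hasCompactSupport_divergence hc).mul_left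
  have hi2 : Integrable (fun x => divergence (fun y => u y • Y y) x) :=
    (continuous_divergence huY).integrable_of_hasCompactSupport (hasCompactSupport_divergence hcu)
  have hi3 : Integrable (fun x => fderiv ℝ u x (Y x)) := by
    refine (hi2.sub hi1).congr (ae_of_all _ fun x => ?_)
    simp [hpt]
  simp only [hpt] at hz
  rw [integral_add hi1 hi3] at hz
  linarith

/-! ### Weighted test fields -/

/-- The weight `x_{n+1}^{-n}`. -/
def weight (x : Space n) : ℝ := ((height x) ^ n)⁻¹

/-- The divergence of the weighted field `x_{n+1}^{-n} g`. -/
def wdiv (g : Space n → Space n) (x : Space n) : ℝ :=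
  divergence (fun y => weight y • g y) x

/-- The pairing `∫ f div (x_{n+1}^{-n} g)`. -/
def pairing (f : Space n → ℝ) (g : Space n → Space n) : ℝ := ∫ x, f x * wdiv g x

lemma contDiffOn_weight {k : WithTop ℕ∞} : ContDiffOn ℝ k (weight : Space n → ℝ) (upperHalf n) :=
  ContDiffOn.inv (contDiff_height.pow n).contDiffOn fun _ hx => (pow_pos hx n).ne'

lemma weight_pos {x : Space n} (hx : x ∈ upperHalf n) : 0 < weight x :=
  inv_pos.2 (pow_pos hx n)

/-- A compactly supported `C¹` field in the upper half-space. -/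
structure IsField (g : Space n → Space n) : Prop where
  contDiff : ContDiff ℝ 1 g
  compact : HasCompactSupport g
  sub : tsupport g ⊆ upperHalf n

lemma IsTestField.isField {A : Set (Space n)} {g : Space n → Space n} (hA : A ⊆ upperHalf n)
    (hg : IsTestField A g) : IsField g := ⟨hg.1, hg.2.1, hg.2.2.1.trans hA⟩

lemma contDiff_smul_of_contDiffOn {η : Space n → ℝ} {g : Space n → Space n} {O : Set (Space n)}
    (hO : IsOpen O) (hη : ContDiffOn ℝ 1 η O) (hg : ContDiff ℝ 1 g) (hs : tsupport g ⊆ O) :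
    ContDiff ℝ 1 (fun x => η x • g x) := by
  rw [contDiff_iff_contDiffAt]
  intro x
  by_cases hx : x ∈ tsupport g
  · exact ((hη x (hs hx)).contDiffAt (hO.mem_nhds (hs hx))).smul hg.contDiffAt
  · have : (fun x => η x • g x) =ᶠ[𝓝 x] fun _ => 0 := by
      filter_upwards [notMem_tsupport_iff_eventuallyEq.1 hx] with y hy
      simp [hy]
    exact contDiffAt_const.congr_of_eventuallyEq this

namespace IsField

variable {g g' : Space n → Space n}

lemma weighted_contDiff (hg : IsField g) : ContDiff ℝ 1 (fun y => weight y • g y) :=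
  contDiff_smul_of_contDiffOn isOpen_upperHalf contDiffOn_weight hg.contDiff hg.sub

lemma weighted_compact (hg : IsField g) : HasCompactSupport (fun y => weight y • g y) :=
  hasCompactSupport_smul_field _ hg.compact

lemma continuous_wdiv (hg : IsField g) : Continuous (wdiv g) :=
  continuous_divergence hg.weighted_contDiff

lemma wdiv_eq_zero {x : Space n} (hx : x ∉ tsupport g) : wdiv g x = 0 :=
  divergence_eq_zero_of_notMem_tsupport fun h => hx (tsupport_smul_field_subset _ _ h)

lemma compact_wdiv (hg : IsField g) : HasCompactSupport (wdiv g) :=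
  hasCompactSupport_divergence hg.weighted_compact

lemma integrable_wdiv (hg : IsField g) : Integrable (wdiv g) :=
  hg.continuous_wdiv.integrable_of_hasCompactSupport hg.compact_wdiv

lemma smul {η : Space n → ℝ} (hη : ContDiff ℝ 1 η) (hg : IsField g) :
    IsField (fun x => η x • g x) where
  contDiff := hη.smul hg.contDiff
  compact := hasCompactSupport_smul_field _ hg.compact
  sub := (tsupport_smul_field_subset η g).trans hg.sub

lemma wdiv_add (hg : IsField g) (hg' : IsField g') (x : Space n) :
    wdiv (fun x => g x + g' x) x = wdiv g x + wdiv g' x := by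
  unfold wdiv
  rw [← divergence_add (hg.weighted_contDiff.differentiable one_ne_zero x)
    (hg'.weighted_contDiff.differentiable one_ne_zero x)]
  simp only [smul_add]

lemma integrable_mul_wdiv (hg : IsField g) {f : Space n → ℝ} (hf : AEStronglyMeasurable f volume)
    {M : ℝ} (hM : ∀ x, |f x| ≤ M) : Integrable (fun x => f x * wdiv g x) :=
  hg.integrable_wdiv.bdd_mul hf (ae_of_all _ hM)

lemma pairing_add_right (hg : IsField g) (hg' : IsField g') {f : Space n → ℝ}
    (hf : AEStronglyMeasurable f volume) {M : ℝ} (hM : ∀ x, |f x| ≤ M) :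
    pairing f (fun x => g x + g' x) = pairing f g + pairing f g' := by
  unfold pairing
  rw [← integral_add (hg.integrable_mul_wdiv hf hM) (hg'.integrable_mul_wdiv hf hM)]
  simp only [hg.wdiv_add hg', mul_add]

lemma pairing_add_left (hg : IsField g) {f f' : Space n → ℝ}
    (hf : AEStronglyMeasurable f volume) {M : ℝ} (hM : ∀ x, |f x| ≤ M)
    (hf' : AEStronglyMeasurable f' volume) {M' : ℝ} (hM' : ∀ x, |f' x| ≤ M') :
    pairing (fun x => f x + f' x) g = pairing f g + pairing f' g := by
  unfold pairing
  rw [← integral_add (hg.integrable_mul_wdiv hf hM) (hg.integrable_mul_wdiv hf' hM')]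
  simp only [add_mul]

end IsField

/-- The weighted divergence vanishes off the support of the field. This lets a set be replaced by
another wherever a cutoff has removed the field. -/
lemma pairing_congr {f f' : Space n → ℝ} {g : Space n → Space n}
    (h : ∀ x ∈ tsupport g, f x = f' x) : pairing f g = pairing f' g := by
  unfold pairing
  refine integral_congr_ae (ae_of_all _ fun x => ?_)
  by_cases hx : x ∈ tsupport g
  · simp [h x hx]
  · simp [IsField.wdiv_eq_zero hx]

/-- Integration by parts for the weighted pairing. -/
lemma IsField.pairing_eq_neg_integral {g : Space n → Space n} (hg : IsField g) {u : Space n → ℝ}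
    {O : Set (Space n)} (hO : IsOpen O) (hu : ContDiffOn ℝ 1 u O) (hs : tsupport g ⊆ O) :
    pairing u g = - ∫ x, weight x * fderiv ℝ u x (g x) := by
  unfold pairing wdiv
  rw [integral_mul_divergence hO hu hg.weighted_contDiff hg.weighted_compact
    ((tsupport_smul_field_subset _ _).trans hs)]
  simp

lemma IsTestField.mono {A B : Set (Space n)} {g : Space n → Space n} (hg : IsTestField A g)
    (h : A ⊆ B) : IsTestField B g := ⟨hg.1, hg.2.1, hg.2.2.1.trans h, hg.2.2.2⟩

lemma isTestField_zero (A : Set (Space n)) : IsTestField A (fun _ => (0 : Space n)) :=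
  ⟨contDiff_const, HasCompactSupport.zero, by simp [tsupport], by simp⟩

@[simp] lemma pairing_zero_right (f : Space n → ℝ) : pairing f (fun _ => (0 : Space n)) = 0 := by
  simp [pairing, wdiv, divergence]

/-- Interpolation of two test fields by a `C¹` function with values in `[0, 1]`. -/
lemma IsTestField.combine {A B C : Set (Space n)} {g k : Space n → Space n} {η : Space n → ℝ}
    (hη : ContDiff ℝ 1 η) (h0 : ∀ x, 0 ≤ η x) (h1 : ∀ x, η x ≤ 1) (hg : IsTestField A g)
    (hk : IsTestField B k) (hA : tsupport (fun x => η x • g x) ⊆ C)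
    (hB : tsupport (fun x => (1 - η x) • k x) ⊆ C) :
    IsTestField C (fun x => η x • g x + (1 - η x) • k x) := by
  refine ⟨(hη.smul hg.1).add ((contDiff_const.sub hη).smul hk.1),
    (hasCompactSupport_smul_field _ hg.2.1).add (hasCompactSupport_smul_field _ hk.2.1), (tsupport_add _ _).trans (union_subset hA hB), ?_⟩
  intro x
  calc ‖η x • g x + (1 - η x) • k x‖ ≤ ‖η x • g x‖ + ‖(1 - η x) • k x‖ := norm_add_le _ _
    _ = η x * ‖g x‖ + (1 - η x) * ‖k x‖ := by
      rw [norm_smul, norm_smul, Real.norm_of_nonneg (h0 x),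
        Real.norm_of_nonneg (sub_nonneg.2 (h1 x))]
    _ ≤ η x * 1 + (1 - η x) * 1 := by
      gcongr
      · exact h0 x
      · exact hg.2.2.2 x
      · exact sub_nonneg.2 (h1 x)
      · exact hk.2.2.2 x
    _ = 1 := by ring

end RadialGraph
end

noncomputable section
namespace RadialGraph
open Filter Topology

variable {n : ℕ}

/-! ### The coarea inequality -/

lemma tendsto_pairing {f : Space n → ℝ} {F : ℕ → Space n → ℝ} {g : Space n → Space n}
    (hg : IsField g) (hF : ∀ k, AEStronglyMeasurable (F k) volume) {M : ℝ}
    (hM : ∀ k x, |F k x| ≤ M) (h : ∀ᵐ x, Tendsto (fun k => F k x) atTop (𝓝 (f x))) :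
    Tendsto (fun k => pairing (F k) g) atTop (𝓝 (pairing f g)) := by
  refine tendsto_integral_of_dominated_convergence (fun x => M * ‖wdiv g x‖)
    (fun k => (hF k).mul hg.continuous_wdiv.aestronglyMeasurable)
    (hg.integrable_wdiv.norm.const_mul M) (fun k => ae_of_all _ fun x => ?_) ?_
  · rw [norm_mul]
    exact mul_le_mul_of_nonneg_right (hM k x) (norm_nonneg _)
  · filter_upwards [h] with x hx
    exact hx.mul_const _

/-- After integration by parts the gradient of `q ∘ u` carries the factor `p (u x)`, which may be
handed over to the field. When `0 ≤ p ≤ 1`, truncating the function thus becomes interpolating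
between fields. -/
lemma pairing_comp {u : Space n → ℝ} (hu : ContDiff ℝ 1 u) {q p : ℝ → ℝ} (hq : ContDiff ℝ 1 q)
    (hp : ContDiff ℝ 1 p) (hqp : ∀ s, HasDerivAt q (p s) s) {g : Space n → Space n}
    (hg : IsField g) :
    pairing (fun x => q (u x)) g = pairing u (fun x => p (u x) • g x) := by
  have h1 := hg.pairing_eq_neg_integral isOpen_univ (hq.comp hu).contDiffOn (subset_univ _)
  have h2 := (hg.smul (hp.comp hu)).pairing_eq_neg_integral isOpen_univ hu.contDiffOn
    (subset_univ _)
  refine h1.trans (Eq.trans ?_ h2.symm)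
  congr 1
  refine integral_congr_ae (ae_of_all _ fun x => ?_)
  have h := ((hqp (u x)).comp_hasFDerivAt x (hu.differentiable one_ne_zero x).hasFDerivAt).fderiv
  have h'' : fderiv ℝ (q ∘ u) x = p (u x) • fderiv ℝ u x := h
  simp [h'']

lemma divergence_translate (Y : Space n → Space n) (c : ℝ) (b x : Space n) :
    divergence (fun y => c • Y (y + b)) x = c * divergence Y (x + b) := by
  have : fderiv ℝ (fun y => c • Y (y + b)) x = c • fderiv ℝ Y (x + b) := by
    rw [← fderiv_comp_add_right b (f := Y) (x := x)]
    exact congrFun (fderiv_const_smul_field (𝕜 := ℝ) (f := fun y => Y (y + b)) c) x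
  simp [divergence, this, Finset.mul_sum]

/-- Translating a test field by a small vector costs little. -/
lemma exists_radius_translate_le {A : Set (Space n)} (hA : IsOpen A) (hA' : A ⊆ upperHalf n)
    {K : Set (Space n)} (hK : IsCompact K) (hKA : K ⊆ A) {ε : ℝ} (hε : 0 < ε) :
    ∃ r > 0, ∀ (f : Space n → ℝ) (c : ℝ) (_ : ∀ g, IsTestField A g → pairing f g ≤ c)
      (G : Space n → Space n) (_ : IsTestField A G) (_ : tsupport G ⊆ K) (b : Space n),
      ‖b‖ ≤ r → ∫ x, f (x - b) * wdiv G x ≤ (1 + ε) * c := by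
  obtain ⟨c0, hc0, hKc⟩ : ∃ c0 > 0, ∀ x ∈ K, c0 ≤ height x := by
    rcases K.eq_empty_or_nonempty with rfl | hne
    · exact ⟨1, one_pos, by simp⟩
    · obtain ⟨x0, hx0, hmin⟩ := hK.exists_isMinOn hne continuous_height.continuousOn
      exact ⟨height x0, hA' (hKA hx0), fun x hx => hmin hx⟩
  obtain ⟨r0, hr0, hth⟩ := hK.exists_cthickening_subset_open hA hKA
  have hlim : Tendsto (fun r : ℝ => (1 + r / c0) ^ n) (𝓝[>] 0) (𝓝 1) := by
    have : Continuous (fun r : ℝ => (1 + r / c0) ^ n) := by fun_prop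
    simpa using (this.tendsto 0).mono_left nhdsWithin_le_nhds
  -- `1 + r / c0` will bound the ratio of heights before and after the translation, and its `n`-th
  -- power has to stay below `1 + ε`; `r ≤ r0` keeps the translated support inside `A`.
  obtain ⟨r, ⟨hr1, hr2⟩, hr3⟩ := ((hlim.eventually (gt_mem_nhds (show (1:ℝ) < 1 + ε by linarith))).and
    (Ioc_mem_nhdsGT hr0)).and self_mem_nhdsWithin |>.exists
  refine ⟨r, hr3, fun f c hc G hG hGK b hb => ?_⟩
  set Y : Space n → Space n := fun y => weight y • G y with hY
  have hF := hG.isField hA'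
  have hYK : tsupport Y ⊆ K := (tsupport_smul_field_subset _ _).trans hGK
  -- The factor `height x ^ n` cancels the weight at the new position, so the weighted field is
  -- exactly a multiple of the translated weighted field; `(1 + ε)⁻¹` restores the length bound.
  set Gb : Space n → Space n := fun x => ((1 + ε)⁻¹ * height x ^ n) • Y (x + b) with hGb
  have hsupp : tsupport (fun x => Y (x + b)) ⊆ (fun x => x + b) ⁻¹' K := by
    refine closure_minimal (fun x hx => hYK (subset_tsupport _ hx)) ?_
    exact hK.isClosed.preimage (continuous_id.add continuous_const)
  have hpre : (fun x => x + b) ⁻¹' K ⊆ A := fun x hx => hth <| by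
    refine Metric.mem_cthickening_of_dist_le x (x + b) r0 K hx ?_
    simpa [dist_eq_norm] using hb.trans hr2.2
  have hcomp : HasCompactSupport (fun x => Y (x + b)) :=
    hF.weighted_compact.comp_homeomorph (Homeomorph.addRight b)
  have hGbT : IsTestField A Gb := by
    refine ⟨?_, hasCompactSupport_smul_field _ hcomp,
      (tsupport_smul_field_subset _ _).trans (hsupp.trans hpre), fun x => ?_⟩
    · exact (contDiff_const.mul (contDiff_height.pow n)).smul
        (hF.weighted_contDiff.comp (contDiff_id.add contDiff_const))
    · by_cases hx : x + b ∈ K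
      · have h1 : 0 < height x := hA' (hpre hx)
        have h2 := hKc _ hx
        have h3 : 0 < height (x + b) := hc0.trans_le h2
        have h4 : height x ≤ height (x + b) + r := by
          have := abs_height_le b
          simp only [height_add]
          linarith [neg_abs_le (height b)]
        have h5 : height x / height (x + b) ≤ 1 + r / c0 := by
          rw [div_le_iff₀ h3]
          have : r / c0 * height (x + b) ≥ r := by
            rw [ge_iff_le, div_mul_eq_mul_div, le_div_iff₀ hc0]
            gcongr
          linarith
        have hnorm : ‖Gb x‖ = (1 + ε)⁻¹ * (height x / height (x + b)) ^ n * ‖G (x + b)‖ := by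
          simp only [hGb, hY, weight, norm_smul]
          rw [Real.norm_of_nonneg (by positivity), Real.norm_of_nonneg (by positivity), div_pow]
          ring
        rw [hnorm]
        have h6 : (1 + ε)⁻¹ * (height x / height (x + b)) ^ n ≤ 1 := by
          rw [inv_mul_le_iff₀ (by positivity), mul_one]
          exact (pow_le_pow_left₀ (by positivity) h5 n).trans hr1.le
        exact mul_le_one₀ h6 (norm_nonneg _) (hG.2.2.2 _)
      · have : Y (x + b) = 0 := image_eq_zero_of_notMem_tsupport fun h => hx (hYK h)
        simp [hGb, this]
  have hw : ∀ x, wdiv Gb x = (1 + ε)⁻¹ * wdiv G (x + b) := by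
    intro x
    have hfun : (fun y => weight y • Gb y) = fun y => (1 + ε)⁻¹ • Y (y + b) := by
      ext1 y
      by_cases hy : y + b ∈ K
      · have h1 : height y ≠ 0 := (hA' (hpre hy)).ne'
        simp only [hGb, weight, smul_smul]
        congr 1
        field_simp
      · have : Y (y + b) = 0 := image_eq_zero_of_notMem_tsupport fun h => hy (hYK h)
        simp [hGb, this]
    simp only [wdiv, hfun]
    exact divergence_translate Y _ b x
  have h := hc Gb hGbT
  have e : pairing f Gb = (1 + ε)⁻¹ * ∫ x, f (x - b) * wdiv G x := by
    rw [← integral_add_right_eq_self (fun x => f (x - b) * wdiv G x) b, ← integral_const_mul]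
    unfold pairing
    refine integral_congr_ae (ae_of_all _ fun x => ?_)
    simp only [hw, add_sub_cancel_right]
    ring
  rw [e, inv_mul_le_iff₀ (by positivity)] at h
  exact h

/-- Since `min s a = (s + a - |s - a|) / 2`, smoothing the absolute value gives a `C¹` approximation
whose slope stays in `[0, 1]`, as needed to interpolate test fields. -/
lemma smoothMin_props (a δ : ℝ) (hδ : 0 < δ) : ∃ q p : ℝ → ℝ,
    (∀ s, q s = (s + a - √((s - a) ^ 2 + δ ^ 2)) / 2) ∧
    ContDiff ℝ 1 q ∧ ContDiff ℝ 1 p ∧ (∀ s, HasDerivAt q (p s) s) ∧ ∀ s, 0 ≤ p s ∧ p s ≤ 1 := by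
  have hpos : ∀ s : ℝ, (s - a) ^ 2 + δ ^ 2 ≠ 0 := fun s => by positivity
  have hsq : ContDiff ℝ 1 fun s : ℝ => √((s - a) ^ 2 + δ ^ 2) :=
    ContDiff.sqrt (by fun_prop) hpos
  have hne : ∀ s : ℝ, √((s - a) ^ 2 + δ ^ 2) ≠ 0 := fun s => (Real.sqrt_pos.2 (by positivity)).ne'
  refine ⟨fun s => (s + a - √((s - a) ^ 2 + δ ^ 2)) / 2,
    fun s => (1 - (s - a) / √((s - a) ^ 2 + δ ^ 2)) / 2, fun s => rfl, ?_, ?_, ?_, ?_⟩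
  · exact ((contDiff_id.add contDiff_const).sub hsq).div_const 2
  · exact (contDiff_const.sub ((contDiff_id.sub contDiff_const).div hsq hne)).div_const 2
  · intro s
    have h1 : HasDerivAt (fun s : ℝ => (s - a) ^ 2 + δ ^ 2) (2 * (s - a)) s := by
      simpa using ((((hasDerivAt_id s).sub_const a).pow 2).add_const (δ ^ 2))
    have h2 := h1.sqrt (hpos s)
    have h3 := ((((hasDerivAt_id s).add_const a).sub h2).div_const 2)
    convert! h3 using 1
    field_simp
  · intro s
    have h : |s - a| ≤ √((s - a) ^ 2 + δ ^ 2) :=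
      Real.abs_le_sqrt (by nlinarith [sq_nonneg δ])
    have h0 : 0 < √((s - a) ^ 2 + δ ^ 2) := (Real.sqrt_pos.2 (by positivity))
    have h1 : |(s - a) / √((s - a) ^ 2 + δ ^ 2)| ≤ 1 := by
      rw [abs_div, abs_of_pos h0, div_le_one h0]; exact h
    rw [abs_le] at h1
    constructor <;> linarith [h1.1, h1.2]

/-- Fubini: testing a mollified function amounts to averaging the tests of its translates. -/
lemma integral_convolution_mul {f ρ w : Space n → ℝ} (hf : AEStronglyMeasurable f volume) {M : ℝ}
    (hM : ∀ x, |f x| ≤ M) (hρ : Integrable ρ) (hw : Integrable w) :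
    ∫ x, (convolution ρ f (ContinuousLinearMap.lsmul ℝ ℝ) volume) x * w x
      = ∫ b, ρ b * ∫ x, f (x - b) * w x := by
  have hint : Integrable (fun z : Space n × Space n => ρ z.2 * f (z.1 - z.2) * w z.1)
      (volume.prod volume) := by
    have h1 : Integrable (fun z : Space n × Space n => w z.1 * ρ z.2) (volume.prod volume) :=
      hw.mul_prod hρ
    have h2 : AEStronglyMeasurable (fun z : Space n × Space n => f (z.1 - z.2))
        (volume.prod volume) :=
      hf.comp_quasiMeasurePreserving (quasiMeasurePreserving_sub_of_right_invariant _ _)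
    refine (h1.bdd_mul h2 (ae_of_all _ fun z => hM _)).congr (ae_of_all _ fun z => ?_)
    simp only
    ring
  have := integral_integral_swap (f := fun x b => ρ b * f (x - b) * w x) hint
  simp only [convolution, ContinuousLinearMap.lsmul_apply, smul_eq_mul]
  simp_rw [← integral_mul_const, ← integral_const_mul]
  rw [this]
  simp only [mul_assoc]

/-- The coarea inequality, for the splitting of a function at one level. -/
theorem coarea_le {A : Set (Space n)} (hA : IsOpen A) (hA' : A ⊆ upperHalf n) {f : Space n → ℝ}
    (hf : AEStronglyMeasurable f volume) {M : ℝ} (hM : ∀ x, |f x| ≤ M) {c : ℝ}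
    (hc : ∀ g, IsTestField A g → pairing f g ≤ c) (a : ℝ) {g₁ g₂ : Space n → Space n}
    (hg₁ : IsTestField A g₁) (hg₂ : IsTestField A g₂) :
    pairing (fun x => min (f x) a) g₁ + pairing (fun x => f x - min (f x) a) g₂ ≤ c := by
  have hF₁ := hg₁.isField hA'
  have hF₂ := hg₂.isField hA'
  have hc0 : 0 ≤ c := by simpa using hc _ (isTestField_zero A)
  have hM0 : 0 ≤ M := (abs_nonneg _).trans (hM 0)
  have hδ : ∀ k : ℕ, (0 : ℝ) < 1 / ((k : ℝ) + 1) := fun k => by positivity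
  let φ : ℕ → ContDiffBump (0 : Space n) := fun k =>
    ⟨(1 / ((k : ℝ) + 1)) / 2, 1 / ((k : ℝ) + 1), half_pos (hδ k), half_lt_self (hδ k)⟩
  have hlim0 : Tendsto (fun k : ℕ => 1 / ((k : ℝ) + 1)) atTop (𝓝 0) :=
    tendsto_one_div_add_atTop_nhds_zero_nat
  have hloc : LocallyIntegrable f volume :=
    (locallyIntegrable_const M).mono hf (ae_of_all _ fun x => by
      simpa [abs_of_nonneg hM0] using hM x)
  set F : ℕ → Space n → ℝ := fun k =>
    convolution ((φ k).normed volume) f (ContinuousLinearMap.lsmul ℝ ℝ) volume with hFdef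
  have hFlim : ∀ᵐ x, Tendsto (fun k => F k x) atTop (𝓝 (f x)) :=
    ContDiffBump.ae_convolution_tendsto_right_of_locallyIntegrable (K := 2) hlim0
      (Eventually.of_forall fun k => by simp only [φ]; linarith) hloc
  have hFsm : ∀ k, ContDiff ℝ 1 (F k) := fun k =>
    ((φ k).hasCompactSupport_normed.contDiff_convolution_left _ (φ k).contDiff_normed hloc :
      ContDiff ℝ ((1 : ℕ∞) : WithTop ℕ∞) (F k))
  have hFM : ∀ k x, |F k x| ≤ M := by
    intro k x
    have h1 : ‖F k x‖ ≤ ∫ t, (φ k).normed volume t * M := by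
      refine norm_integral_le_of_norm_le ((φ k).integrable_normed.mul_const M)
        (ae_of_all _ fun t => ?_)
      simp only [ContinuousLinearMap.lsmul_apply, smul_eq_mul, norm_mul,
        Real.norm_of_nonneg ((φ k).nonneg_normed t)]
      exact mul_le_mul_of_nonneg_left (hM _) ((φ k).nonneg_normed t)
    rwa [integral_mul_const, (φ k).integral_normed, one_mul] at h1
  choose q p hq hqs hps hqp hp01 using fun k : ℕ => smoothMin_props a (1 / ((k : ℝ) + 1)) (hδ k)
  have hqlim : ∀ᵐ x, Tendsto (fun k => q k (F k x)) atTop (𝓝 (min (f x) a)) := by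
    filter_upwards [hFlim] with x hx
    have hcont : Continuous fun z : ℝ × ℝ => (z.1 + a - √((z.1 - a) ^ 2 + z.2 ^ 2)) / 2 := by
      fun_prop
    have h := (hcont.tendsto (f x, 0)).comp (hx.prodMk_nhds hlim0)
    have e : (f x + a - √((f x - a) ^ 2 + 0 ^ 2)) / 2 = min (f x) a := by
      rw [zero_pow two_ne_zero, add_zero, Real.sqrt_sq_eq_abs]
      rcases le_total (f x) a with h | h
      · rw [min_eq_left h, abs_of_nonpos (by linarith)]; ring
      · rw [min_eq_right h, abs_of_nonneg (by linarith)]; ring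
    simp only [e] at h
    refine h.congr fun k => ?_
    simp [hq]
  have hqM : ∀ k x, |q k (F k x)| ≤ M + |a| + 1 := by
    intro k x
    have h1 := hFM k x
    have hd : (1 / ((k : ℝ) + 1)) ≤ 1 := by
      rw [div_le_one (by positivity)]; linarith [Nat.cast_nonneg (α := ℝ) k]
    have h2 : √((F k x - a) ^ 2 + (1 / ((k : ℝ) + 1)) ^ 2) ≤ |F k x| + |a| + 1 := by
      refine Real.sqrt_le_iff.2 ⟨by positivity, ?_⟩
      have h3 : (F k x - a) ^ 2 ≤ (|F k x| + |a|) ^ 2 :=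
        sq_le_sq' (by linarith [neg_abs_le (F k x), le_abs_self a])
          (by linarith [le_abs_self (F k x), neg_abs_le a])
      have h4 : (1 / ((k : ℝ) + 1)) ^ 2 ≤ 1 := pow_le_one₀ (hδ k).le hd
      nlinarith [abs_nonneg (F k x), abs_nonneg a]
    have h5 := Real.sqrt_nonneg ((F k x - a) ^ 2 + (1 / ((k : ℝ) + 1)) ^ 2)
    rw [hq, abs_le]
    constructor
    · linarith [neg_abs_le (F k x), neg_abs_le a]
    · linarith [le_abs_self (F k x), le_abs_self a]
  have hmeas : ∀ k, AEStronglyMeasurable (F k) volume := fun k =>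
    (hFsm k).continuous.aestronglyMeasurable
  have hqmeas : ∀ k, AEStronglyMeasurable (fun x => q k (F k x)) volume := fun k =>
    ((hqs k).continuous.comp (hFsm k).continuous).aestronglyMeasurable
  have hL1 := tendsto_pairing hF₁ hqmeas hqM hqlim
  have hL2 : Tendsto (fun k => pairing (fun x => F k x - q k (F k x)) g₂) atTop
      (𝓝 (pairing (fun x => f x - min (f x) a) g₂)) := by
    refine tendsto_pairing hF₂ (fun k => (hmeas k).sub (hqmeas k)) (M := M + (M + |a| + 1))
      (fun k x => ?_) ?_
    · exact (abs_sub _ _).trans (add_le_add (hFM k x) (hqM k x))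
    · filter_upwards [hFlim, hqlim] with x h1 h2
      exact h1.sub h2
  have hkey : ∀ ε > 0, ∀ᶠ k in atTop, pairing (fun x => q k (F k x)) g₁
      + pairing (fun x => F k x - q k (F k x)) g₂ ≤ (1 + ε) * c := by
    intro ε hε
    -- The interpolated fields below depend on `k`, but their supports stay in this one compact set,
    -- so a single radius serves every `k`.
    obtain ⟨r, hr, hrad⟩ := exists_radius_translate_le hA hA' (hg₁.2.1.isCompact.union hg₂.2.1.isCompact)
      (union_subset hg₁.2.2.1 hg₂.2.2.1) hε
    filter_upwards [hlim0.eventually (gt_mem_nhds hr)] with k hk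
    have hpk : ContDiff ℝ 1 (fun x => p k (F k x)) := (hps k).comp (hFsm k)
    -- By `pairing_comp`, this single admissible field sees in `F k` what `g₁` sees in the smoothed
    -- truncation plus what `g₂` sees in the remainder.
    set G : Space n → Space n := fun x => p k (F k x) • g₁ x + (1 - p k (F k x)) • g₂ x with hG
    have hGT : IsTestField A G := IsTestField.combine hpk (fun x => (hp01 k _).1)
      (fun x => (hp01 k _).2) hg₁ hg₂ ((tsupport_smul_field_subset _ _).trans hg₁.2.2.1)
      ((tsupport_smul_field_subset _ _).trans hg₂.2.2.1)
    have hGs : tsupport G ⊆ tsupport g₁ ∪ tsupport g₂ :=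
      (tsupport_add _ _).trans (union_subset_union (tsupport_smul_field_subset _ _)
        (tsupport_smul_field_subset _ _))
    have e1 := pairing_comp (hFsm k) (hqs k) (hps k) (hqp k) hF₁
    have e2 := pairing_comp (hFsm k) (q := fun s => s - q k s) (p := fun s => 1 - p k s)
      (contDiff_id.sub (hqs k)) (contDiff_const.sub (hps k))
      (fun s => (hasDerivAt_id s).sub (hqp k s)) hF₂
    have e3 : pairing (F k) G = pairing (F k) (fun x => p k (F k x) • g₁ x)
        + pairing (F k) (fun x => (1 - p k (F k x)) • g₂ x) :=
      (hF₁.smul hpk).pairing_add_right (hF₂.smul (contDiff_const.sub hpk)) (hmeas k) (hFM k)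
    rw [e1, e2, ← e3]
    have e4 : pairing (F k) G = ∫ b, (φ k).normed volume b * ∫ x, f (x - b) * wdiv G x :=
      integral_convolution_mul hf hM (φ k).integrable_normed (hGT.isField hA').integrable_wdiv
    rw [e4]
    calc ∫ b, (φ k).normed volume b * ∫ x, f (x - b) * wdiv G x
        ≤ ∫ b, (φ k).normed volume b * ((1 + ε) * c) := by
          have hr2 : ∀ b, (φ k).normed volume b * ∫ x, f (x - b) * wdiv G x
              ≤ (φ k).normed volume b * ((1 + ε) * c) := by
            intro b
            by_cases hb : ‖b‖ ≤ r
            · exact mul_le_mul_of_nonneg_left (hrad f c hc G hGT hGs b hb)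
                ((φ k).nonneg_normed b)
            · have : (φ k).normed volume b = 0 := by
                rw [← Function.notMem_support, (φ k).support_normed_eq]
                simp only [Metric.mem_ball, dist_zero_right, not_lt]
                exact hk.le.trans (not_le.1 hb).le
              simp [this]
          by_cases hi : Integrable fun b => (φ k).normed volume b * ∫ x, f (x - b) * wdiv G x
          · exact integral_mono hi ((φ k).integrable_normed.mul_const _) hr2
          -- Integrability in `b` need not be checked: otherwise the integral is 0 by convention,
          -- and the right side is nonnegative because `c` is.
          · rw [integral_undef hi]
            exact integral_nonneg fun b => mul_nonneg ((φ k).nonneg_normed b)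
              (mul_nonneg (by positivity) hc0)
      _ = (1 + ε) * c := by
          rw [integral_mul_const, (φ k).integral_normed, one_mul]
  have hlim := hL1.add hL2
  have : ∀ ε > 0, pairing (fun x => min (f x) a) g₁ + pairing (fun x => f x - min (f x) a) g₂
      ≤ (1 + ε) * c := fun ε hε => le_of_tendsto hlim (hkey ε hε)
  refine le_of_forall_pos_le_add fun ε hε => (this (ε / (c + 1)) (by positivity)).trans ?_
  have : ε / (c + 1) * c ≤ ε := by
    rw [div_mul_eq_mul_div, div_le_iff₀ (by positivity)]
    nlinarith
  linarith

end RadialGraph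
end

noncomputable section
namespace RadialGraph
open Filter Topology

variable {n : ℕ}

/-! ### Indicator functions -/

/-- The indicator function of a set. -/
def chi (E : Set (Space n)) : Space n → ℝ := E.indicator 1

lemma chi_of_mem {E : Set (Space n)} {x : Space n} (h : x ∈ E) : chi E x = 1 := by
  simp [chi, h]

lemma chi_of_notMem {E : Set (Space n)} {x : Space n} (h : x ∉ E) : chi E x = 0 := by
  simp [chi, h]

lemma chi_nonneg (E : Set (Space n)) (x : Space n) : 0 ≤ chi E x := by
  by_cases h : x ∈ E
  · simp [chi_of_mem h]
  · simp [chi_of_notMem h]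

lemma chi_le_one (E : Set (Space n)) (x : Space n) : chi E x ≤ 1 := by
  by_cases h : x ∈ E
  · simp [chi_of_mem h]
  · simp [chi_of_notMem h]

lemma abs_chi_le (E : Set (Space n)) (x : Space n) : |chi E x| ≤ 1 := by
  rw [abs_of_nonneg (chi_nonneg E x)]; exact chi_le_one E x

lemma chi_mono {E F : Set (Space n)} (h : E ⊆ F) (x : Space n) : chi E x ≤ chi F x := by
  by_cases hx : x ∈ E
  · rw [chi_of_mem hx, chi_of_mem (h hx)]
  · rw [chi_of_notMem hx]; exact chi_nonneg F x

lemma chi_congr {E F : Set (Space n)} {x : Space n} (h : x ∈ E ↔ x ∈ F) : chi E x = chi F x := by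
  by_cases hx : x ∈ E
  · rw [chi_of_mem hx, chi_of_mem (h.1 hx)]
  · rw [chi_of_notMem hx, chi_of_notMem (fun h' => hx (h.2 h'))]

lemma chi_ae_eq {E F : Set (Space n)} (h : E =ᵐ[volume] F) : chi E =ᵐ[volume] chi F := by
  filter_upwards [h.mem_iff] with x hx
  exact chi_congr hx

lemma chi_meas {E : Set (Space n)} (hE : NullMeasurableSet E volume) :
    AEStronglyMeasurable (chi E) volume :=
  (aemeasurable_const (b := (1 : ℝ))).indicator₀ hE |>.aestronglyMeasurable

/-! ### Localized submodularity -/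

/-- The value 1 is required on a neighbourhood of `K`, so that the closed support of `(1 - η) • g`
misses `K`. -/
lemma exists_cutoff {K O : Set (Space n)} (hK : IsCompact K) (hO : IsOpen O) (h : K ⊆ O) :
    ∃ η : Space n → ℝ, ContDiff ℝ 1 η ∧ (∀ x, 0 ≤ η x) ∧ (∀ x, η x ≤ 1) ∧
      (∀ᶠ x in 𝓝ˢ K, η x = 1) ∧ HasCompactSupport η ∧ tsupport η ⊆ O := by
  obtain ⟨K', hK', hKK', hK'O⟩ := exists_compact_between hK hO h
  obtain ⟨f, hf1, hf0, hf01⟩ := exists_contMDiffMap_one_nhds_of_subset_interior (n := 1)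
    (modelWithCornersSelf ℝ (Space n)) hK.isClosed hKK'
  have hs : tsupport f ⊆ K' := closure_minimal
    (fun x hx => by_contra fun h => hx (hf0 x h)) hK'.isClosed
  exact ⟨f, f.contMDiff.contDiff, fun x => (hf01 x).1, fun x => (hf01 x).2, hf1,
    hK'.of_isClosed_subset (isClosed_tsupport _) hs, hs.trans hK'O⟩

/-- Supplies a field to splice with others; the supremum itself may not be attained. -/
lemma exists_nearly_optimal {A : Set (Space n)} {f : Space n → ℝ} {c : ℝ}
    (hc : ∀ g, IsTestField A g → pairing f g ≤ c) {ε : ℝ} (hε : 0 < ε) :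
    ∃ G, IsTestField A G ∧ ∀ g, IsTestField A g → pairing f g ≤ pairing f G + ε := by
  set S : Set ℝ := {y | ∃ g, IsTestField A g ∧ y = pairing f g}
  have hne : S.Nonempty := ⟨_, _, isTestField_zero A, rfl⟩
  have hb : BddAbove S := ⟨c, by rintro _ ⟨g, hg, rfl⟩; exact hc g hg⟩
  obtain ⟨_, ⟨G, hG, rfl⟩, h⟩ := exists_lt_of_lt_csSup hne (sub_lt_self (sSup S) hε)
  exact ⟨G, hG, fun g hg => by linarith [le_csSup hb ⟨g, hg, rfl⟩]⟩

lemma tsupport_smul_subset_left (η : Space n → ℝ) (g : Space n → Space n) :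
    tsupport (fun x => η x • g x) ⊆ tsupport η :=
  closure_mono fun x hx hg => hx (by simp [hg])

lemma tsupport_one_sub_smul_disjoint {η : Space n → ℝ} {K : Set (Space n)}
    (h : ∀ᶠ x in 𝓝ˢ K, η x = 1) (g : Space n → Space n) {x : Space n}
    (hx : x ∈ tsupport (fun x => (1 - η x) • g x)) : x ∉ K := by
  intro hK
  refine notMem_tsupport_iff_eventuallyEq.2 ?_ hx
  filter_upwards [h.filter_mono (nhds_le_nhdsSet hK)] with y hy
  simp [hy]

/-- Submodularity of the perimeter for two sets in different domains, whose difference is compactly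
contained in both. -/
theorem submodular_local {A A' : Set (Space n)} (hA : IsOpen A) (hA' : IsOpen A')
    (hAu : A ⊆ upperHalf n) (hAu' : A' ⊆ upperHalf n) {E F D K : Set (Space n)}
    (hE : NullMeasurableSet E volume) (hF : NullMeasurableSet F volume)
    (hDm : NullMeasurableSet D volume) (hK : IsCompact K) (hKA : K ⊆ A ∩ A') (hDK : D ⊆ K)
    (hD : ∀ x ∈ A ∩ A', x ∈ D ↔ x ∈ F ∧ x ∉ E) {cE cF : ℝ}
    (hcE : ∀ g, IsTestField A g → pairing (chi E) g ≤ cE)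
    (hcF : ∀ g, IsTestField A' g → pairing (chi F) g ≤ cF) {g₁ g₂ : Space n → Space n}
    (hg₁ : IsTestField A g₁) (hg₂ : IsTestField A' g₂) :
    pairing (chi (E ∪ D)) g₁ + pairing (chi (F \ D)) g₂ ≤ cE + cF := by
  refine le_of_forall_pos_le_add fun ε hε => ?_
  obtain ⟨η, hη, h0, h1, hη1, -, hηs⟩ := exists_cutoff hK (hA.inter hA') hKA
  have hBu : A ∩ A' ⊆ upperHalf n := inter_subset_left.trans hAu
  set f : Space n → ℝ := fun x => chi E x + chi F x with hf
  have hfm : AEStronglyMeasurable f volume := (chi_meas hE).add (chi_meas hF)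
  have hfM : ∀ x, |f x| ≤ 2 := fun x =>
    (abs_add_le _ _).trans (by linarith [abs_chi_le E x, abs_chi_le F x])
  have hfadd : ∀ g, IsField g → pairing f g = pairing (chi E) g + pairing (chi F) g := fun g hg =>
    hg.pairing_add_left (chi_meas hE) (abs_chi_le E) (chi_meas hF) (abs_chi_le F)
  have hfc : ∀ g, IsTestField (A ∩ A') g → pairing f g ≤ cE + cF := fun g hg => by
    rw [hfadd g (hg.isField hBu)]
    exact add_le_add (hcE g (hg.mono inter_subset_left)) (hcF g (hg.mono inter_subset_right))
  -- `G` fills in away from `K`, where nothing changes. The coarea inequality tests the sum with `η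
  -- g₁ + (1 - η) G` and `η g₂ + (1 - η) G` on the common domain. The complementary fields `η G + (1
  -- - η) g₁` and `η G + (1 - η) g₂` test `E` in `A` and `F` in `A'`. On adding up, all terms with
  -- `G` cancel up to `ε`.
  obtain ⟨G, hG, hGopt⟩ := exists_nearly_optimal hfc hε
  have hη' : ContDiff ℝ 1 fun x => 1 - η x := contDiff_const.sub hη
  have hGF := hG.isField hBu
  have hF₁ := hg₁.isField hAu
  have hF₂ := hg₂.isField hAu'
  have hGs : ∀ C, A ∩ A' ⊆ C → tsupport (fun x => (1 - η x) • G x) ⊆ C := fun C h =>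
    (tsupport_smul_field_subset _ _).trans (hG.2.2.1.trans h)
  have ha₁ : IsTestField (A ∩ A') (fun x => η x • g₁ x + (1 - η x) • G x) :=
    IsTestField.combine hη h0 h1 hg₁ hG ((tsupport_smul_subset_left _ _).trans hηs) (hGs _ le_rfl)
  have ha₂ : IsTestField (A ∩ A') (fun x => η x • g₂ x + (1 - η x) • G x) :=
    IsTestField.combine hη h0 h1 hg₂ hG ((tsupport_smul_subset_left _ _).trans hηs) (hGs _ le_rfl)
  have hmin : AEStronglyMeasurable (fun x => min (f x) 1) volume :=
    hfm.inf aestronglyMeasurable_const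
  have hf0 : ∀ x, 0 ≤ f x := fun x => add_nonneg (chi_nonneg E x) (chi_nonneg F x)
  have hminM : ∀ x, |min (f x) 1| ≤ 1 := fun x => by
    rw [abs_of_nonneg (le_min (hf0 x) zero_le_one)]; exact min_le_right _ _
  have hmax : AEStronglyMeasurable (fun x => f x - min (f x) 1) volume := hfm.sub hmin
  have hmaxM : ∀ x, |f x - min (f x) 1| ≤ 3 := fun x =>
    (abs_sub _ _).trans (by linarith [hfM x, hminM x])
  have hco := coarea_le (hA.inter hA') hBu hfm hfM hGopt 1 ha₁ ha₂
  rw [(hF₁.smul hη).pairing_add_right (hGF.smul hη') hmin hminM,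
    (hF₂.smul hη).pairing_add_right (hGF.smul hη') hmax hmaxM] at hco
  have hsplit : pairing f (fun x => (1 - η x) • G x)
      = pairing (fun x => min (f x) 1) (fun x => (1 - η x) • G x)
        + pairing (fun x => f x - min (f x) 1) (fun x => (1 - η x) • G x) := by
    rw [← (hGF.smul hη').pairing_add_left hmin hminM hmax hmaxM]
    simp
  have hadd : ∀ (u : Space n → ℝ) (_ : AEStronglyMeasurable u volume) (M : ℝ)
      (_ : ∀ x, |u x| ≤ M) (g : Space n → Space n) (_ : IsField g), pairing u g
        = pairing u (fun x => η x • g x) + pairing u (fun x => (1 - η x) • g x) := by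
    intro u hu M hM g hg
    rw [← (hg.smul hη).pairing_add_right (hg.smul hη') hu hM]
    congr 1
    ext1 x
    rw [← add_smul]; simp
  have hGsplit := hadd f hfm 2 hfM G hGF
  have hfηG := hfadd _ (hGF.smul hη)
  have hED : pairing (chi (E ∪ D)) g₁ = pairing (fun x => min (f x) 1) (fun x => η x • g₁ x)
      + pairing (chi E) (fun x => (1 - η x) • g₁ x) := by
    rw [hadd _ (chi_meas (hE.union hDm)) 1 (abs_chi_le _) g₁ hF₁]
    congr 1
    · refine pairing_congr fun x hx => ?_
      have hxB := hηs (tsupport_smul_subset_left _ _ hx)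
      have := hD x hxB
      by_cases h1 : x ∈ E <;> by_cases h2 : x ∈ F <;>
        simp [hf, chi, this, h1, h2]
    · refine pairing_congr fun x hx => ?_
      have hxK := tsupport_one_sub_smul_disjoint hη1 _ hx
      exact chi_congr ⟨fun h => h.resolve_right fun h' => hxK (hDK h'), Or.inl⟩
  have hFD : pairing (chi (F \ D)) g₂ = pairing (fun x => f x - min (f x) 1) (fun x => η x • g₂ x)
      + pairing (chi F) (fun x => (1 - η x) • g₂ x) := by
    rw [hadd _ (chi_meas (hF.diff hDm)) 1 (abs_chi_le _) g₂ hF₂]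
    congr 1
    · refine pairing_congr fun x hx => ?_
      have hxB := hηs (tsupport_smul_subset_left _ _ hx)
      have := hD x hxB
      by_cases h1 : x ∈ E <;> by_cases h2 : x ∈ F <;>
        simp [hf, chi, this, h1, h2]
    · refine pairing_congr fun x hx => ?_
      have hxK := tsupport_one_sub_smul_disjoint hη1 _ hx
      exact chi_congr ⟨fun h => h.1, fun h => ⟨h, fun h' => hxK (hDK h')⟩⟩
  have hEb := hcE _ (IsTestField.combine (C := A) hη h0 h1 hG hg₁
    ((tsupport_smul_field_subset _ _).trans (hG.2.2.1.trans inter_subset_left))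
    ((tsupport_smul_field_subset _ _).trans hg₁.2.2.1))
  have hFb := hcF _ (IsTestField.combine (C := A') hη h0 h1 hG hg₂
    ((tsupport_smul_field_subset _ _).trans (hG.2.2.1.trans inter_subset_right))
    ((tsupport_smul_field_subset _ _).trans hg₂.2.2.1))
  rw [(hGF.smul hη).pairing_add_right (hF₁.smul hη') (chi_meas hE) (abs_chi_le E)] at hEb
  rw [(hGF.smul hη).pairing_add_right (hF₂.smul hη') (chi_meas hF) (abs_chi_le F)] at hFb
  linarith

/-- Submodularity of the perimeter. -/
theorem submodular {A : Set (Space n)} (hA : IsOpen A) (hAu : A ⊆ upperHalf n)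
    {E F : Set (Space n)} (hE : NullMeasurableSet E volume) (hF : NullMeasurableSet F volume)
    {cE cF : ℝ} (hcE : ∀ g, IsTestField A g → pairing (chi E) g ≤ cE)
    (hcF : ∀ g, IsTestField A g → pairing (chi F) g ≤ cF) {g₁ g₂ : Space n → Space n}
    (hg₁ : IsTestField A g₁) (hg₂ : IsTestField A g₂) :
    pairing (chi (E ∪ F)) g₁ + pairing (chi (E ∩ F)) g₂ ≤ cE + cF := by
  have hfM : ∀ x, |chi E x + chi F x| ≤ 2 := fun x =>
    (abs_add_le _ _).trans (by linarith [abs_chi_le E x, abs_chi_le F x])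
  have h := coarea_le hA hAu (f := fun x => chi E x + chi F x) ((chi_meas hE).add (chi_meas hF))
    hfM (c := cE + cF) (fun g hg => by
      rw [(hg.isField hAu).pairing_add_left (chi_meas hE) (abs_chi_le E) (chi_meas hF)
        (abs_chi_le F)]
      exact add_le_add (hcE g hg) (hcF g hg)) 1 hg₁ hg₂
  have e1 : chi (E ∪ F) = fun x => min (chi E x + chi F x) 1 := by
    ext1 x
    by_cases h1 : x ∈ E <;> by_cases h2 : x ∈ F <;> simp [chi, h1, h2]
  have e2 : chi (E ∩ F) = fun x => chi E x + chi F x - min (chi E x + chi F x) 1 := by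
    ext1 x
    by_cases h1 : x ∈ E <;> by_cases h2 : x ∈ F <;> simp [chi, h1, h2]
  rw [e1, e2]
  exact h

end RadialGraph
end

noncomputable section
namespace RadialGraph
open Filter Topology

variable {n : ℕ}

/-! ### Nested convex sets in a Hilbert space -/

/-- The points of least norm in the `C j` have increasing bounded norms, and the parallelogram law
makes them a Cauchy sequence. This takes the place of weak compactness. -/
lemma nonempty_iInter_of_convex {E : Type*} [NormedAddCommGroup E] [InnerProductSpace ℝ E]
    [CompleteSpace E] {C : ℕ → Set E} (hne : ∀ j, (C j).Nonempty) (hcl : ∀ j, IsClosed (C j))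
    (hcv : ∀ j, Convex ℝ (C j)) (hanti : Antitone C) {R : ℝ} (hR : ∀ x ∈ C 0, ‖x‖ ≤ R) :
    ∃ x, ∀ j, x ∈ C j := by
  have hmin : ∀ j, ∃ x ∈ C j, ∀ w ∈ C j, ‖x‖ ≤ ‖w‖ := by
    intro j
    obtain ⟨x, hx, hxe⟩ := exists_norm_eq_iInf_of_complete_convex (hne j) (hcl j).isComplete
      (hcv j) 0
    refine ⟨x, hx, fun w hw => ?_⟩
    have hb : BddBelow (range fun w : C j => ‖(0 : E) - w‖) :=
      ⟨0, by rintro _ ⟨w, rfl⟩; exact norm_nonneg _⟩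
    have := ciInf_le hb ⟨w, hw⟩
    simp only [zero_sub, norm_neg] at hxe this
    exact hxe.le.trans this
  choose x hx hxm using hmin
  have hmono : Monotone fun j => ‖x j‖ ^ 2 := fun i j hij =>
    pow_le_pow_left₀ (norm_nonneg _) (hxm i _ (hanti hij (hx j))) 2
  have hbdd : BddAbove (range fun j => ‖x j‖ ^ 2) := ⟨R ^ 2, by
    rintro _ ⟨j, rfl⟩
    exact pow_le_pow_left₀ (norm_nonneg _) (hR _ (hanti (Nat.zero_le j) (hx j))) 2⟩
  set L := ⨆ j, ‖x j‖ ^ 2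
  have hL : Tendsto (fun j => ‖x j‖ ^ 2) atTop (𝓝 L) := tendsto_atTop_ciSup hmono hbdd
  have hd : ∀ i j, i ≤ j → dist (x i) (x j) ≤ √(2 * (L - ‖x i‖ ^ 2)) := by
    intro i j hij
    refine Real.le_sqrt_of_sq_le ?_
    have hmid : (1 / 2 : ℝ) • x i + (1 / 2 : ℝ) • x j ∈ C i :=
      hcv i (hx i) (hanti hij (hx j)) (by norm_num) (by norm_num) (by norm_num)
    have h1 := hxm i _ hmid
    rw [← smul_add, norm_smul, Real.norm_of_nonneg (by norm_num)] at h1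
    have h2 := parallelogram_law_with_norm ℝ (x i) (x j)
    have h3 : ‖x j‖ ^ 2 ≤ L := le_ciSup hbdd j
    rw [dist_eq_norm]
    nlinarith [norm_nonneg (x i), norm_nonneg (x i + x j)]
  have hlim : Tendsto (fun j => √(2 * (L - ‖x j‖ ^ 2))) atTop (𝓝 0) := by
    have := ((tendsto_const_nhds (x := L)).sub hL).const_mul 2
    rw [sub_self, mul_zero] at this
    have h := (Real.continuous_sqrt.tendsto _).comp this
    rwa [Real.sqrt_zero] at h
  obtain ⟨y, hy⟩ := cauchySeq_tendsto_of_complete (cauchySeq_of_le_tendsto_0' _ hd hlim)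
  exact ⟨y, fun j => (hcl j).mem_of_tendsto hy
    ((eventually_ge_atTop j).mono fun i hi => hanti hi (hx i))⟩

/-! ### The relaxed functional -/

/-- The density `x_{n+1}^{-(n+1)}` of the hyperbolic volume in `A`. -/
def volDensity (A : Set (Space n)) : Space n → ℝ :=
  A.indicator fun x => ((height x) ^ (n + 1))⁻¹

/-- The domains on which the functional is studied. -/
structure IsDomain (A : Set (Space n)) : Prop where
  isOpen : IsOpen A
  upper : A ⊆ upperHalf n
  finite : volume A < ⊤
  bounded : ∃ c, ∀ x ∈ A, ((height x) ^ (n + 1))⁻¹ ≤ c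

/-- `∫ f (div (x_{n+1}^{-n} g) + κ x_{n+1}^{-(n+1)})`. -/
def fieldEnergy (κ : ℝ) (A : Set (Space n)) (f : Space n → ℝ) (g : Space n → Space n) : ℝ :=
  ∫ x, f x * (wdiv g x + κ * volDensity A x)

/-- The relaxed functional is at most `c` at `f`. -/
def EnergyLE (κ : ℝ) (A : Set (Space n)) (f : Space n → ℝ) (c : ℝ) : Prop :=
  ∀ g, IsTestField A g → fieldEnergy κ A f g ≤ c

/-- Measurable functions between two indicator functions. -/
structure Adm (V₁ V₂ : Set (Space n)) (f : Space n → ℝ) : Prop where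
  meas : AEStronglyMeasurable f volume
  lower : ∀ x, chi V₁ x ≤ f x
  upper : ∀ x, f x ≤ chi V₂ x

/-- Minimizers of the relaxed functional, with minimal value `m`. -/
structure IsRelaxedMin (κ : ℝ) (A V₁ V₂ : Set (Space n)) (m : ℝ) (f : Space n → ℝ) : Prop where
  adm : Adm V₁ V₂ f
  le : EnergyLE κ A f m

/-- `m` is a lower bound for the relaxed functional. -/
def LowerBound (κ : ℝ) (A V₁ V₂ : Set (Space n)) (m : ℝ) : Prop :=
  ∀ f c, Adm V₁ V₂ f → EnergyLE κ A f c → m ≤ c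

section

variable {κ m : ℝ} {A V₁ V₂ : Set (Space n)} {f f' : Space n → ℝ} {g : Space n → Space n}

lemma Adm.nonneg (h : Adm V₁ V₂ f) (x : Space n) : 0 ≤ f x := (chi_nonneg _ x).trans (h.lower x)
lemma Adm.le_one (h : Adm V₁ V₂ f) (x : Space n) : f x ≤ 1 := (h.upper x).trans (chi_le_one _ x)
lemma Adm.abs_le (h : Adm V₁ V₂ f) (x : Space n) : |f x| ≤ 1 := by
  rw [abs_of_nonneg (h.nonneg x)]; exact h.le_one x
lemma Adm.eq_one (h : Adm V₁ V₂ f) {x : Space n} (hx : x ∈ V₁) : f x = 1 :=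
  le_antisymm (h.le_one x) (by simpa [chi_of_mem hx] using h.lower x)
lemma Adm.eq_zero (h : Adm V₁ V₂ f) {x : Space n} (hx : x ∉ V₂) : f x = 0 :=
  le_antisymm (by simpa [chi_of_notMem hx] using h.upper x) (h.nonneg x)

lemma Adm.of_values (hm : AEStronglyMeasurable f volume) (h0 : ∀ x, 0 ≤ f x) (h1 : ∀ x, f x ≤ 1)
    (hl : ∀ x ∈ V₁, f x = 1) (hu : ∀ x, x ∉ V₂ → f x = 0) : Adm V₁ V₂ f where
  meas := hm
  lower x := by
    by_cases hx : x ∈ V₁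
    · rw [chi_of_mem hx, hl x hx]
    · rw [chi_of_notMem hx]; exact h0 x
  upper x := by
    by_cases hx : x ∈ V₂
    · rw [chi_of_mem hx]; exact h1 x
    · rw [chi_of_notMem hx, hu x hx]

lemma adm_chi {E : Set (Space n)} (hE : NullMeasurableSet E volume) (h1 : V₁ ⊆ E) (h2 : E ⊆ V₂) :
    Adm V₁ V₂ (chi E) := ⟨chi_meas hE, chi_mono h1, chi_mono h2⟩

lemma IsDomain.volDensity_nonneg (hA : IsDomain A) (x : Space n) : 0 ≤ volDensity A x :=
  indicator_nonneg (fun _ hy => inv_nonneg.2 (pow_pos (hA.upper hy) _).le) x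

lemma IsDomain.memLp_volDensity (hA : IsDomain A) (p : ENNReal) :
    MemLp (volDensity A) p volume := by
  obtain ⟨c, hc⟩ := hA.bounded
  have : IsFiniteMeasure (volume.restrict A) := ⟨by simpa using hA.finite⟩
  unfold volDensity
  rw [memLp_indicator_iff_restrict hA.isOpen.measurableSet]
  refine MemLp.of_bound ?_ c ?_
  · exact ((measurable_inv.comp ((continuous_height (n := n)).measurable.pow_const
      (n + 1)))).aestronglyMeasurable
  · refine (ae_restrict_mem hA.isOpen.measurableSet).mono fun x hx => ?_
    rw [Real.norm_of_nonneg (inv_nonneg.2 (pow_pos (hA.upper hx) _).le)]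
    exact hc x hx

lemma IsDomain.integrable_volDensity (hA : IsDomain A) : Integrable (volDensity A) volume :=
  memLp_one_iff_integrable.1 (hA.memLp_volDensity 1)

lemma IsField.memLp_wdiv (hg : IsField g) (p : ENNReal) : MemLp (wdiv g) p volume :=
  hg.continuous_wdiv.memLp_of_hasCompactSupport hg.compact_wdiv

lemma IsDomain.integrable_kernel (hA : IsDomain A) (κ : ℝ) (hg : IsTestField A g) :
    Integrable (fun x => wdiv g x + κ * volDensity A x) volume :=
  (hg.isField hA.upper).integrable_wdiv.add (hA.integrable_volDensity.const_mul κ)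

lemma IsDomain.integrable_mul_kernel (hA : IsDomain A) (κ : ℝ) (hg : IsTestField A g)
    (hf : AEStronglyMeasurable f volume) {M : ℝ} (hM : ∀ x, |f x| ≤ M) :
    Integrable (fun x => f x * (wdiv g x + κ * volDensity A x)) volume :=
  (hA.integrable_kernel κ hg).bdd_mul hf (ae_of_all _ hM)

lemma IsDomain.integrable_mul_volDensity (hA : IsDomain A)
    (hf : AEStronglyMeasurable f volume) {M : ℝ} (hM : ∀ x, |f x| ≤ M) :
    Integrable (fun x => f x * volDensity A x) volume :=
  hA.integrable_volDensity.bdd_mul hf (ae_of_all _ hM)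

lemma fieldEnergy_eq (hA : IsDomain A) (hg : IsTestField A g)
    (hf : AEStronglyMeasurable f volume) {M : ℝ} (hM : ∀ x, |f x| ≤ M) :
    fieldEnergy κ A f g = pairing f g + κ * ∫ x, f x * volDensity A x := by
  unfold fieldEnergy pairing
  rw [← integral_const_mul, ← integral_add ((hg.isField hA.upper).integrable_mul_wdiv hf hM)
    ((hA.integrable_mul_volDensity hf hM).const_mul κ)]
  refine integral_congr_ae (ae_of_all _ fun x => ?_)
  ring

lemma fieldEnergy_smul (c : ℝ) : fieldEnergy κ A (fun x => c * f x) g = c * fieldEnergy κ A f g := by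
  unfold fieldEnergy
  rw [← integral_const_mul]
  simp only [mul_assoc]

lemma fieldEnergy_add (hA : IsDomain A) (hg : IsTestField A g)
    (hf : AEStronglyMeasurable f volume) {M : ℝ} (hM : ∀ x, |f x| ≤ M)
    (hf' : AEStronglyMeasurable f' volume) {M' : ℝ} (hM' : ∀ x, |f' x| ≤ M') :
    fieldEnergy κ A (fun x => f x + f' x) g = fieldEnergy κ A f g + fieldEnergy κ A f' g := by
  unfold fieldEnergy
  rw [← integral_add (hA.integrable_mul_kernel κ hg hf hM) (hA.integrable_mul_kernel κ hg hf' hM')]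
  simp only [add_mul]

lemma fieldEnergy_congr_ae (h : f =ᵐ[volume] f') (g : Space n → Space n) :
    fieldEnergy κ A f g = fieldEnergy κ A f' g :=
  integral_congr_ae (h.mono fun x hx => by simp only [hx])

lemma tendsto_fieldEnergy (hA : IsDomain A) (hg : IsTestField A g) {F : ℕ → Space n → ℝ}
    (hF : ∀ k, AEStronglyMeasurable (F k) volume) {M : ℝ} (hM : ∀ k x, |F k x| ≤ M)
    (h : ∀ᵐ x, Tendsto (fun k => F k x) atTop (𝓝 (f x))) :
    Tendsto (fun k => fieldEnergy κ A (F k) g) atTop (𝓝 (fieldEnergy κ A f g)) := by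
  have hk := hA.integrable_kernel κ hg
  refine tendsto_integral_of_dominated_convergence
    (fun x => M * ‖wdiv g x + κ * volDensity A x‖) (fun k => (hF k).mul hk.aestronglyMeasurable)
    (hk.norm.const_mul M) (fun k => ae_of_all _ fun x => ?_) ?_
  · rw [norm_mul]
    exact mul_le_mul_of_nonneg_right (hM k x) (norm_nonneg _)
  · filter_upwards [h] with x hx
    exact hx.mul_const _

/-- The coarea inequality for the full functional. -/
lemma coarea_energy (hA : IsDomain A) (hf : AEStronglyMeasurable f volume) {M : ℝ}
    (hM : ∀ x, |f x| ≤ M) {c : ℝ} (hc : EnergyLE κ A f c) (a : ℝ) {g₁ g₂ : Space n → Space n}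
    (hg₁ : IsTestField A g₁) (hg₂ : IsTestField A g₂) :
    fieldEnergy κ A (fun x => min (f x) a) g₁
      + fieldEnergy κ A (fun x => f x - min (f x) a) g₂ ≤ c := by
  have hm : AEStronglyMeasurable (fun x => min (f x) a) volume :=
    hf.inf aestronglyMeasurable_const
  have hmM : ∀ x, |min (f x) a| ≤ M + |a| := fun x => by
    rcases min_choice (f x) a with h | h <;> rw [h]
    · linarith [hM x, abs_nonneg a]
    · linarith [(abs_nonneg _).trans (hM x)]
  have hd : AEStronglyMeasurable (fun x => f x - min (f x) a) volume := hf.sub hm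
  have hdM : ∀ x, |f x - min (f x) a| ≤ M + (M + |a|) := fun x =>
    (abs_sub _ _).trans (add_le_add (hM x) (hmM x))
  rw [fieldEnergy_eq hA hg₁ hm hmM, fieldEnergy_eq hA hg₂ hd hdM]
  have h := coarea_le hA.isOpen hA.upper hf hM (c := c - κ * ∫ x, f x * volDensity A x)
    (fun g hg => by
      have := hc g hg
      rw [fieldEnergy_eq hA hg hf hM] at this
      linarith) a hg₁ hg₂
  have hi : ∫ x, f x * volDensity A x = (∫ x, min (f x) a * volDensity A x)
      + ∫ x, (f x - min (f x) a) * volDensity A x := by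
    rw [← integral_add (hA.integrable_mul_volDensity hm hmM)
      (hA.integrable_mul_volDensity hd hdM)]
    refine integral_congr_ae (ae_of_all _ fun x => ?_)
    ring
  rw [hi] at h
  linarith

lemma IsRelaxedMin.of_tendsto (hA : IsDomain A) {F : ℕ → Space n → ℝ}
    (hF : ∀ k, IsRelaxedMin κ A V₁ V₂ m (F k)) (hf : Adm V₁ V₂ f)
    (h : ∀ᵐ x, Tendsto (fun k => F k x) atTop (𝓝 (f x))) : IsRelaxedMin κ A V₁ V₂ m f :=
  ⟨hf, fun g hg => le_of_tendsto
    (tendsto_fieldEnergy hA hg (fun k => (hF k).adm.meas) (fun k => (hF k).adm.abs_le) h)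
    (Eventually.of_forall fun k => (hF k).le g hg)⟩

/-- Splitting a minimizer: if two convex-complementary pieces have total energy at most `m`, both
are minimizers. -/
lemma isRelaxedMin_of_split (hlb : LowerBound κ A V₁ V₂ m) {s t : ℝ} (hs : 0 < s) (ht : 0 < t)
    (hf : Adm V₁ V₂ f) (hf' : Adm V₁ V₂ f')
    (h : ∀ g₁ g₂, IsTestField A g₁ → IsTestField A g₂ →
      s * fieldEnergy κ A f g₁ + t * fieldEnergy κ A f' g₂ ≤ (s + t) * m) :
    IsRelaxedMin κ A V₁ V₂ m f ∧ IsRelaxedMin κ A V₁ V₂ m f' := by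
  constructor
  · refine ⟨hf, fun g₁ hg₁ => ?_⟩
    -- With `g₁` fixed, the hypothesis bounds the energy of `f'` uniformly in `g₂`. This bound is at
    -- least `m`, which rearranges to the desired bound at `g₁`.
    have := hlb f' (((s + t) * m - s * fieldEnergy κ A f g₁) / t) hf' fun g₂ hg₂ => by
      rw [le_div_iff₀ ht]
      linarith [h g₁ g₂ hg₁ hg₂]
    rw [le_div_iff₀ ht] at this
    exact le_of_mul_le_mul_left (by linarith) hs
  · refine ⟨hf', fun g₂ hg₂ => ?_⟩
    have := hlb f (((s + t) * m - t * fieldEnergy κ A f' g₂) / s) hf fun g₁ hg₁ => by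
      rw [le_div_iff₀ hs]
      linarith [h g₁ g₂ hg₁ hg₂]
    rw [le_div_iff₀ hs] at this
    exact le_of_mul_le_mul_left (by linarith) ht

lemma IsRelaxedMin.truncate (hA : IsDomain A) (hlb : LowerBound κ A V₁ V₂ m)
    (hf : IsRelaxedMin κ A V₁ V₂ m f) {t : ℝ} (ht : 0 < t) (ht1 : t < 1) :
    IsRelaxedMin κ A V₁ V₂ m (fun x => t⁻¹ * min (f x) t) ∧
      IsRelaxedMin κ A V₁ V₂ m (fun x => (1 - t)⁻¹ * (f x - min (f x) t)) := by
  have h1t : 0 < 1 - t := sub_pos.2 ht1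
  have hm : AEStronglyMeasurable (fun x => min (f x) t) volume :=
    hf.adm.meas.inf aestronglyMeasurable_const
  refine isRelaxedMin_of_split hlb ht h1t ?_ ?_ fun g₁ g₂ hg₁ hg₂ => ?_
  · refine Adm.of_values (hm.const_mul _) (fun x => ?_) (fun x => ?_) (fun x hx => ?_)
      fun x hx => ?_
    · exact mul_nonneg (by positivity) (le_min (hf.adm.nonneg x) ht.le)
    · rw [inv_mul_le_iff₀ ht, mul_one]; exact min_le_right _ _
    · rw [hf.adm.eq_one hx, min_eq_right ht1.le, inv_mul_cancel₀ ht.ne']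
    · rw [hf.adm.eq_zero hx, min_eq_left ht.le, mul_zero]
  · refine Adm.of_values ((hf.adm.meas.sub hm).const_mul _) (fun x => ?_) (fun x => ?_)
      (fun x hx => ?_) fun x hx => ?_
    · exact mul_nonneg (by positivity) (sub_nonneg.2 (min_le_left _ _))
    · rw [inv_mul_le_iff₀ h1t, mul_one]
      rcases min_choice (f x) t with h | h <;> rw [h]
      · linarith
      · linarith [hf.adm.le_one x]
    · rw [hf.adm.eq_one hx, min_eq_right ht1.le, inv_mul_cancel₀ h1t.ne']
    · rw [hf.adm.eq_zero hx, min_eq_left ht.le, sub_zero, mul_zero]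
  · rw [fieldEnergy_smul, fieldEnergy_smul, mul_inv_cancel_left₀ ht.ne',
      mul_inv_cancel_left₀ h1t.ne']
    have := coarea_energy hA hf.adm.meas hf.adm.abs_le hf.le t hg₁ hg₂
    linarith

/-- Superlevel sets of relaxed minimizers are minimizers. -/
lemma IsRelaxedMin.superlevel (hA : IsDomain A) (hlb : LowerBound κ A V₁ V₂ m)
    (hf : IsRelaxedMin κ A V₁ V₂ m f) {t : ℝ} (ht : 0 < t) (ht1 : t < 1) :
    IsRelaxedMin κ A V₁ V₂ m (chi {x | t < f x}) := by
  -- `F` is positive exactly where `t < f`. Its truncations at levels `1 / (k + 2)`, rescaled to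
  -- height 1, converge to the indicator of that set; the shift by 2 keeps every level below 1.
  set F := fun x => (1 - t)⁻¹ * (f x - min (f x) t) with hF
  have hFm : IsRelaxedMin κ A V₁ V₂ m F := (hf.truncate hA hlb ht ht1).2
  have hs : ∀ k : ℕ, (0 : ℝ) < 1 / ((k : ℝ) + 2) := fun k => by positivity
  have hs1 : ∀ k : ℕ, 1 / ((k : ℝ) + 2) < 1 := fun k => by
    rw [div_lt_one (by positivity)]; linarith [Nat.cast_nonneg (α := ℝ) k]
  have hE : NullMeasurableSet {x | t < f x} volume :=
    nullMeasurableSet_lt aemeasurable_const hf.adm.meas.aemeasurable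
  refine IsRelaxedMin.of_tendsto hA (fun k => (hFm.truncate hA hlb (hs k) (hs1 k)).1)
    (adm_chi hE (fun x hx => ?_) (fun x hx => ?_)) (ae_of_all _ fun x => ?_)
  · simpa [hf.adm.eq_one hx] using ht1
  · by_contra h
    have hx' : t < f x := hx
    rw [hf.adm.eq_zero h] at hx'
    linarith
  · by_cases hx : t < f x
    · rw [chi_of_mem (by exact hx)]
      have hFx : 0 < F x := by
        simp only [hF, min_eq_right hx.le]
        exact mul_pos (inv_pos.2 (sub_pos.2 ht1)) (sub_pos.2 hx)
      have hlim : Tendsto (fun k : ℕ => 1 / ((k : ℝ) + 2)) atTop (𝓝 0) :=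
        tendsto_const_nhds.div_atTop (tendsto_atTop_add_const_right _ _ tendsto_natCast_atTop_atTop)
      refine tendsto_const_nhds.congr' ?_
      filter_upwards [hlim.eventually (gt_mem_nhds hFx)] with k hk
      rw [min_eq_right hk.le, inv_mul_cancel₀ (hs k).ne']
    · rw [chi_of_notMem (by exact hx)]
      have hFx : F x = 0 := by simp [hF, min_eq_left (not_lt.1 hx)]
      simp only [hFx, min_eq_left (hs _).le, mul_zero]
      exact tendsto_const_nhds

/-- Existence of a relaxed minimizer. -/
theorem exists_relaxed_min (hA : IsDomain A) (hV₁ : MeasurableSet V₁) (hV₂ : MeasurableSet V₂)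
    (h12 : V₁ ⊆ V₂) (h2A : V₂ ⊆ A) (κ : ℝ) {f₀ : Space n → ℝ} {c₀ : ℝ} (hf₀ : Adm V₁ V₂ f₀)
    (hc₀ : EnergyLE κ A f₀ c₀) :
    ∃ m f, IsRelaxedMin κ A V₁ V₂ m f ∧ LowerBound κ A V₁ V₂ m := by
  set S : Set ℝ := {c | ∃ f, Adm V₁ V₂ f ∧ EnergyLE κ A f c}
  have hS : S.Nonempty := ⟨c₀, f₀, hf₀, hc₀⟩
  have hSb : BddBelow S := by
    -- Testing with the zero field leaves only the volume term, which is controlled by `0 ≤ f ≤ 1`.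
    refine ⟨-(|κ| * ∫ x, volDensity A x), ?_⟩
    rintro c ⟨f, hf, hc⟩
    have h := hc _ (isTestField_zero A)
    rw [fieldEnergy_eq hA (isTestField_zero A) hf.meas hf.abs_le, pairing_zero_right, zero_add] at h
    have h1 : 0 ≤ ∫ x, f x * volDensity A x :=
      integral_nonneg fun x => mul_nonneg (hf.nonneg x) (hA.volDensity_nonneg x)
    have h2 : ∫ x, f x * volDensity A x ≤ ∫ x, volDensity A x :=
      integral_mono (hA.integrable_mul_volDensity hf.meas hf.abs_le) hA.integrable_volDensity
        fun x => mul_le_of_le_one_left (hA.volDensity_nonneg x) (hf.le_one x)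
    nlinarith [neg_abs_le κ, abs_nonneg κ]
  set m := sInf S
  have hlb : LowerBound κ A V₁ V₂ m := fun f c hf hc => csInf_le hSb ⟨f, hf, hc⟩
  have hfin : ∀ V, MeasurableSet V → V ⊆ A → MemLp (chi V) 2 volume := fun V hV hVA =>
    memLp_indicator_const 2 hV (1 : ℝ) (Or.inr ((measure_mono hVA).trans_lt hA.finite).ne)
  set u₁ : Lp ℝ 2 (volume : Measure (Space n)) := (hfin V₁ hV₁ (h12.trans h2A)).toLp
  set u₂ : Lp ℝ 2 (volume : Measure (Space n)) := (hfin V₂ hV₂ h2A).toLp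
  have hu₁ : u₁ =ᵐ[volume] chi V₁ := MemLp.coeFn_toLp _
  have hu₂ : u₂ =ᵐ[volume] chi V₂ := MemLp.coeFn_toLp _
  have hker : ∀ g, IsTestField A g → MemLp (fun x => wdiv g x + κ * volDensity A x) 2 volume :=
    fun g hg => ((hg.isField hA.upper).memLp_wdiv 2).add ((hA.memLp_volDensity 2).const_mul κ)
  have hinner : ∀ g (hg : IsTestField A g) (f : Lp ℝ 2 (volume : Measure (Space n))),
      inner ℝ ((hker g hg).toLp) f = fieldEnergy κ A f g := by
    intro g hg f
    rw [L2.inner_def]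
    unfold fieldEnergy
    refine integral_congr_ae ?_
    filter_upwards [MemLp.coeFn_toLp (hker g hg)] with x hx
    simp [hx]
  -- Each test field imposes a closed half-space of L², so near-minimizers form closed convex sets,
  -- shrinking with `j`; a common point is a minimizer.
  let C : ℕ → Set (Lp ℝ 2 (volume : Measure (Space n))) := fun j =>
    Icc u₁ u₂ ∩ ⋂ (g) (hg : IsTestField A g),
      {f | inner ℝ ((hker g hg).toLp) f ≤ m + 1 / ((j : ℝ) + 1)}
  -- The order of L² is only almost everywhere; clipping between the two indicators produces a
  -- representative obeying the bounds at every point.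
  have hrep : ∀ f ∈ Icc u₁ u₂, ∃ f', Adm V₁ V₂ f' ∧ f =ᵐ[volume] f' := by
    intro f hf
    refine ⟨fun x => max (chi V₁ x) (min (chi V₂ x) (f x)), ⟨?_, fun x => le_max_left _ _,
      fun x => max_le (chi_mono h12 x) (min_le_left _ _)⟩, ?_⟩
    · exact (chi_meas hV₁.nullMeasurableSet).sup
        ((chi_meas hV₂.nullMeasurableSet).inf (Lp.aestronglyMeasurable f))
    · filter_upwards [hu₁, hu₂, (Lp.coeFn_le _ _).2 hf.1, (Lp.coeFn_le _ _).2 hf.2] with x h1 h2 h3 h4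
      rw [h1] at h3
      rw [h2] at h4
      rw [min_eq_right h4, max_eq_right h3]
  have hCne : ∀ j, (C j).Nonempty := by
    intro j
    have hpos : (0 : ℝ) < 1 / ((j : ℝ) + 1) := by positivity
    obtain ⟨c, ⟨f, hf, hc⟩, hcm⟩ := exists_lt_of_csInf_lt hS (lt_add_of_pos_right m hpos)
    have hfL : MemLp f 2 volume := (hfin V₂ hV₂ h2A).of_le hf.meas (ae_of_all _ fun x => by
      rw [Real.norm_of_nonneg (hf.nonneg x), Real.norm_of_nonneg (chi_nonneg _ x)]
      exact hf.upper x)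
    have hfe : (hfL.toLp : Space n → ℝ) =ᵐ[volume] f := MemLp.coeFn_toLp _
    refine ⟨hfL.toLp, ⟨?_, ?_⟩, ?_⟩
    · rw [← Lp.coeFn_le]
      filter_upwards [hfe, hu₁] with x h1 h2
      rw [h1, h2]; exact hf.lower x
    · rw [← Lp.coeFn_le]
      filter_upwards [hfe, hu₂] with x h1 h2
      rw [h1, h2]; exact hf.upper x
    · simp only [mem_iInter, mem_ofPred_eq]
      intro g hg
      rw [hinner g hg, fieldEnergy_congr_ae hfe]
      exact (hc g hg).trans hcm.le
  have hCcl : ∀ j, IsClosed (C j) := fun j =>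
    isClosed_Icc.inter (isClosed_iInter fun g => isClosed_iInter fun hg =>
      isClosed_le (continuous_const.inner continuous_id) continuous_const)
  have hCcv : ∀ j, Convex ℝ (C j) := by
    intro j
    refine Convex.inter ?_ (convex_iInter fun g => convex_iInter fun hg => ?_)
    · intro x hx y hy a b ha hb hab
      have key : ∀ z : Lp ℝ 2 (volume : Measure (Space n)), z = a • z + b • z := fun z => by
        rw [← add_smul, hab, one_smul]
      have hsm : ∀ (c : ℝ) (_ : 0 ≤ c) (z w : Lp ℝ 2 (volume : Measure (Space n))) (_ : z ≤ w),
          c • z ≤ c • w := by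
        intro c hc z w hzw
        rw [← Lp.coeFn_le] at hzw ⊢
        filter_upwards [hzw, Lp.coeFn_smul c z, Lp.coeFn_smul c w] with x h1 h2 h3
        rw [h2, h3]
        exact mul_le_mul_of_nonneg_left h1 hc
      refine ⟨?_, ?_⟩
      · rw [key u₁]
        exact add_le_add (hsm a ha _ _ hx.1) (hsm b hb _ _ hy.1)
      · rw [key u₂]
        exact add_le_add (hsm a ha _ _ hx.2) (hsm b hb _ _ hy.2)
    · exact convex_halfSpace_le (IsBoundedLinearMap.toIsLinearMap
        (innerSL ℝ ((hker g hg).toLp)).isBoundedLinearMap) _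
  have hCanti : Antitone C := by
    intro i j hij
    refine inter_subset_inter_right _ (iInter_mono fun g => iInter_mono fun hg => ?_)
    intro f hf
    rw [mem_ofPred_eq] at hf ⊢
    refine hf.trans ?_
    have : (i : ℝ) ≤ j := by exact_mod_cast hij
    gcongr
  have hCb : ∀ f ∈ C 0, ‖f‖ ≤ ‖u₂‖ := by
    intro f hf
    refine Lp.norm_le_norm_of_ae_le ?_
    filter_upwards [hu₁, hu₂, (Lp.coeFn_le _ _).2 hf.1.1, (Lp.coeFn_le _ _).2 hf.1.2]
      with x h1 h2 h3 h4
    have h0 : 0 ≤ f x := by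
      rw [h1] at h3
      exact (chi_nonneg _ _).trans h3
    rw [Real.norm_of_nonneg h0, Real.norm_of_nonneg (h0.trans h4)]
    exact h4
  obtain ⟨f, hf⟩ := nonempty_iInter_of_convex hCne hCcl hCcv hCanti hCb
  obtain ⟨f', hf', hff'⟩ := hrep f (hf 0).1
  refine ⟨m, f', ⟨hf', fun g hg => ?_⟩, hlb⟩
  refine le_of_forall_pos_le_add fun ε hε => ?_
  obtain ⟨j, hj⟩ := exists_nat_one_div_lt hε
  have h := (hf j).2
  simp only [mem_iInter, mem_ofPred_eq] at h
  have := h g hg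
  rw [hinner g hg, fieldEnergy_congr_ae hff'] at this
  linarith

end

end RadialGraph
end

noncomputable section
namespace RadialGraph
open Filter Topology

variable {n : ℕ}

/-! ### Sets minimizing the functional -/

/-- Sets between `V₁` and `V₂` with energy at most `m`. -/
structure IsSetMin (κ : ℝ) (A V₁ V₂ : Set (Space n)) (m : ℝ) (E : Set (Space n)) : Prop where
  meas : NullMeasurableSet E volume
  lower : V₁ ⊆ E
  upper : E ⊆ V₂
  le : EnergyLE κ A (chi E) m

section

variable {κ m : ℝ} {A V₁ V₂ E F : Set (Space n)}

lemma IsSetMin.relaxed (h : IsSetMin κ A V₁ V₂ m E) : IsRelaxedMin κ A V₁ V₂ m (chi E) :=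
  ⟨adm_chi h.meas h.lower h.upper, h.le⟩

/-- Volume is additive over union and intersection and perimeter is submodular, so the two energies
add up to at most `2 m`; neither can be below `m`. -/
lemma IsSetMin.union_inter (hA : IsDomain A) (hlb : LowerBound κ A V₁ V₂ m)
    (hE : IsSetMin κ A V₁ V₂ m E) (hF : IsSetMin κ A V₁ V₂ m F) :
    IsSetMin κ A V₁ V₂ m (E ∪ F) ∧ IsSetMin κ A V₁ V₂ m (E ∩ F) := by
  have hU := hE.meas.union hF.meas
  have hI := hE.meas.inter hF.meas
  have hvol : (∫ x, chi (E ∪ F) x * volDensity A x) + ∫ x, chi (E ∩ F) x * volDensity A x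
      = (∫ x, chi E x * volDensity A x) + ∫ x, chi F x * volDensity A x := by
    rw [← integral_add (hA.integrable_mul_volDensity (chi_meas hU) (abs_chi_le _))
      (hA.integrable_mul_volDensity (chi_meas hI) (abs_chi_le _)),
      ← integral_add (hA.integrable_mul_volDensity (chi_meas hE.meas) (abs_chi_le _))
      (hA.integrable_mul_volDensity (chi_meas hF.meas) (abs_chi_le _))]
    refine integral_congr_ae (ae_of_all _ fun x => ?_)
    by_cases h1 : x ∈ E <;> by_cases h2 : x ∈ F <;> simp [chi, h1, h2]
  have hb : ∀ {G : Set (Space n)}, IsSetMin κ A V₁ V₂ m G → ∀ g, IsTestField A g →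
      pairing (chi G) g ≤ m - κ * ∫ x, chi G x * volDensity A x := fun hG g hg => by
    have := hG.le g hg
    rw [fieldEnergy_eq hA hg (chi_meas hG.meas) (abs_chi_le _)] at this
    linarith
  obtain ⟨h1, h2⟩ := isRelaxedMin_of_split hlb one_pos one_pos
    (adm_chi hU (hE.lower.trans subset_union_left) (union_subset hE.upper hF.upper))
    (adm_chi hI (subset_inter hE.lower hF.lower) (inter_subset_left.trans hE.upper))
    (fun g₁ g₂ hg₁ hg₂ => by
      rw [fieldEnergy_eq hA hg₁ (chi_meas hU) (abs_chi_le _),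
        fieldEnergy_eq hA hg₂ (chi_meas hI) (abs_chi_le _)]
      have := submodular hA.isOpen hA.upper hE.meas hF.meas (hb hE) (hb hF) hg₁ hg₂
      linear_combination this + κ * hvol)
  exact ⟨⟨hU, hE.lower.trans subset_union_left, union_subset hE.upper hF.upper, h1.le⟩,
    ⟨hI, subset_inter hE.lower hF.lower, inter_subset_left.trans hE.upper, h2.le⟩⟩

lemma IsSetMin.of_tendsto (hA : IsDomain A) {G : ℕ → Set (Space n)}
    (hG : ∀ k, IsSetMin κ A V₁ V₂ m (G k)) (hE : NullMeasurableSet E volume) (h1 : V₁ ⊆ E)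
    (h2 : E ⊆ V₂) (h : ∀ x, ∀ᶠ k in atTop, x ∈ G k ↔ x ∈ E) : IsSetMin κ A V₁ V₂ m E :=
  ⟨hE, h1, h2, (IsRelaxedMin.of_tendsto hA (fun k => (hG k).relaxed) (adm_chi hE h1 h2)
    (ae_of_all _ fun x => tendsto_const_nhds.congr' <| (h x).mono fun _ hk =>
      (chi_congr hk).symm)).le⟩

lemma IsSetMin.congr_ae (hE : IsSetMin κ A V₁ V₂ m E) (h : E =ᵐ[volume] F) (h1 : V₁ ⊆ F)
    (h2 : F ⊆ V₂) : IsSetMin κ A V₁ V₂ m F :=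
  ⟨hE.meas.congr h, h1, h2, fun g hg => by
    rw [← fieldEnergy_congr_ae (chi_ae_eq h)]; exact hE.le g hg⟩

/-- A set of maximal measure arises as the increasing union of a maximizing sequence. Adjoining any
other set cannot raise its finite measure, so only a null set is added. -/
lemma exists_ae_maximal {α : Type*} [MeasurableSpace α] (μ : Measure α) (P : Set α → Prop)
    (hne : ∃ E, P E) (hnull : ∀ E, P E → NullMeasurableSet E μ)
    (hunion : ∀ E F, P E → P F → P (E ∪ F))
    (hlim : ∀ G : ℕ → Set α, (∀ k, P (G k)) → Monotone G → P (⋃ k, G k))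
    (hfin : ∀ E, P E → μ E < ⊤) : ∃ E, P E ∧ ∀ F, P F → μ (F \ E) = 0 := by
  set S : Set ENNReal := {a | ∃ E, P E ∧ a = μ E}
  have hS : S.Nonempty := let ⟨E, hE⟩ := hne; ⟨_, E, hE, rfl⟩
  obtain ⟨u, -, hu, huS⟩ := exists_seq_tendsto_sSup hS (OrderTop.bddAbove S)
  choose G hG hGu using huS
  have hacc : ∀ k, P (accumulate G k) := by
    intro k
    induction k with
    | zero => simpa using hG 0
    | succ k ih => rw [accumulate_succ]; exact hunion _ _ ih (hG _)
  have hU := hlim _ hacc monotone_accumulate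
  set U := ⋃ k, accumulate G k
  have hUS : sSup S ≤ μ U := le_of_tendsto hu (Eventually.of_forall fun k => by
    rw [hGu k]
    exact measure_mono ((subset_accumulate).trans (subset_iUnion _ k)))
  refine ⟨U, hU, fun F hF => ?_⟩
  have h1 : μ (F ∪ U) ≤ μ U := (le_sSup (show μ (F ∪ U) ∈ S from ⟨_, hunion _ _ hF hU, rfl⟩)).trans hUS
  have h2 : μ (F \ U) + μ U = μ (F ∪ U) := by
    rw [← measure_union₀ (hnull _ hU) disjoint_sdiff_left.aedisjoint, sdiff_union_self]
  rw [← h2] at h1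
  have h3 : μ (F \ U) + μ U ≤ 0 + μ U := by simpa using h1
  exact le_antisymm ((ENNReal.add_le_add_iff_right (hfin _ hU).ne).1 h3) zero_le

/-- There are a largest and a smallest minimizer, up to null sets. -/
theorem exists_extremal (hA : IsDomain A) (h2A : V₂ ⊆ A) (hlb : LowerBound κ A V₁ V₂ m)
    (hE : IsSetMin κ A V₁ V₂ m E) :
    (∃ U, IsSetMin κ A V₁ V₂ m U ∧ ∀ F, IsSetMin κ A V₁ V₂ m F → volume (F \ U) = 0) ∧
      ∃ I, IsSetMin κ A V₁ V₂ m I ∧ ∀ F, IsSetMin κ A V₁ V₂ m F → volume (I \ F) = 0 := by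
  constructor
  · refine exists_ae_maximal volume (IsSetMin κ A V₁ V₂ m) ⟨E, hE⟩ (fun E h => h.meas)
      (fun E F h h' => (h.union_inter hA hlb h').1) (fun G hG hm => ?_)
      (fun E h => (measure_mono (h.upper.trans h2A)).trans_lt hA.finite)
    refine IsSetMin.of_tendsto hA hG (NullMeasurableSet.iUnion fun k => (hG k).meas)
      ((hG 0).lower.trans (subset_iUnion G 0)) (iUnion_subset fun k => (hG k).upper) fun x => ?_
    by_cases hx : x ∈ ⋃ k, G k
    · obtain ⟨k, hk⟩ := mem_iUnion.1 hx
      filter_upwards [eventually_ge_atTop k] with j hj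
      exact iff_of_true (hm hj hk) hx
    · exact Eventually.of_forall fun k => iff_of_false (fun h => hx (mem_iUnion_of_mem k h)) hx
  -- The smallest minimizer is found as the complement in `A` of a largest complement.
  · obtain ⟨U, ⟨I, hI, rfl⟩, hmax⟩ := exists_ae_maximal volume
      (fun F => ∃ E, IsSetMin κ A V₁ V₂ m E ∧ F = A \ E) ⟨_, E, hE, rfl⟩
      (by rintro _ ⟨E, h, rfl⟩; exact hA.isOpen.measurableSet.nullMeasurableSet.diff h.meas)
      (by
        rintro _ _ ⟨E, h, rfl⟩ ⟨F, h', rfl⟩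
        exact ⟨E ∩ F, (h.union_inter hA hlb h').2, by rw [sdiff_inter]⟩)
      (by
        intro G hG hm
        choose B hB hGB using hG
        have hanti : ∀ {i j}, i ≤ j → B j ⊆ B i := fun {i j} hij x hx => by
          by_contra h
          have hxA := h2A ((hB j).upper hx)
          have : x ∈ G i := by rw [hGB i]; exact ⟨hxA, h⟩
          have := hm hij this
          rw [hGB j] at this
          exact this.2 hx
        refine ⟨⋂ k, B k, ?_, ?_⟩
        · refine IsSetMin.of_tendsto hA hB (NullMeasurableSet.iInter fun k => (hB k).meas)
            (subset_iInter fun k => (hB k).lower) ((iInter_subset B 0).trans (hB 0).upper)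
            fun x => ?_
          by_cases hx : x ∈ ⋂ k, B k
          · exact Eventually.of_forall fun k => iff_of_true (mem_iInter.1 hx k) hx
          · obtain ⟨k, hk⟩ := not_forall.1 (fun h => hx (mem_iInter.2 h))
            filter_upwards [eventually_ge_atTop k] with j hj
            exact iff_of_false (fun h => hk (hanti hj h)) hx
        · simp only [hGB, sdiff_iInter])
      (by rintro _ ⟨E, h, rfl⟩; exact (measure_mono sdiff_subset).trans_lt hA.finite)
    refine ⟨I, hI, fun F hF => measure_mono_null (fun x hx => ?_) (hmax _ ⟨F, hF, rfl⟩)⟩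
    exact ⟨⟨h2A (hI.upper hx.1), hx.2⟩, fun h => h.2 hx.1⟩

/-! ### The functional of the statement -/

/-- The volume term is finite and can be moved across the inequality, so the extended-real
functional is governed by real bounds on individual test fields. -/
lemma energy_le_iff (hA : IsDomain A) {H : ℝ} (hE : NullMeasurableSet E volume) {c : ℝ} :
    energy H A E ≤ (c : EReal) ↔ EnergyLE ((n : ℝ) * H) A (chi E) c := by
  have hvol : vol A E = ∫ x, chi E x * volDensity A x := by
    unfold vol
    rw [inter_comm, ← integral_indicator₀
      (hA.isOpen.measurableSet.nullMeasurableSet.inter hE)]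
    refine integral_congr_ae (ae_of_all _ fun x => ?_)
    by_cases h1 : x ∈ A <;> by_cases h2 : x ∈ E <;> simp [chi, volDensity, h1, h2]
  have hpair : ∀ g : Space n → Space n,
      ∫ x in E, divergence (fun y => ((height y) ^ n)⁻¹ • g y) x = pairing (chi E) g := by
    intro g
    rw [← integral_indicator₀ hE]
    unfold pairing wdiv
    refine integral_congr_ae (ae_of_all _ fun x => ?_)
    by_cases h2 : x ∈ E <;> simp [chi, h2, weight]
  have key : energy H A E ≤ (c : EReal) ↔ perimeter A E ≤ ((c - n * H * vol A E : ℝ) : EReal) := by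
    unfold energy
    rw [EReal.coe_sub, EReal.le_sub_iff_add_le (Or.inl (EReal.coe_ne_bot _))
      (Or.inl (EReal.coe_ne_top _))]
  rw [key]
  unfold perimeter
  simp only [iSup_le_iff, EReal.coe_le_coe_iff, hpair]
  refine forall_congr' fun g => forall_congr' fun hg => ?_
  rw [fieldEnergy_eq hA hg (chi_meas hE) (abs_chi_le _), hvol]
  constructor <;> intro h <;> linarith

end

/-! ### Isometries of the half-space: horizontal translations and dilations -/

/-- The vertical unit vector. -/
def north (n : ℕ) : Space n := EuclideanSpace.single (Fin.last n) 1

@[simp] lemma height_north : height (north n) = 1 := by simp [height, north]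

lemma norm_north : ‖north n‖ = 1 := by simp [north]

/-- The action of the half-space on itself: `b` acts by the dilation of ratio `height b` followed by
the translation along the horizontal part of `b`. -/
def act (b x : Space n) : Space n := height b • x + (b - height b • north n)

/-- The inverse for the group law `act`. -/
def actInv (b : Space n) : Space n := (height b)⁻¹ • (north n - b) + north n

@[simp] lemma height_act (b x : Space n) : height (act b x) = height b * height x := by
  simp [act]

/-- Associativity of the group law on the half-space, with neutral element `north n`: a group
element is recorded by the image of the north vector. -/
lemma act_act (b c x : Space n) : act b (act c x) = act (act b c) x := by
  simp only [act, height_add, height_sub, height_smul, height_north]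
  module

@[simp] lemma north_act (x : Space n) : act (north n) x = x := by simp [act]

@[simp] lemma act_north (b : Space n) : act b (north n) = b := by simp [act]

lemma height_actInv {b : Space n} (hb : height b ≠ 0) : height (actInv b) = (height b)⁻¹ := by
  simp only [actInv, height_add, height_smul, height_sub, height_north, mul_sub, mul_one,
    inv_mul_cancel₀ hb]
  ring

lemma act_actInv {b : Space n} (hb : height b ≠ 0) : act b (actInv b) = north n := by
  simp only [act, actInv, smul_add, smul_smul, mul_inv_cancel₀ hb]
  module

lemma actInv_act {b : Space n} (hb : height b ≠ 0) : act (actInv b) b = north n := by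
  rw [act, height_actInv hb, actInv]
  module

lemma act_actInv_act {b : Space n} (hb : height b ≠ 0) (x : Space n) :
    act b (act (actInv b) x) = x := by rw [act_act, act_actInv hb, north_act]

lemma actInv_act_act {b : Space n} (hb : height b ≠ 0) (x : Space n) :
    act (actInv b) (act b x) = x := by rw [act_act, actInv_act hb, north_act]

lemma contDiff_act_right {k : WithTop ℕ∞} (b : Space n) : ContDiff ℝ k (act b) :=
  ((contDiff_const (c := height b)).smul contDiff_id).add
    (contDiff_const (c := b - height b • north n))

lemma continuous_act : Continuous fun z : Space n × Space n => act z.1 z.2 := by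
  unfold act
  have : Continuous fun z : Space n × Space n => height z.1 := continuous_height.comp continuous_fst
  fun_prop

lemma continuous_act_right (b : Space n) : Continuous (act b) := (contDiff_act_right (k := 0) b).continuous

/-- `act b` as a homeomorphism. -/
def actHomeo (b : Space n) (hb : height b ≠ 0) : Space n ≃ₜ Space n where
  toFun := act b
  invFun := act (actInv b)
  left_inv := actInv_act_act hb
  right_inv := act_actInv_act hb
  continuous_toFun := continuous_act_right b
  continuous_invFun := continuous_act_right _

lemma integral_comp_act (F : Space n → ℝ) {b : Space n} (hb : 0 < height b) :
    ∫ x, F (act b x) = (height b ^ (n + 1))⁻¹ * ∫ x, F x := by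
  have h := Measure.integral_comp_smul (volume : Measure (Space n))
    (fun y => F (y + (b - height b • north n))) (height b)
  simp only [act]
  rw [h, integral_add_right_eq_self F, finrank_euclideanSpace_fin,
    abs_of_pos (inv_pos.2 (pow_pos hb _)), smul_eq_mul]

lemma quasiMeasurePreserving_act {b : Space n} (hb : 0 < height b) :
    Measure.QuasiMeasurePreserving (act b) volume volume := by
  refine ⟨(continuous_act_right b).measurable, ?_⟩
  have h1 : Measure.QuasiMeasurePreserving (fun x : Space n => height b • x) volume volume := by
    refine ⟨(continuous_const_smul _).measurable, ?_⟩
    rw [Measure.map_addHaar_smul _ hb.ne']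
    exact Measure.smul_absolutelyContinuous
  exact ((measurePreserving_add_right volume
    (b - height b • north n)).quasiMeasurePreserving.comp h1).absolutelyContinuous

lemma divergence_comp_act (Y : Space n → Space n) (a : ℝ) (c x : Space n) :
    divergence (fun y => a • Y (act c y)) x = a * (height c * divergence Y (act c x)) := by
  have h1 : fderiv ℝ (fun y => a • Y (act c y)) x = a • (height c • fderiv ℝ Y (act c x)) := by
    have e1 := congrFun (fderiv_const_smul_field (𝕜 := ℝ) (f := fun y => Y (act c y)) a) x
    refine e1.trans ?_
    simp only [Pi.smul_apply]
    congr 1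
    have e2 := fderiv_comp_smul (𝕜 := ℝ) (f := fun y => Y (y + (c - height c • north n)))
      (x := x) (height c)
    refine e2.trans ?_
    rw [fderiv_comp_add_right]
    rfl
  simp [divergence, h1, Finset.mul_sum]

/-! ### Invariance of the functional and comparison with isometric copies. -/

section

variable {κ : ℝ} {A : Set (Space n)} {f : Space n → ℝ} {g : Space n → Space n}

lemma IsTestField.comp_act (hg : IsTestField A g) {c : Space n} (hc : 0 < height c) :
    IsTestField {x | act c x ∈ A} (fun x => g (act c x)) := by
  refine ⟨hg.1.comp (contDiff_act_right c), hg.2.1.comp_homeomorph (actHomeo c hc.ne'), ?_,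
    fun x => hg.2.2.2 _⟩
  refine (closure_minimal (t := act c ⁻¹' tsupport g) (fun x hx => subset_tsupport _ hx)
    ((isClosed_tsupport g).preimage (continuous_act_right c))).trans ?_
  exact preimage_mono hg.2.2.1

lemma weight_act (c x : Space n) : weight (act c x) = weight c * weight x := by
  simp [weight, mul_pow, mul_comm]

/-- The derivative contributes one factor `height c` and the weight another `n`. Their product is
the Jacobian of `act c`, whence the invariance of the perimeter. -/
lemma wdiv_comp_act (g : Space n → Space n) {c : Space n} (hc : 0 < height c) (x : Space n) :
    wdiv (fun x => g (act c x)) x = height c ^ (n + 1) * wdiv g (act c x) := by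
  have hfun : (fun y => weight y • g (act c y))
      = fun y => (height c ^ n) • (fun z => weight z • g z) (act c y) := by
    ext1 y
    simp only [weight_act, smul_smul]
    congr 1
    rw [← mul_assoc, weight.eq_1 c, mul_inv_cancel₀ (pow_pos hc n).ne', one_mul]
  rw [wdiv, hfun, divergence_comp_act (fun z => weight z • g z), wdiv]
  ring

lemma volDensity_preimage_act (A : Set (Space n)) {c : Space n} (hc : 0 < height c) (x : Space n) :
    volDensity {x | act c x ∈ A} x = height c ^ (n + 1) * volDensity A (act c x) := by
  by_cases h : act c x ∈ A
  · have h' : x ∈ {x | act c x ∈ A} := h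
    rw [volDensity, indicator_of_mem h', volDensity, indicator_of_mem h, height_act, mul_pow,
      mul_inv, ← mul_assoc, mul_inv_cancel₀ (pow_pos hc (n + 1)).ne', one_mul]
  · have h' : x ∉ {x | act c x ∈ A} := h
    rw [volDensity, indicator_of_notMem h', volDensity, indicator_of_notMem h, mul_zero]

/-- Invariance of the functional under isometries. -/
lemma fieldEnergy_comp_act {c : Space n} (hc : 0 < height c) :
    fieldEnergy κ {x | act c x ∈ A} (fun x => f (act c x)) (fun x => g (act c x))
      = fieldEnergy κ A f g := by
  unfold fieldEnergy
  have h := integral_comp_act (fun x => f x * (wdiv g x + κ * volDensity A x)) hc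
  have h' : ∫ x, f x * (wdiv g x + κ * volDensity A x) = height c ^ (n + 1) *
      ∫ x, f (act c x) * (wdiv g (act c x) + κ * volDensity A (act c x)) := by
    rw [h, ← mul_assoc, mul_inv_cancel₀ (pow_pos hc (n + 1)).ne', one_mul]
  rw [h', ← integral_const_mul]
  refine integral_congr_ae (ae_of_all _ fun x => ?_)
  simp only [wdiv_comp_act g hc, volDensity_preimage_act A hc]
  ring

lemma EnergyLE.comp_act {m : ℝ} {c : Space n} (hc : 0 < height c) (h : EnergyLE κ A f m) :
    EnergyLE κ {x | act c x ∈ A} (fun x => f (act c x)) m := by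
  intro g hg
  have hi : 0 < height (actInv c) := by rw [height_actInv hc.ne']; exact inv_pos.2 hc
  have h1 := hg.comp_act hi
  have h2 : {y | act (actInv c) y ∈ {x | act c x ∈ A}} = A := by
    ext y
    simp [act_actInv_act hc.ne']
  rw [h2] at h1
  have h3 := h _ h1
  rw [← fieldEnergy_comp_act hc] at h3
  simpa only [actInv_act_act hc.ne'] using h3

lemma IsDomain.preimage_act (hA : IsDomain A) {c : Space n} (hc : 0 < height c) :
    IsDomain {x | act c x ∈ A} := by
  refine ⟨hA.isOpen.preimage (continuous_act_right c), fun x hx => ?_, ?_, ?_⟩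
  · have := hA.upper hx
    rw [upperHalf, mem_ofPred_eq, height_act] at this
    exact pos_of_mul_pos_right this hc.le
  · have h1 : {x | act c x ∈ A}
        = (height c • ·) ⁻¹' ((· + (c - height c • north n)) ⁻¹' A) := rfl
    rw [h1, Measure.addHaar_preimage_smul _ hc.ne', measure_preimage_add_right]
    exact ENNReal.mul_lt_top ENNReal.ofReal_lt_top hA.finite
  · obtain ⟨k, hk⟩ := hA.bounded
    refine ⟨height c ^ (n + 1) * k, fun x hx => ?_⟩
    have := hk _ hx
    rw [height_act, mul_pow, mul_inv, inv_mul_le_iff₀ (pow_pos hc _)] at this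
    exact this

/-- Comparison of a minimizer with an isometric copy of another one. -/
theorem IsSetMin.comparison {m : ℝ} {V₁ V₂ E₁ E₂ D K : Set (Space n)} (hA : IsDomain A)
    (hlb : LowerBound κ A V₁ V₂ m) (hE₁ : IsSetMin κ A V₁ V₂ m E₁)
    (hE₂ : IsSetMin κ A V₁ V₂ m E₂) {c : Space n} (hc : 0 < height c)
    (hD : D = {x | x ∈ A ∧ act c x ∈ E₂ ∧ x ∉ E₁}) (hK : IsCompact K) (hDK : D ⊆ K)
    (hKA : ∀ x ∈ K, x ∈ A ∧ act c x ∈ A) (hDV₂ : D ⊆ V₂) (hDV₁ : ∀ x ∈ D, act c x ∉ V₁) :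
    IsSetMin κ A V₁ V₂ m (E₁ ∪ D) ∧
      IsSetMin κ A V₁ V₂ m {y | y ∈ E₂ ∧ act (actInv c) y ∉ D} := by
  set A' : Set (Space n) := {x | act c x ∈ A} with hA'def
  have hA' : IsDomain A' := hA.preimage_act hc
  have hi : 0 < height (actInv c) := by rw [height_actInv hc.ne']; exact inv_pos.2 hc
  set F : Set (Space n) := {x | act c x ∈ E₂} with hFdef
  have hFm : NullMeasurableSet F volume := hE₂.meas.preimage (quasiMeasurePreserving_act hc)
  have hDm : NullMeasurableSet D volume := by
    have : D = A ∩ (F \ E₁) := by rw [hD]; rfl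
    rw [this]
    exact hA.isOpen.measurableSet.nullMeasurableSet.inter (hFm.diff hE₁.meas)
  have hmemD : ∀ x, x ∈ D ↔ x ∈ A ∧ act c x ∈ E₂ ∧ x ∉ E₁ := fun x => by rw [hD]; rfl
  set G : Set (Space n) := {y | y ∈ E₂ ∧ act (actInv c) y ∉ D} with hGdef
  have hGm : NullMeasurableSet G volume :=
    hE₂.meas.inter (hDm.preimage (quasiMeasurePreserving_act hi)).compl
  have hFD : ∀ x, x ∈ F \ D ↔ act c x ∈ G := fun x => by
    simp only [hFdef, hGdef, Set.mem_sdiff, mem_ofPred_eq, actInv_act_act hc.ne']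
  have hcF : EnergyLE κ A' (chi F) m := by
    have := hE₂.le.comp_act hc
    have e : chi F = fun x => chi E₂ (act c x) := by
      ext1 x
      by_cases h : act c x ∈ E₂
      · rw [chi_of_mem h, chi_of_mem (by exact h)]
      · rw [chi_of_notMem h, chi_of_notMem (by exact h)]
    rw [e]; exact this
  have hb₁ : ∀ g, IsTestField A g →
      pairing (chi E₁) g ≤ m - κ * ∫ x, chi E₁ x * volDensity A x := fun g hg => by
    have := hE₁.le g hg
    rw [fieldEnergy_eq hA hg (chi_meas hE₁.meas) (abs_chi_le _)] at this
    linarith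
  have hb₂ : ∀ g, IsTestField A' g →
      pairing (chi F) g ≤ m - κ * ∫ x, chi F x * volDensity A' x := fun g hg => by
    have := hcF g hg
    rw [fieldEnergy_eq hA' hg (chi_meas hFm) (abs_chi_le _)] at this
    linarith
  have hUm := hE₁.meas.union hDm
  have hSm := hFm.diff hDm
  have hI : ∀ {B E : Set (Space n)}, IsDomain B → NullMeasurableSet E volume →
      Integrable (fun x => chi E x * volDensity B x) volume := fun hB hE =>
    hB.integrable_mul_volDensity (chi_meas hE) (abs_chi_le _)
  have hv1 : ∫ x, chi (E₁ ∪ D) x * volDensity A x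
      = (∫ x, chi E₁ x * volDensity A x) + ∫ x, chi D x * volDensity A x := by
    rw [← integral_add (hI hA hE₁.meas) (hI hA hDm)]
    refine integral_congr_ae (ae_of_all _ fun x => ?_)
    have := hmemD x
    by_cases h1 : x ∈ E₁
    · simp [chi, h1, this]
    · by_cases h2 : x ∈ D <;> simp [chi, h1, h2]
  have hv2 : ∫ x, chi F x * volDensity A' x
      = (∫ x, chi (F \ D) x * volDensity A' x) + ∫ x, chi D x * volDensity A x := by
    rw [← integral_add (hI hA' hSm) (hI hA hDm)]
    refine integral_congr_ae (ae_of_all _ fun x => ?_)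
    by_cases h2 : x ∈ D
    · have h3 : x ∈ F := ((hmemD x).1 h2).2.1
      have h4 : x ∈ A := ((hmemD x).1 h2).1
      have h5 : x ∈ A' := (hKA x (hDK h2)).2
      simp [chi, h2, h3, volDensity, h4, h5]
    · by_cases h1 : x ∈ F <;> simp [chi, h1, h2]
  -- The enlarged set is tested in `A`, the diminished one in `A'` after pulling back by `act c`. On
  -- `D`, which lies in both domains, the densities agree, so the volume lost by one is gained by
  -- the other.
  obtain ⟨r1, r2⟩ := isRelaxedMin_of_split hlb one_pos one_pos
    (adm_chi hUm (hE₁.lower.trans subset_union_left) (union_subset hE₁.upper hDV₂))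
    (adm_chi (V₁ := V₁) (V₂ := V₂) hGm (fun y hy => ⟨hE₂.lower hy, fun h => hDV₁ _ h (by
      rwa [act_actInv_act hc.ne'])⟩) (fun y hy => hE₂.upper hy.1))
    (fun g₁ g₂ hg₁ hg₂ => by
      have hg₂' := hg₂.comp_act hc
      have hs := submodular_local hA.isOpen hA'.isOpen hA.upper hA'.upper hE₁.meas hFm hDm hK
        (fun x hx => hKA x hx) hDK (fun x hx => by
          rw [hmemD]; exact ⟨fun h => ⟨h.2.1, h.2.2⟩, fun h => ⟨hx.1, h.1, h.2⟩⟩) hb₁ hb₂ hg₁ hg₂'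
      have e : chi (F \ D) = fun x => chi G (act c x) := by
        ext1 x
        by_cases h : act c x ∈ G
        · rw [chi_of_mem h, chi_of_mem ((hFD x).2 h)]
        · rw [chi_of_notMem h, chi_of_notMem (fun h' => h ((hFD x).1 h'))]
      have h2 : fieldEnergy κ A (chi G) g₂ = pairing (chi (F \ D)) (fun x => g₂ (act c x))
          + κ * ∫ x, chi (F \ D) x * volDensity A' x := by
        rw [← fieldEnergy_eq hA' hg₂' (chi_meas hSm) (abs_chi_le _), e]
        exact (fieldEnergy_comp_act hc).symm
      rw [h2, fieldEnergy_eq hA hg₁ (chi_meas hUm) (abs_chi_le _), hv1]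
      rw [hv2] at hs
      linarith)
  exact ⟨⟨hUm, hE₁.lower.trans subset_union_left, union_subset hE₁.upper hDV₂, r1.le⟩,
    ⟨hGm, (fun y hy => ⟨hE₂.lower hy, fun h => hDV₁ _ h (by
      rwa [act_actInv_act hc.ne'])⟩), (fun y hy => hE₂.upper hy.1), r2.le⟩⟩

end

end RadialGraph
end

noncomputable section
namespace RadialGraph
open Filter Topology

variable {n : ℕ}

/-! ### Polar coordinates -/

/-- The radial projection to the unit sphere, with an arbitrary value at the origin. -/
def dir (x : Space n) : Sphere n :=
  if h : x = 0 then ⟨north n, by simp [norm_north]⟩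
  else ⟨‖x‖⁻¹ • x, by simp [norm_smul, norm_ne_zero_iff.2 h]⟩

lemma coe_dir {x : Space n} (h : x ≠ 0) : (dir x : Space n) = ‖x‖⁻¹ • x := by simp [dir, h]

lemma norm_exp_smul (w : ℝ) (z : Sphere n) : ‖Real.exp w • (z : Space n)‖ = Real.exp w := by
  rw [norm_smul, norm_eq_of_mem_sphere, mul_one, Real.norm_of_nonneg (Real.exp_pos w).le]

lemma exp_smul_ne_zero (w : ℝ) (z : Sphere n) : Real.exp w • (z : Space n) ≠ 0 := by
  rw [← norm_ne_zero_iff, norm_exp_smul]; exact (Real.exp_pos w).ne'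

@[simp] lemma log_norm_exp_smul (w : ℝ) (z : Sphere n) :
    Real.log ‖Real.exp w • (z : Space n)‖ = w := by rw [norm_exp_smul, Real.log_exp]

@[simp] lemma dir_exp_smul (w : ℝ) (z : Sphere n) : dir (Real.exp w • (z : Space n)) = z := by
  refine Subtype.ext ?_
  rw [coe_dir (exp_smul_ne_zero w z), norm_exp_smul, smul_smul, inv_mul_cancel₀ (Real.exp_pos w).ne',
    one_smul]

lemma exp_log_smul_dir {x : Space n} (h : x ≠ 0) :
    Real.exp (Real.log ‖x‖) • (dir x : Space n) = x := by
  rw [Real.exp_log (norm_pos_iff.2 h), coe_dir h, smul_smul,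
    mul_inv_cancel₀ (norm_ne_zero_iff.2 h), one_smul]

lemma dir_smul {x : Space n} (h : x ≠ 0) {c : ℝ} (hc : 0 < c) : dir (c • x) = dir x := by
  refine Subtype.ext ?_
  rw [coe_dir (smul_ne_zero hc.ne' h), coe_dir h, norm_smul, Real.norm_of_nonneg hc.le, smul_smul,
    mul_inv, mul_comm c⁻¹, mul_assoc, inv_mul_cancel₀ hc.ne', mul_one]

lemma continuousOn_dir : ContinuousOn (dir : Space n → Sphere n) {0}ᶜ := by
  rw [continuousOn_iff_continuous_domRestrict]
  refine continuous_induced_rng.2 ?_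
  have : (Subtype.val ∘ ({0}ᶜ : Set (Space n)).domRestrict dir)
      = fun x : ({0}ᶜ : Set (Space n)) => ‖(x : Space n)‖⁻¹ • (x : Space n) := by
    ext1 x
    exact coe_dir x.2
  rw [this]
  exact (continuous_subtype_val.norm.inv₀ fun x => norm_ne_zero_iff.2 x.2).smul
    continuous_subtype_val

lemma continuousOn_log_norm : ContinuousOn (fun x : Space n => Real.log ‖x‖) {0}ᶜ :=
  continuous_norm.continuousOn.log fun _ hx => norm_ne_zero_iff.2 hx

/-- The position of a point relative to the radial graph of `v`. -/
def gap (v : Sphere n → ℝ) (x : Space n) : ℝ := Real.log ‖x‖ - v (dir x)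

section

variable {Ω : Set (Sphere n)} {T : ℝ}

lemma mem_truncCone_iff {x : Space n} : x ∈ truncCone Ω T ↔
    x ≠ 0 ∧ dir x ∈ Ω ∧ -T - 1 < Real.log ‖x‖ ∧ Real.log ‖x‖ < T + 1 := by
  constructor
  · rintro ⟨z, hz, w, h1, h2, rfl⟩
    exact ⟨exp_smul_ne_zero w z, by simpa using hz, by simpa using h1, by simpa using h2⟩
  · rintro ⟨h0, hz, h1, h2⟩
    exact ⟨dir x, hz, _, h1, h2, (exp_log_smul_dir h0).symm⟩

lemma mem_subgraph_iff {v : Sphere n → ℝ} {x : Space n} : x ∈ subgraph Ω T v ↔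
    x ∈ truncCone Ω T ∧ gap v x < 0 := by
  constructor
  · rintro ⟨⟨z, hz, w, h1, rfl⟩, h2⟩
    exact ⟨h2, by simpa [gap] using h1⟩
  · rintro ⟨h1, h2⟩
    obtain ⟨h0, hz, -, -⟩ := mem_truncCone_iff.1 h1
    exact ⟨⟨dir x, hz, _, by simpa [gap] using h2, (exp_log_smul_dir h0).symm⟩, h1⟩

lemma mem_radialGraph_iff {u : Sphere n → ℝ} {x : Space n} : x ∈ radialGraph Ω u ↔
    x ≠ 0 ∧ dir x ∈ Ω ∧ gap u x = 0 := by
  constructor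
  · rintro ⟨z, hz, rfl⟩
    exact ⟨exp_smul_ne_zero _ z, by simpa using hz, by simp [gap]⟩
  · rintro ⟨h0, hz, h1⟩
    refine ⟨dir x, hz, ?_⟩
    rw [← sub_eq_zero.1 h1, exp_log_smul_dir h0]

lemma gap_smul_exp (v : Sphere n → ℝ) (s : ℝ) {x : Space n} (hx : x ≠ 0) :
    gap v (Real.exp s • x) = s + gap v x := by
  rw [gap, gap, dir_smul hx (Real.exp_pos s), norm_smul, Real.norm_of_nonneg (Real.exp_pos s).le,
    Real.log_mul (Real.exp_pos s).ne' (norm_ne_zero_iff.2 hx), Real.log_exp]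
  ring

/-- The part of the closed cone over `S` between two spheres. -/
def closedCone (S : Set (Sphere n)) (a b : ℝ) : Set (Space n) :=
  (fun p : Sphere n × ℝ => Real.exp p.2 • (p.1 : Space n)) '' (S ×ˢ Icc a b)

lemma mem_closedCone_iff {S : Set (Sphere n)} {a b : ℝ} {x : Space n} : x ∈ closedCone S a b ↔
    x ≠ 0 ∧ dir x ∈ S ∧ a ≤ Real.log ‖x‖ ∧ Real.log ‖x‖ ≤ b := by
  constructor
  · rintro ⟨⟨z, w⟩, ⟨hz, h1, h2⟩, rfl⟩
    exact ⟨exp_smul_ne_zero w z, by simpa using hz, by simpa using h1, by simpa using h2⟩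
  · rintro ⟨h0, hz, h1, h2⟩
    exact ⟨(dir x, _), ⟨hz, h1, h2⟩, exp_log_smul_dir h0⟩

lemma isCompact_closedCone {S : Set (Sphere n)} (hS : IsClosed S) (a b : ℝ) :
    IsCompact (closedCone S a b) := by
  refine (hS.isCompact.prod isCompact_Icc).image ?_
  exact (Real.continuous_exp.comp continuous_snd).smul
    (continuous_subtype_val.comp continuous_fst)

lemma continuousOn_gap {S : Set (Sphere n)} {v : Sphere n → ℝ} (hv : ContinuousOn v S) :
    ContinuousOn (gap v) {x | x ≠ 0 ∧ dir x ∈ S} :=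
  (continuousOn_log_norm.mono fun _ hx => hx.1).sub
    (hv.comp (continuousOn_dir.mono fun _ hx => hx.1) fun _ hx => hx.2)

lemma closedCone_subset {S : Set (Sphere n)} (a b : ℝ) :
    closedCone S a b ⊆ {x | x ≠ 0 ∧ dir x ∈ S} := fun _ hx =>
  ⟨(mem_closedCone_iff.1 hx).1, (mem_closedCone_iff.1 hx).2.1⟩

lemma truncCone_subset : truncCone Ω T ⊆ {x | x ≠ 0 ∧ dir x ∈ Ω} := fun _ hx =>
  ⟨(mem_truncCone_iff.1 hx).1, (mem_truncCone_iff.1 hx).2.1⟩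

lemma isOpen_truncCone (hΩ : IsOpen Ω) : IsOpen (truncCone Ω T) := by
  have h1 : IsOpen ({0}ᶜ ∩ (fun x : Space n => (dir x, Real.log ‖x‖)) ⁻¹'
      (Ω ×ˢ Ioo (-T - 1) (T + 1))) :=
    (continuousOn_dir.prodMk continuousOn_log_norm).isOpen_inter_preimage
      isOpen_compl_singleton (hΩ.prod isOpen_Ioo)
  convert! h1 using 1
  ext x
  rw [mem_truncCone_iff]
  rfl

lemma isOpen_subgraph (hΩ : IsOpen Ω) {v : Sphere n → ℝ} (hv : ContinuousOn v Ω) :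
    IsOpen (subgraph Ω T v) := by
  have h1 := ((continuousOn_gap hv).mono truncCone_subset).isOpen_inter_preimage
    (isOpen_truncCone (T := T) hΩ) (isOpen_Iio (a := (0 : ℝ)))
  convert! h1 using 1
  ext x
  rw [mem_subgraph_iff]
  rfl

lemma subgraph_subset (v : Sphere n → ℝ) : subgraph Ω T v ⊆ truncCone Ω T := inter_subset_right

lemma height_dir {x : Space n} (h : x ≠ 0) : height x = ‖x‖ * height (dir x : Space n) := by
  rw [coe_dir h, height_smul, ← mul_assoc, mul_inv_cancel₀ (norm_ne_zero_iff.2 h), one_mul]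

/-- The closure of `Ω` is a compact subset of the open hemisphere, so heights on the cone stay away
from zero. -/
lemma isDomain_truncCone (hΩ : IsOpen Ω) (hΩs : closure Ω ⊆ upperHemisphere n) :
    IsDomain (truncCone Ω T) := by
  have hup : ∀ x ∈ truncCone Ω T, 0 < height x := fun x hx => by
    obtain ⟨h0, h1, -, -⟩ := mem_truncCone_iff.1 hx
    rw [height_dir h0]
    exact mul_pos (norm_pos_iff.2 h0) (hΩs (subset_closure h1))
  refine ⟨isOpen_truncCone hΩ, hup, ?_, ?_⟩
  · refine (measure_mono (t := Metric.closedBall 0 (Real.exp (T + 1))) fun x hx => ?_).trans_lt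
      measure_closedBall_lt_top
    obtain ⟨h0, -, -, h2⟩ := mem_truncCone_iff.1 hx
    rw [mem_closedBall_zero_iff, ← Real.log_le_iff_le_exp (norm_pos_iff.2 h0)]
    exact h2.le
  · obtain ⟨c0, hc0, hc⟩ : ∃ c0 > 0, ∀ z ∈ closure Ω, c0 ≤ height (z : Space n) := by
      rcases (closure Ω).eq_empty_or_nonempty with h | hne
      · exact ⟨1, one_pos, by simp [h]⟩
      · obtain ⟨z0, hz0, hmin⟩ := isClosed_closure.isCompact.exists_isMinOn hne
          (continuous_height.comp continuous_subtype_val).continuousOn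
        exact ⟨_, hΩs hz0, fun z hz => hmin hz⟩
    refine ⟨((Real.exp (-T - 1) * c0) ^ (n + 1))⁻¹, fun x hx => ?_⟩
    obtain ⟨h0, h1, h2, -⟩ := mem_truncCone_iff.1 hx
    have h3 : Real.exp (-T - 1) ≤ ‖x‖ := ((Real.lt_log_iff_exp_lt (norm_pos_iff.2 h0)).1 h2).le
    have h4 : Real.exp (-T - 1) * c0 ≤ height x := by
      rw [height_dir h0]
      exact mul_le_mul h3 (hc _ (subset_closure h1)) hc0.le (norm_nonneg _)
    gcongr

/-- Near a dilation of ratio `e^s > 1`, the isometries move points up by nearly `s`. -/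
lemma exists_gap_act {v : Sphere n → ℝ} (hv : ContinuousOn v (closure Ω)) {s : ℝ} (hs : 0 < s) :
    ∃ δ > 0, ∀ c, dist c (Real.exp s • north n) < δ → ∀ x ∈ truncCone Ω T,
      act c x ∈ truncCone Ω T → gap v x + 3 / 4 * s ≤ gap v (act c x) := by
  -- The upper end is raised by `s` to contain the exact dilates `e^s x`, on which `gap` grows by
  -- exactly `s`. Uniform continuity on `Q` then costs less than `s / 4`.
  set Q := closedCone (closure Ω) (-T - 1) (T + 1 + s)
  have hQ : IsCompact Q := isCompact_closedCone isClosed_closure _ _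
  have huc : UniformContinuousOn (gap v) Q :=
    hQ.uniformContinuousOn_of_continuous ((continuousOn_gap hv).mono (closedCone_subset _ _))
  obtain ⟨ε, hε, hQε⟩ := Metric.uniformContinuousOn_iff.1 huc (s / 4) (by positivity)
  have hR : 0 < Real.exp (T + 1) + 2 := by positivity
  refine ⟨ε / (Real.exp (T + 1) + 2), by positivity, fun c hc x hx hcx => ?_⟩
  obtain ⟨h0, h1, h2, h3⟩ := mem_truncCone_iff.1 hx
  have hx2 : Real.exp s • x ∈ Q := by
    rw [mem_closedCone_iff, dir_smul h0 (Real.exp_pos s), norm_smul,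
      Real.norm_of_nonneg (Real.exp_pos s).le,
      Real.log_mul (Real.exp_pos s).ne' (norm_ne_zero_iff.2 h0), Real.log_exp]
    exact ⟨smul_ne_zero (Real.exp_pos s).ne' h0, subset_closure h1, by linarith, by linarith⟩
  have hcx2 : act c x ∈ Q := by
    obtain ⟨g0, g1, g2, g3⟩ := mem_truncCone_iff.1 hcx
    exact mem_closedCone_iff.2 ⟨g0, subset_closure g1, by linarith, by linarith⟩
  have hd : dist (act c x) (Real.exp s • x) < ε := by
    set d := c - Real.exp s • north n with hd
    have hcd : c = Real.exp s • north n + d := by rw [hd]; module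
    have e : act c x - Real.exp s • x = height d • x + (d - height d • north n) := by
      rw [hcd]
      simp only [act, height_add, height_smul, height_north]
      module
    have hxn : ‖x‖ ≤ Real.exp (T + 1) := ((Real.log_lt_iff_lt_exp (norm_pos_iff.2 h0)).1 h3).le
    have hdn : ‖d‖ < ε / (Real.exp (T + 1) + 2) := by rwa [dist_eq_norm] at hc
    rw [dist_eq_norm, e]
    calc ‖height d • x + (d - height d • north n)‖
        ≤ ‖height d • x‖ + (‖d‖ + ‖height d • north n‖) :=
          (norm_add_le _ _).trans (add_le_add le_rfl (norm_sub_le _ _))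
      _ ≤ ‖d‖ * Real.exp (T + 1) + (‖d‖ + ‖d‖ * 1) := by
          rw [norm_smul, norm_smul, norm_north]
          have := abs_height_le d
          gcongr <;> exact this
      _ = ‖d‖ * (Real.exp (T + 1) + 2) := by ring
      _ < ε := by rwa [lt_div_iff₀ hR] at hdn
  have := hQε _ hcx2 _ hx2 hd
  rw [Real.dist_eq, gap_smul_exp v s h0] at this
  linarith [(abs_lt.1 this).1]

end

/-! ### The obstacle problem -/

/-- The hypotheses on the domain and on the obstacles. -/
structure Obstacles (Ω : Set (Sphere n)) (T : ℝ) (v₁ v₂ : Sphere n → ℝ) : Prop where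
  isOpen : IsOpen Ω
  upper : closure Ω ⊆ upperHemisphere n
  cont₁ : ContinuousOn v₁ (closure Ω)
  cont₂ : ContinuousOn v₂ (closure Ω)
  le : ∀ z ∈ Ω, v₁ z ≤ v₂ z
  eq : ∀ z ∈ frontier Ω, v₁ z = v₂ z
  bound₁ : ∀ z ∈ Ω, |v₁ z| ≤ T
  bound₂ : ∀ z ∈ Ω, |v₂ z| ≤ T

section

variable {Ω : Set (Sphere n)} {T : ℝ} {v₁ v₂ : Sphere n → ℝ} {κ m : ℝ}

lemma Obstacles.isDomain (h : Obstacles Ω T v₁ v₂) : IsDomain (truncCone Ω T) :=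
  isDomain_truncCone h.isOpen h.upper

lemma subgraph_mono {u v : Sphere n → ℝ} (h : ∀ z ∈ Ω, u z ≤ v z) :
    subgraph Ω T u ⊆ subgraph Ω T v := fun x hx => by
  rw [mem_subgraph_iff] at hx ⊢
  refine ⟨hx.1, ?_⟩
  have := h _ (mem_truncCone_iff.1 hx.1).2.1
  have := hx.2
  simp only [gap] at *
  linarith

/-- Minimizers in the obstacle problem. -/
abbrev ObstacleMin (κ : ℝ) (Ω : Set (Sphere n)) (T : ℝ) (v₁ v₂ : Sphere n → ℝ) (m : ℝ)
    (E : Set (Space n)) : Prop :=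
  IsSetMin κ (truncCone Ω T) (subgraph Ω T v₁) (subgraph Ω T v₂) m E

/-- Isometric copies of minimizers, pushed down by an arbitrarily small amount, can be glued to
minimizers. -/
theorem Obstacles.exists_glue (h : Obstacles Ω T v₁ v₂)
    (hlb : LowerBound κ (truncCone Ω T) (subgraph Ω T v₁) (subgraph Ω T v₂) m)
    {s : ℝ} (hs : 0 < s) :
    ∃ δ > 0, ∀ c, dist c (Real.exp s • north n) < δ → 0 < height c ∧
      ∀ E₁ E₂, ObstacleMin κ Ω T v₁ v₂ m E₁ → ObstacleMin κ Ω T v₁ v₂ m E₂ →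
      ObstacleMin κ Ω T v₁ v₂ m (E₁ ∪ {x | x ∈ truncCone Ω T ∧ act c x ∈ E₂ ∧ x ∉ E₁}) ∧
      ObstacleMin κ Ω T v₁ v₂ m
        {y | y ∈ E₂ ∧ (act (actInv c) y ∈ truncCone Ω T → act (actInv c) y ∈ E₁)} := by
  obtain ⟨δ₁, hδ₁, H₁⟩ := exists_gap_act (T := T) h.cont₁ hs
  obtain ⟨δ₂, hδ₂, H₂⟩ := exists_gap_act (T := T) h.cont₂ hs
  -- The last bound keeps the height of `c` positive.
  refine ⟨min (min δ₁ δ₂) (Real.exp s), by positivity, fun c hc => ?_⟩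
  have hc1 := hc.trans_le ((min_le_left _ _).trans (min_le_left _ _))
  have hc2 := hc.trans_le ((min_le_left _ _).trans (min_le_right _ _))
  have hc3 := hc.trans_le (min_le_right _ _)
  have hcpos : 0 < height c := by
    rw [dist_eq_norm] at hc3
    have := (abs_height_le _).trans_lt hc3
    rw [height_sub, height_smul, height_north, mul_one] at this
    linarith [(abs_lt.1 this).1]
  refine ⟨hcpos, fun E₁ E₂ hE₁ hE₂ => ?_⟩
  set A := truncCone Ω T
  set D : Set (Space n) := {x | x ∈ A ∧ act c x ∈ E₂ ∧ x ∉ E₁} with hD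
  set Q := closedCone (closure Ω) (-T) T
  have hQ : IsCompact Q := isCompact_closedCone isClosed_closure _ _
  -- Points over which the obstacles differ by at least `3 s / 4`. These directions avoid the
  -- boundary of `Ω`, where the obstacles agree, so this compact set lies in the open cone.
  set K₀ : Set (Space n) := Q ∩ (fun x => (gap v₁ x, gap v₂ x)) ⁻¹'
    {p : ℝ × ℝ | p.2 + 3 / 4 * s ≤ p.1} with hK₀
  have hK₀c : IsCompact K₀ := by
    refine hQ.of_isClosed_subset ?_ inter_subset_left
    refine ContinuousOn.preimage_isClosed_of_isClosed ?_ hQ.isClosed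
      (isClosed_le (by fun_prop) (by fun_prop))
    exact ((continuousOn_gap h.cont₁).prodMk (continuousOn_gap h.cont₂)).mono
      (closedCone_subset _ _)
  have hTpos : ∀ z ∈ Ω, 0 ≤ T := fun z hz => (abs_nonneg _).trans (h.bound₁ z hz)
  have hK₀A : K₀ ⊆ A := by
    rintro x ⟨hx, hg⟩
    obtain ⟨h0, h1, h2, h3⟩ := mem_closedCone_iff.1 hx
    have hg' : gap v₂ x + 3 / 4 * s ≤ gap v₁ x := hg
    have hxΩ : dir x ∈ Ω := by
      by_contra hn
      have := h.eq (dir x) ⟨h1, by rwa [h.isOpen.interior_eq]⟩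
      simp only [gap, this] at hg'
      linarith
    exact mem_truncCone_iff.2 ⟨h0, hxΩ, by linarith, by linarith⟩
  have hmemK₀ : ∀ x ∈ A, 0 ≤ gap v₁ x → gap v₂ x ≤ 0 → gap v₂ x + 3 / 4 * s ≤ gap v₁ x →
      x ∈ K₀ := by
    intro x hx h1 h2 h3
    obtain ⟨g0, g1, -, -⟩ := mem_truncCone_iff.1 hx
    have b1 := abs_le.1 (h.bound₁ _ g1)
    have b2 := abs_le.1 (h.bound₂ _ g1)
    refine ⟨mem_closedCone_iff.2 ⟨g0, subset_closure g1, ?_, ?_⟩, h3⟩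
    · simp only [gap] at h1; linarith
    · simp only [gap] at h2; linarith
  have hDfacts : ∀ x ∈ D, x ∈ A ∧ act c x ∈ A ∧ 0 ≤ gap v₁ x ∧ gap v₂ (act c x) < 0 ∧
      gap v₁ x + 3 / 4 * s ≤ gap v₁ (act c x) ∧ gap v₂ x + 3 / 4 * s ≤ gap v₂ (act c x) := by
    rintro x ⟨hxA, hxE₂, hxE₁⟩
    obtain ⟨hcA, hc2'⟩ := mem_subgraph_iff.1 (hE₂.upper hxE₂)
    refine ⟨hxA, hcA, ?_, hc2', H₁ c hc1 x hxA hcA, H₂ c hc2 x hxA hcA⟩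
    by_contra hneg
    exact hxE₁ (hE₁.lower (mem_subgraph_iff.2 ⟨hxA, not_le.1 hneg⟩))
  -- A point `x` of `D` is not below `v₁`, while `act c x` is below `v₂`. Moving between them
  -- changes both gaps by at least `3 s / 4`, so both points lie in `K₀` and the modified sets
  -- respect the obstacles.
  have hcomp := hE₁.comparison h.isDomain hlb hE₂ (D := D) (K := K₀ ∩ act c ⁻¹' K₀) hcpos rfl
    (hK₀c.inter_right (hK₀c.isClosed.preimage (continuous_act_right c)))
    (fun x hx => by
      obtain ⟨a1, a2, a3, a4, a5, a6⟩ := hDfacts x hx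
      exact ⟨hmemK₀ x a1 a3 (by linarith) (by linarith),
        hmemK₀ _ a2 (by linarith) a4.le (by linarith)⟩)
    (fun x hx => ⟨hK₀A hx.1, hK₀A hx.2⟩)
    (fun x hx => by
      obtain ⟨a1, a2, a3, a4, a5, a6⟩ := hDfacts x hx
      exact mem_subgraph_iff.2 ⟨a1, by linarith⟩)
    (fun x hx hV => by
      obtain ⟨a1, a2, a3, a4, a5, a6⟩ := hDfacts x hx
      linarith [(mem_subgraph_iff.1 hV).2])
  refine ⟨hcomp.1, ?_⟩
  convert! hcomp.2 using 1
  ext y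
  simp only [hD, mem_ofPred_eq, act_actInv_act hcpos.ne']
  tauto

end

end RadialGraph
end

noncomputable section
namespace RadialGraph
open Filter Topology

variable {n : ℕ}

/-! ### The group action in its first variable -/

/-- `b ↦ act b x` as a linear map. -/
def actLeft (x : Space n) : Space n →ₗ[ℝ] Space n :=
  LinearMap.transvection (heightL n).toLinearMap (x - north n)

lemma actLeft_apply (x b : Space n) : actLeft x b = act b x := by
  simp only [actLeft, LinearMap.transvection.apply, act, ContinuousLinearMap.coe_coe, heightL_apply]
  module

lemma det_actLeft (x : Space n) : LinearMap.det (actLeft x) = height x := by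
  rw [actLeft, LinearMap.transvection.det]
  simp

/-- For fixed `x` the action is linear in the group element, with determinant `height x`. Null sets
of points therefore correspond to null sets of group elements. -/
lemma quasiMeasurePreserving_actLeft {x : Space n} (hx : 0 < height x) :
    Measure.QuasiMeasurePreserving (fun b => act b x) volume volume := by
  have := Measure.LinearMap.quasiMeasurePreserving (volume : Measure (Space n)) (actLeft x)
    (by rw [det_actLeft]; exact hx.ne')
  simpa only [funext (actLeft_apply x)] using this

lemma act_div_act (x y : Space n) (hx : height x ≠ 0) : act (act y (actInv x)) x = y := by
  rw [← act_act, actInv_act hx, act_north]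

lemma act_act_div (x c : Space n) (hx : height x ≠ 0) : act (act c x) (actInv x) = c := by
  rw [← act_act, act_actInv hx, act_north]

lemma act_exp_north (s : ℝ) (x : Space n) : act (Real.exp s • north n) x = Real.exp s • x := by
  simp [act]

lemma continuousOn_actInv : ContinuousOn (actInv : Space n → Space n) (upperHalf n) := by
  unfold actInv
  exact ((continuous_height.continuousOn.inv₀ fun x hx => ne_of_gt hx).smul
    (continuousOn_const.sub continuousOn_id)).add continuousOn_const

lemma continuousAt_act_actInv {p q : Space n} (hp : p ∈ upperHalf n) :
    ContinuousAt (fun z : Space n × Space n => act z.2 (actInv z.1)) (p, q) := by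
  have h1 : ContinuousAt (fun z : Space n × Space n => actInv z.1) (p, q) :=
    ContinuousAt.comp (f := Prod.fst) (x := (p, q))
      (continuousOn_actInv.continuousAt (isOpen_upperHalf.mem_nhds hp)) continuousAt_fst
  have h2 : Continuous fun z : Space n × Space n => height z.2 :=
    continuous_height.comp continuous_snd
  have h3 : Continuous fun z : Space n × Space n => z.2 - height z.2 • north n :=
    continuous_snd.sub (h2.smul continuous_const)
  exact (h2.continuousAt.smul h1).add h3.continuousAt

/-! ### The radial graph structure of monotone sets -/

section

variable {Ω : Set (Sphere n)} {T : ℝ} {E : Set (Space n)}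

/-- The points near which `E` has full measure. -/
def essInterior (E : Set (Space n)) : Set (Space n) := {x | ∃ U ∈ 𝓝 x, volume (U \ E) = 0}

lemma isOpen_essInterior (E : Set (Space n)) : IsOpen (essInterior E) := by
  rw [isOpen_iff_mem_nhds]
  rintro x ⟨U, hU, h⟩
  filter_upwards [eventually_mem_nhds_iff.2 hU] with y hy
  exact ⟨U, hy, h⟩

/-- A locally null set is null, by second countability. -/
lemma essInterior_diff_null (E : Set (Space n)) : volume (essInterior E \ E) = 0 := by
  refine measure_null_of_locally_null _ fun x hx => ?_
  obtain ⟨U, hU, h⟩ := hx.1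
  exact ⟨U \ E, by
    rw [sdiff_eq]
    exact inter_mem (mem_nhdsWithin_of_mem_nhds hU)
      (mem_of_superset self_mem_nhdsWithin fun y hy => hy.2), h⟩

lemma essInterior_disjoint (E : Set (Space n)) {x : Space n} (h : x ∈ essInterior E)
    (h' : x ∈ essInterior Eᶜ) : False := by
  obtain ⟨U, hU, h1⟩ := h
  obtain ⟨U', hU', h2⟩ := h'
  have hpos : 0 < volume (U ∩ U') := Measure.measure_pos_of_mem_nhds _ (inter_mem hU hU')
  have : volume (U ∩ U') = 0 := by
    refine measure_mono_null (fun y hy => ?_) (measure_union_null h1 h2)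
    by_cases hE : y ∈ E
    · exact Or.inr ⟨hy.2, fun h => h hE⟩
    · exact Or.inl ⟨hy.1, hE⟩
  exact hpos.ne' this

/-- If small isometric copies of `E` pushed down by `s` stay in `E`, then points of the essential
closure of `E` move into the essential interior of `E` when pushed down by `s`. -/
lemma mem_essInterior_of_push {A : Set (Space n)} (hA : IsOpen A) (hAu : A ⊆ upperHalf n)
    (hE : MeasurableSet E) {s δ : ℝ}
    (hnull : ∀ c, dist c (Real.exp s • north n) < δ →
      volume {x | x ∈ A ∧ act c x ∈ E ∧ x ∉ E} = 0) (hδ : 0 < δ)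
    {p : Space n} (hp : p ∈ A) (hp' : Real.exp s • p ∉ essInterior Eᶜ) : p ∈ essInterior E := by
  have hpu := hAu hp
  have hcont := continuousAt_act_actInv (q := Real.exp s • p) hpu
  have hval : act (Real.exp s • p) (actInv p) = Real.exp s • north n := by
    rw [← act_exp_north, act_act_div p _ (ne_of_gt hpu)]
  have hmem : {z : Space n × Space n | dist (act z.2 (actInv z.1)) (Real.exp s • north n) < δ}
      ∈ 𝓝 (p, Real.exp s • p) := by
    refine hcont.preimage_mem_nhds (t := Metric.ball (Real.exp s • north n) δ) ?_
    simp only [hval]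
    exact Metric.ball_mem_nhds _ hδ
  rw [nhds_prod_eq] at hmem
  obtain ⟨U₁, hU₁, U₂, hU₂, hUU⟩ := mem_prod_iff.1 hmem
  obtain ⟨W, hWU, hWo, hpW⟩ := mem_nhds_iff.1 (inter_mem hU₁ (hA.mem_nhds hp))
  obtain ⟨W', hWU', hWo', hpW'⟩ := mem_nhds_iff.1 hU₂
  have hpos : 0 < volume (W' ∩ E) := by
    refine pos_iff_ne_zero.2 fun h0 => hp' ⟨W', hWo'.mem_nhds hpW', ?_⟩
    rwa [Set.sdiff_compl]
  refine ⟨W, hWo.mem_nhds hpW, ?_⟩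
  set N : Set (Space n) := Metric.ball (Real.exp s • north n) δ
  -- Sliced at a fixed group element, `Z` is null by hypothesis, hence it is null; so almost every
  -- slice at a fixed point is null too.
  set Z : Set (Space n × Space n) :=
    {z | z.2 ∈ N ∧ z.1 ∈ W ∧ act z.2 z.1 ∈ E ∧ z.1 ∉ E} with hZ
  have hZm : MeasurableSet Z := by
    refine (measurable_snd Metric.isOpen_ball.measurableSet).inter
      ((measurable_fst hWo.measurableSet).inter ((?_ : MeasurableSet _).inter
        (measurable_fst hE.compl)))
    exact ((continuous_act.comp (continuous_snd.prodMk continuous_fst)).measurable) hE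
  have hZ0 : (volume.prod volume) Z = 0 := by
    have hsw : (volume.prod volume) (Prod.swap ⁻¹' Z) = (0 : ENNReal) := by
      refine Measure.measure_prod_null_of_ae_null (measurable_swap hZm) (ae_of_all _ fun c => ?_)
      by_cases hc : c ∈ N
      · refine measure_mono_null (fun x hx => ?_) (hnull c (Metric.mem_ball.1 hc))
        have hx' : (x, c) ∈ Z := hx
        exact ⟨(hWU hx'.2.1).2, hx'.2.2.1, hx'.2.2.2⟩
      · have : Prod.mk c ⁻¹' (Prod.swap ⁻¹' Z) = ∅ := by
          ext x; simp [hZ, hc]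
        simp [this]
    rwa [Measure.measurePreserving_swap.measure_preimage hZm.nullMeasurableSet] at hsw
  have hae := Measure.measure_ae_null_of_prod_null hZ0
  -- For `x` in `W \ E` the slice contains every `c` carrying `x` into `W' ∩ E`. These form a set of
  -- positive measure, since `W' ∩ E` has positive measure.
  have hsub : W \ E ⊆ {x | ¬ volume (Prod.mk x ⁻¹' Z) = 0} := by
    intro x hx h0
    have hxu : 0 < height x := hAu (hWU hx.1).2
    have h1 : {c | act c x ∈ W' ∩ E} ⊆ Prod.mk x ⁻¹' Z := by
      intro c hc
      have h2 := hUU (mk_mem_prod (hWU hx.1).1 (hWU' hc.1))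
      rw [mem_ofPred_eq] at h2
      simp only [act_act_div x c hxu.ne'] at h2
      exact ⟨Metric.mem_ball.2 h2, hx.1, hc.2, hx.2⟩
    have h3 : volume {c | act c x ∈ W' ∩ E} = 0 := measure_mono_null h1 h0
    have hq : 0 < height (actInv x) := by rw [height_actInv hxu.ne']; exact inv_pos.2 hxu
    have h4 := (quasiMeasurePreserving_actLeft hq).preimage_null h3
    have h5 : (fun y => act y (actInv x)) ⁻¹' {c | act c x ∈ W' ∩ E} = W' ∩ E := by
      ext y
      simp only [mem_preimage, mem_ofPred_eq, act_div_act x y hxu.ne']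
    rw [h5] at h4
    exact hpos.ne' h4
  exact measure_mono_null hsub (ae_iff.1 hae)

lemma exp_smul_mem_truncCone {z : Sphere n} (hz : z ∈ Ω) {w : ℝ} (h1 : -T - 1 < w)
    (h2 : w < T + 1) : Real.exp w • (z : Space n) ∈ truncCone Ω T := ⟨z, hz, w, h1, h2, rfl⟩

@[simp] lemma gap_exp_smul (v : Sphere n → ℝ) (w : ℝ) (z : Sphere n) :
    gap v (Real.exp w • (z : Space n)) = w - v z := by simp [gap]

/-- Only countably many level sets of `gap u` have positive measure, so some level `t` in `(0, 1)`
is null, and the dilation by `e^t` carries the graph into it. -/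
lemma volume_radialGraph (hΩ : IsOpen Ω) {u : Sphere n → ℝ} (hu : ContinuousOn u Ω)
    (hT : ∀ z ∈ Ω, |u z| ≤ T) : volume (radialGraph Ω u) = 0 := by
  set A := truncCone Ω T
  have hAo : IsOpen A := isOpen_truncCone hΩ
  classical
  have hmeas : Measurable (A.piecewise (gap u) fun _ => (0 : ℝ)) :=
    ContinuousOn.measurable_piecewise ((continuousOn_gap hu).mono truncCone_subset)
      continuousOn_const hAo.measurableSet
  have hcount := Measure.countable_meas_level_set_pos (μ := (volume : Measure (Space n))) hmeas
  obtain ⟨t, ht, ht0⟩ : ∃ t ∈ Ioo (0 : ℝ) 1,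
      volume {x : Space n | A.piecewise (gap u) (fun _ => (0 : ℝ)) x = t} = 0 := by
    by_contra hcon
    push Not at hcon
    refine (Cardinal.Real.Ioo_countable_iff (x := (0:ℝ)) (y := 1)).not.2 (by simp) (hcount.mono ?_)
    intro t ht
    exact pos_iff_ne_zero.2 (hcon t ht)
  have h0 := (Measure.quasiMeasurePreserving_smul (volume : Measure (Space n))
    (Real.exp_pos t).ne').preimage_null ht0
  refine measure_mono_null (fun x hx => ?_) h0
  obtain ⟨g0, g1, g2⟩ := mem_radialGraph_iff.1 hx
  have hlog : Real.log ‖x‖ = u (dir x) := sub_eq_zero.1 g2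
  have hb := abs_le.1 (hT _ g1)
  have hxA : Real.exp t • x ∈ A := by
    rw [mem_truncCone_iff, dir_smul g0 (Real.exp_pos t), norm_smul,
      Real.norm_of_nonneg (Real.exp_pos t).le,
      Real.log_mul (Real.exp_pos t).ne' (norm_ne_zero_iff.2 g0), Real.log_exp, hlog]
    exact ⟨smul_ne_zero (Real.exp_pos t).ne' g0, g1, by linarith [ht.1], by linarith [ht.2]⟩
  rw [mem_preimage, mem_ofPred_eq, piecewise_eq_of_mem _ _ _ hxA, gap_smul_exp u t g0, g2,
    add_zero]

/-- A set that contains its isometric copies pushed down is, up to a null set, the subgraph of a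
continuous function. -/
theorem exists_subgraph {v₁ v₂ : Sphere n → ℝ} (h : Obstacles Ω T v₁ v₂) (hE : MeasurableSet E)
    (hE₁ : volume (subgraph Ω T v₁ \ E) = 0) (hE₂ : volume (E \ subgraph Ω T v₂) = 0)
    (hpush : ∀ s > 0, ∃ δ > 0, ∀ c, dist c (Real.exp s • north n) < δ →
      volume {x | x ∈ truncCone Ω T ∧ act c x ∈ E ∧ x ∉ E} = 0) :
    ∃ u : Sphere n → ℝ, ContinuousOn u Ω ∧ (∀ z ∈ Ω, v₁ z ≤ u z) ∧ (∀ z ∈ Ω, u z ≤ v₂ z) ∧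
      E =ᵐ[volume] subgraph Ω T u := by
  set A := truncCone Ω T with hAdef
  have hA := h.isDomain
  -- Along each ray, below any point outside the essential exterior one is in the essential
  -- interior. So the two are separated by a single value, the supremum `u z` below.
  have hdown : ∀ z ∈ Ω, ∀ w w' : ℝ, -T - 1 < w → w < w' → w' < T + 1 →
      Real.exp w' • (z : Space n) ∉ essInterior Eᶜ →
      Real.exp w • (z : Space n) ∈ essInterior E := by
    intro z hz w w' h1 h2 h3 h4
    obtain ⟨δ, hδ, hc⟩ := hpush (w' - w) (sub_pos.2 h2)
    refine mem_essInterior_of_push hA.isOpen hA.upper hE hc hδ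
      (exp_smul_mem_truncCone hz h1 (h2.trans h3)) ?_
    rwa [smul_smul, ← Real.exp_add, sub_add_cancel]
  have hV₁ : subgraph Ω T v₁ ⊆ essInterior E := fun x hx =>
    ⟨_, (isOpen_subgraph h.isOpen (h.cont₁.mono subset_closure)).mem_nhds hx, hE₁⟩
  have hV₂ : ∀ x ∈ A, 0 < gap v₂ x → x ∈ essInterior Eᶜ := by
    intro x hx hg
    have ho := ((continuousOn_gap (h.cont₂.mono subset_closure)).mono
      truncCone_subset).isOpen_inter_preimage hA.isOpen (isOpen_Ioi (a := (0 : ℝ)))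
    refine ⟨_, ho.mem_nhds ⟨hx, hg⟩, measure_mono_null (fun y hy => ?_) hE₂⟩
    refine ⟨by simpa using hy.2, fun h' => ?_⟩
    have := (mem_subgraph_iff.1 h').2
    have h2 : 0 < gap v₂ y := hy.1.2
    linarith
  set I : Sphere n → Set ℝ := fun z =>
    {w | -T - 1 < w ∧ w < T + 1 ∧ Real.exp w • (z : Space n) ∈ essInterior E}
  set u : Sphere n → ℝ := fun z => sSup (I z)
  have hIb : ∀ z, BddAbove (I z) := fun z => ⟨T + 1, fun w hw => hw.2.1.le⟩
  have hlow : ∀ z ∈ Ω, ∀ w, -T - 1 < w → w < v₁ z → w ∈ I z := by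
    intro z hz w h1 h2
    have hb := abs_le.1 (h.bound₁ z hz)
    have h3 : w < T + 1 := by linarith
    exact ⟨h1, h3, hV₁ (mem_subgraph_iff.2 ⟨exp_smul_mem_truncCone hz h1 h3, by simpa using h2⟩)⟩
  have hIne : ∀ z ∈ Ω, (I z).Nonempty := fun z hz => ⟨-T - 1 / 2, hlow z hz _ (by linarith) (by
    have hb := abs_le.1 (h.bound₁ z hz); linarith)⟩
  have hlt : ∀ z ∈ Ω, ∀ w, -T - 1 < w → w < u z → w ∈ I z := by
    intro z hz w h1 h2
    obtain ⟨w', hw', hlt⟩ := exists_lt_of_lt_csSup (hIne z hz) h2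
    exact ⟨h1, hlt.trans hw'.2.1, hdown z hz w w' h1 hlt hw'.2.1 fun hc =>
      essInterior_disjoint E hw'.2.2 hc⟩
  have hv₁u : ∀ z ∈ Ω, v₁ z ≤ u z := by
    intro z hz
    by_contra hcon
    have hb := abs_le.1 (h.bound₁ z hz)
    have hu0 : -T - 1 / 2 ≤ u z := le_csSup (hIb z) (hlow z hz _ (by linarith) (by linarith))
    obtain ⟨w, hw1, hw2⟩ := exists_between (not_le.1 hcon)
    exact absurd (le_csSup (hIb z) (hlow z hz w (by linarith) hw2)) (not_le.2 hw1)
  have huv₂ : ∀ z ∈ Ω, u z ≤ v₂ z := by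
    intro z hz
    by_contra hcon
    have hb := abs_le.1 (h.bound₂ z hz)
    obtain ⟨w, hw1, hw2⟩ := exists_between (not_le.1 hcon)
    have hw := hlt z hz w (by linarith) hw2
    refine essInterior_disjoint E hw.2.2 (hV₂ _ (exp_smul_mem_truncCone hz hw.1 hw.2.1) ?_)
    simpa using hw1
  have huT : ∀ z ∈ Ω, |u z| ≤ T := fun z hz => by
    have b1 := abs_le.1 (h.bound₁ z hz)
    have b2 := abs_le.1 (h.bound₂ z hz)
    exact abs_le.2 ⟨by linarith [hv₁u z hz], by linarith [huv₂ z hz]⟩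
  have hgt : ∀ z ∈ Ω, ∀ w, w < T + 1 → u z < w → Real.exp w • (z : Space n) ∈ essInterior Eᶜ := by
    intro z hz w h1 h2
    by_contra hcon
    obtain ⟨w', hw1, hw2⟩ := exists_between h2
    have hb := abs_le.1 (huT z hz)
    have := hdown z hz w' w (by linarith) hw2 h1 hcon
    exact absurd (le_csSup (hIb z) (show w' ∈ I z from ⟨by linarith, by linarith, this⟩))
      (not_le.2 hw1)
  have hcexp : ∀ w : ℝ, Continuous fun z : Sphere n => Real.exp w • (z : Space n) := fun w =>
    (continuous_const_smul (Real.exp w)).comp continuous_subtype_val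
  -- Lower semicontinuity comes from openness of the essential interior of `E`, upper semicontinuity
  -- from openness of that of the complement.
  have hucont : ContinuousOn u Ω := by
    intro z hz
    refine ContinuousAt.continuousWithinAt (tendsto_order.2 ⟨fun a ha => ?_, fun a ha => ?_⟩)
    · obtain ⟨w, hw1, hw2⟩ := exists_between (max_lt ha (show -T - 1 < u z by
        linarith [(abs_le.1 (huT z hz)).1]))
      have hw := hlt z hz w ((le_max_right _ _).trans_lt hw1) hw2
      filter_upwards [h.isOpen.mem_nhds hz, (hcexp w).continuousAt.preimage_mem_nhds
        ((isOpen_essInterior E).mem_nhds hw.2.2)] with y hy hyE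
      refine ((le_max_left _ _).trans_lt hw1).trans_le (le_csSup (hIb y) ⟨hw.1, hw.2.1, hyE⟩)
    · obtain ⟨w, hw1, hw2⟩ := exists_between (lt_min ha (show u z < T + 1 by
        linarith [(abs_le.1 (huT z hz)).2]))
      have hw := hgt z hz w (hw2.trans_le (min_le_right _ _)) hw1
      filter_upwards [h.isOpen.mem_nhds hz, (hcexp w).continuousAt.preimage_mem_nhds
        ((isOpen_essInterior Eᶜ).mem_nhds hw)] with y hy hyE
      refine lt_of_le_of_lt ?_ (hw2.trans_le (min_le_left _ _))
      by_contra hcon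
      have hb := abs_le.1 (huT z hz)
      exact essInterior_disjoint E (hlt y hy w (by linarith) (not_le.1 hcon)).2.2 hyE
  refine ⟨u, hucont, hv₁u, huv₂, ?_⟩
  have hsubI : subgraph Ω T u ⊆ essInterior E := fun x hx => by
    obtain ⟨hxA, hg⟩ := mem_subgraph_iff.1 hx
    obtain ⟨g0, g1, g2, -⟩ := mem_truncCone_iff.1 hxA
    have := (hlt (dir x) g1 _ g2 (by simpa [gap] using hg)).2.2
    rwa [exp_log_smul_dir g0] at this
  have hext : ∀ x ∈ A, 0 < gap u x → x ∈ essInterior Eᶜ := fun x hxA hg => by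
    obtain ⟨g0, g1, -, g3⟩ := mem_truncCone_iff.1 hxA
    have := hgt (dir x) g1 _ g3 (by simpa [gap] using hg)
    rwa [exp_log_smul_dir g0] at this
  have hd1 : volume (E \ subgraph Ω T u) = 0 := by
    refine measure_mono_null (fun x hx => ?_) (measure_union_null hE₂
      (measure_union_null (essInterior_diff_null Eᶜ) (volume_radialGraph h.isOpen hucont huT)))
    by_cases hxV : x ∈ subgraph Ω T v₂
    · right
      have hxA := subgraph_subset v₂ hxV
      rcases lt_trichotomy (gap u x) 0 with h1 | h1 | h1
      · exact absurd (mem_subgraph_iff.2 ⟨hxA, h1⟩) hx.2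
      · right
        exact mem_radialGraph_iff.2 ⟨(mem_truncCone_iff.1 hxA).1, (mem_truncCone_iff.1 hxA).2.1, h1⟩
      · left
        exact ⟨hext x hxA h1, fun hc => hc hx.1⟩
    · exact Or.inl ⟨hx.1, hxV⟩
  have hd2 : volume (subgraph Ω T u \ E) = 0 :=
    measure_mono_null (sdiff_subset_sdiff_left hsubI) (essInterior_diff_null E)
  exact (ae_le_set.2 hd1).antisymm (ae_le_set.2 hd2)

end

end RadialGraph
end

noncomputable section
namespace RadialGraph
open Filter Topology

variable {n : ℕ}

/-! ### Strict convexity: gradients of smooth minimizers are parallel -/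

lemma inner_gradient (f : Space n → ℝ) (x v : Space n) :
    inner ℝ (gradient f x) v = fderiv ℝ f x v := by
  rw [gradient, InnerProductSpace.toDual_symm_apply]

lemma contDiffOn_gradient {f : Space n → ℝ} {B : Set (Space n)} (hB : IsOpen B)
    (hf : ContDiffOn ℝ 2 f B) : ContDiffOn ℝ 1 (gradient f) B :=
  ((InnerProductSpace.toDual ℝ (Space n)).symm.contDiff).comp_contDiffOn
    (hf.fderiv_of_isOpen hB (by norm_num))

/-- A smooth approximation of the direction of steepest descent. -/
def descent (δ : ℝ) (a : Space n) : Space n := -((√(‖a‖ ^ 2 + δ ^ 2))⁻¹ • a)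

lemma sqrt_add_pos {δ : ℝ} (hδ : 0 < δ) (a : Space n) : 0 < √(‖a‖ ^ 2 + δ ^ 2) :=
  Real.sqrt_pos.2 (by positivity)

lemma contDiff_descent {δ : ℝ} (hδ : 0 < δ) : ContDiff ℝ 1 (descent δ : Space n → Space n) := by
  have h : ContDiff ℝ 1 fun a : Space n => √(‖a‖ ^ 2 + δ ^ 2) :=
    ((contDiff_norm_sq ℝ).add contDiff_const).sqrt fun a => by positivity
  exact ((h.inv fun a => (sqrt_add_pos hδ a).ne').smul contDiff_id).neg

lemma norm_descent_le {δ : ℝ} (hδ : 0 < δ) (a : Space n) : ‖descent δ a‖ ≤ 1 := by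
  rw [descent, norm_neg, norm_smul, Real.norm_of_nonneg (inv_nonneg.2 (Real.sqrt_nonneg _)),
    inv_mul_le_iff₀ (sqrt_add_pos hδ a), mul_one]
  exact Real.le_sqrt_of_sq_le (by nlinarith [sq_nonneg δ])

/-- The regularized direction achieves the optimal value `-‖a‖` up to `δ`, uniformly in `a`,
including near `a = 0`. -/
lemma inner_descent_le {δ : ℝ} (hδ : 0 < δ) (a : Space n) :
    inner ℝ a (descent δ a) ≤ -(‖a‖ - δ) := by
  rw [descent, inner_neg_right, inner_smul_right, real_inner_self_eq_norm_sq, neg_le_neg_iff,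
    ← div_eq_inv_mul, le_div_iff₀ (sqrt_add_pos hδ a)]
  have h1 : √(‖a‖ ^ 2 + δ ^ 2) ≤ ‖a‖ + δ :=
    Real.sqrt_le_iff.2 ⟨by positivity, by nlinarith [norm_nonneg a]⟩
  rcases le_total ‖a‖ δ with h | h
  · have := Real.sqrt_nonneg (‖a‖ ^ 2 + δ ^ 2)
    nlinarith [sq_nonneg ‖a‖]
  · nlinarith [norm_nonneg a]

/-- If the perimeter is additive on two functions that are smooth in an open set, then their
gradients there are parallel. -/
theorem sameRay_gradient {A B : Set (Space n)} (hA : IsDomain A) (hB : IsOpen B) (hBA : B ⊆ A)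
    {f₁ f₂ : Space n → ℝ} (hm₁ : AEStronglyMeasurable f₁ volume)
    (hm₂ : AEStronglyMeasurable f₂ volume) {M : ℝ} (hM₁ : ∀ x, |f₁ x| ≤ M)
    (hM₂ : ∀ x, |f₂ x| ≤ M) {c₁ c₂ : ℝ} (hc₁ : ∀ g, IsTestField A g → pairing f₁ g ≤ c₁)
    (hc₂ : ∀ g, IsTestField A g → pairing f₂ g ≤ c₂)
    (hc : ∀ c, (∀ g, IsTestField A g → pairing (fun x => f₁ x + f₂ x) g ≤ c) → c₁ + c₂ ≤ c)
    (hs₁ : ContDiffOn ℝ 2 f₁ B) (hs₂ : ContDiffOn ℝ 2 f₂ B) {x₀ : Space n} (hx₀ : x₀ ∈ B) :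
    SameRay ℝ (gradient f₁ x₀) (gradient f₂ x₀) := by
  rw [sameRay_iff_norm_add]
  by_contra hne
  set a₁ := gradient f₁
  set a₂ := gradient f₂
  have ha₁ : ContDiffOn ℝ 1 a₁ B := contDiffOn_gradient hB hs₁
  have ha₂ : ContDiffOn ℝ 1 a₂ B := contDiffOn_gradient hB hs₂
  set d : Space n → ℝ := fun x => ‖a₁ x‖ + ‖a₂ x‖ - ‖a₁ x + a₂ x‖ with hd
  have hd0 : ∀ x, 0 ≤ d x := fun x => sub_nonneg.2 (norm_add_le _ _)
  have hdx₀ : 0 < d x₀ := (hd0 x₀).lt_of_ne fun h => hne (by simp only [hd] at h; linarith)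
  obtain ⟨η, hη, h0, h1, hη1, hηc, hηs⟩ := exists_cutoff (isCompact_singleton (x := x₀)) hB
    (singleton_subset_iff.2 hx₀)
  have hηx₀ : η x₀ = 1 := by
    rw [nhdsSet_singleton] at hη1
    exact hη1.self_of_nhds
  obtain ⟨θ, hθ, t0, t1, hθ1, hθc, hθs⟩ := exists_cutoff hηc.isCompact hB hηs
  have hη' : ContDiff ℝ 1 fun x => 1 - η x := contDiff_const.sub hη
  -- integrals against `weight * η`
  have hint : ∀ k : Space n → ℝ, ContinuousOn k B →
      Continuous (fun x => weight x * η x * k x) ∧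
        HasCompactSupport (fun x => weight x * η x * k x) := by
    intro k hk
    have hs : tsupport (fun x => weight x * η x * k x) ⊆ tsupport η :=
      closure_mono fun x hx hx' => hx (by simp [hx'])
    refine ⟨?_, hηc.of_isClosed_subset (isClosed_tsupport _) hs⟩
    refine continuous_iff_continuousAt.2 fun x => ?_
    by_cases hx : x ∈ tsupport η
    · have hxB := hηs hx
      have hw : ContinuousAt weight x := (contDiffOn_weight (k := 0)).continuousOn.continuousAt
        (isOpen_upperHalf.mem_nhds (hA.upper (hBA hxB)))
      exact (hw.mul hη.continuous.continuousAt).mul (hk.continuousAt (hB.mem_nhds hxB))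
    · have : (fun x => weight x * η x * k x) =ᶠ[𝓝 x] fun _ => 0 := by
        filter_upwards [notMem_tsupport_iff_eventuallyEq.1 hx] with y hy
        simp [hy]
      exact continuousAt_const.congr this.symm
  have hInt : ∀ k : Space n → ℝ, ContinuousOn k B →
      Integrable (fun x => weight x * η x * k x) volume := fun k hk =>
    (hint k hk).1.integrable_of_hasCompactSupport (hint k hk).2
  have hwη : ∀ x, 0 ≤ weight x * η x := by
    intro x
    by_cases hx : x ∈ tsupport η
    · exact mul_nonneg (weight_pos (hA.upper (hBA (hηs hx)))).le (h0 x)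
    · simp [image_eq_zero_of_notMem_tsupport hx]
  have hdc : ContinuousOn d B := ((ha₁.continuousOn.norm).add ha₂.continuousOn.norm).sub
    (ha₁.continuousOn.add ha₂.continuousOn).norm
  set I := ∫ x, weight x * η x * d x with hI
  have hIpos : 0 < I := by
    refine (hint d hdc).1.integral_pos_of_hasCompactSupport_nonneg_nonzero (hint d hdc).2
      (fun x => mul_nonneg (hwη x) (hd0 x)) (x := x₀) ?_
    rw [hηx₀]
    have := weight_pos (hA.upper (hBA hx₀))
    positivity
  set J := ∫ x, weight x * η x * 1 with hJ
  have hJ0 : 0 ≤ J := integral_nonneg fun x => by simpa using hwη x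
  -- The gain `I` from the strict triangle inequality must outweigh the regularization loss `δ J`
  -- for each of the two functions and the defect `I / 2` of the field `G` chosen below.
  obtain ⟨δ, hδ, hδI⟩ : ∃ δ > 0, 2 * δ * J < I / 2 := by
    refine ⟨I / (4 * (J + 1)) / 2, by positivity, ?_⟩
    have : 2 * (I / (4 * (J + 1)) / 2) * J = I / 4 * (J / (J + 1)) := by field_simp
    rw [this]
    have h3 : J / (J + 1) ≤ 1 := (div_le_one (by positivity)).2 (by linarith)
    nlinarith
  have hm := hm₁.add hm₂
  have hM : ∀ x, |f₁ x + f₂ x| ≤ M + M := fun x =>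
    (abs_add_le _ _).trans (add_le_add (hM₁ x) (hM₂ x))
  have hadd : ∀ g, IsField g → pairing (fun x => f₁ x + f₂ x) g = pairing f₁ g + pairing f₂ g :=
    fun g hg => hg.pairing_add_left hm₁ hM₁ hm₂ hM₂
  obtain ⟨G, hG, hGopt⟩ := exists_nearly_optimal (A := A) (f := fun x => f₁ x + f₂ x)
    (c := c₁ + c₂) (fun g hg => by
      rw [hadd g (hg.isField hA.upper)]
      exact add_le_add (hc₁ g hg) (hc₂ g hg)) (half_pos hIpos)
  have hGF := hG.isField hA.upper
  have hcG := hc _ hGopt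
  rw [hadd G hGF] at hcG
  have hsplit : ∀ (f : Space n → ℝ) (_ : AEStronglyMeasurable f volume) (_ : ∀ x, |f x| ≤ M),
      pairing f G = pairing f (fun x => η x • G x) + pairing f (fun x => (1 - η x) • G x) := by
    intro f hf hfM
    rw [← (hGF.smul hη).pairing_add_right (hGF.smul hη') hf hfM]
    congr 1
    ext1 x
    rw [← add_smul]; simp
  have hηG : ∀ (f : Space n → ℝ) (_ : ContDiffOn ℝ 2 f B), pairing f (fun x => η x • G x)
      = -∫ x, weight x * η x * inner ℝ (gradient f x) (G x) := by
    intro f hf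
    rw [(hGF.smul hη).pairing_eq_neg_integral hB (hf.of_le (by norm_num))
      ((tsupport_smul_subset_left _ _).trans hηs)]
    congr 1
    refine integral_congr_ae (ae_of_all _ fun x => ?_)
    simp only [map_smul, smul_eq_mul, inner_gradient]
    ring
  -- Near `x₀` each function is tested with its own descent direction, elsewhere with the common
  -- field `G`.
  have hupper : ∀ (f : Space n → ℝ) (_ : AEStronglyMeasurable f volume) (_ : ∀ x, |f x| ≤ M)
      (c : ℝ) (_ : ∀ g, IsTestField A g → pairing f g ≤ c) (_ : ContDiffOn ℝ 2 f B),
      (∫ x, weight x * η x * (‖gradient f x‖ - δ)) + pairing f (fun x => (1 - η x) • G x) ≤ c := by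
    intro f hf hfM c hfc hfs
    have hgr := contDiffOn_gradient hB hfs
    set X : Space n → Space n := fun x => θ x • descent δ (gradient f x) with hX
    have hXs : tsupport X ⊆ tsupport θ := tsupport_smul_subset_left _ _
    have hXT : IsTestField A X := by
      refine ⟨?_, hθc.of_isClosed_subset (isClosed_tsupport _) hXs, hXs.trans (hθs.trans hBA),
        fun x => ?_⟩
      · refine contDiff_iff_contDiffAt.2 fun x => ?_
        by_cases hx : x ∈ tsupport θ
        · exact hθ.contDiffAt.smul (((contDiff_descent hδ).comp_contDiffOn hgr).contDiffAt
            (hB.mem_nhds (hθs hx)))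
        · have : X =ᶠ[𝓝 x] fun _ => 0 := by
            filter_upwards [notMem_tsupport_iff_eventuallyEq.1 hx] with y hy
            simp [hX, hy]
          exact contDiffAt_const.congr_of_eventuallyEq this
      · simp only [hX, norm_smul, Real.norm_of_nonneg (t0 x)]
        exact mul_le_one₀ (t1 x) (norm_nonneg _) (norm_descent_le hδ _)
    have hXF := hXT.isField hA.upper
    have hY := hfc _ (IsTestField.combine (C := A) hη h0 h1 hXT hG
      ((tsupport_smul_field_subset _ _).trans hXT.2.2.1)
      ((tsupport_smul_field_subset _ _).trans hG.2.2.1))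
    rw [(hXF.smul hη).pairing_add_right (hGF.smul hη') hf hfM,
      (hXF.smul hη).pairing_eq_neg_integral hB (hfs.of_le (by norm_num))
      ((tsupport_smul_subset_left _ _).trans hηs)] at hY
    refine le_trans (add_le_add_left ?_ _) hY
    rw [← integral_neg]
    have e : (fun x => -(weight x * fderiv ℝ f x (η x • X x)))
        = fun x => weight x * η x * (-inner ℝ (gradient f x) (descent δ (gradient f x))) := by
      ext1 x
      by_cases hx : x ∈ tsupport η
      · have hx1 : θ x = 1 := hθ1.self_of_nhdsSet x hx
        simp only [hX, hx1, one_smul, map_smul, smul_eq_mul, inner_gradient]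
        ring
      · simp [image_eq_zero_of_notMem_tsupport hx]
    rw [e]
    refine integral_mono (hInt _ (hgr.continuousOn.norm.sub continuousOn_const)) (hInt _ ?_)
      fun x => mul_le_mul_of_nonneg_left ?_ (hwη x)
    · exact (hgr.continuousOn.inner ((contDiff_descent hδ).continuous.comp_continuousOn
        hgr.continuousOn)).neg
    · linarith [inner_descent_le hδ (gradient f x)]
  have hu₁ := hupper f₁ hm₁ hM₁ c₁ hc₁ hs₁
  have hu₂ := hupper f₂ hm₂ hM₂ c₂ hc₂ hs₂
  rw [hsplit f₁ hm₁ hM₁, hsplit f₂ hm₂ hM₂, hηG f₁ hs₁, hηG f₂ hs₂] at hcG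
  have hGc : ContinuousOn G B := hG.1.continuous.continuousOn
  have i1 : Integrable (fun x => weight x * η x * inner ℝ (gradient f₁ x) (G x)) volume :=
    hInt _ (ha₁.continuousOn.inner hGc)
  have i2 : Integrable (fun x => weight x * η x * inner ℝ (gradient f₂ x) (G x)) volume :=
    hInt _ (ha₂.continuousOn.inner hGc)
  have i3 : Integrable (fun x => weight x * η x * (‖gradient f₁ x‖ - δ)) volume :=
    hInt _ (ha₁.continuousOn.norm.sub continuousOn_const)
  have i4 : Integrable (fun x => weight x * η x * (‖gradient f₂ x‖ - δ)) volume :=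
    hInt _ (ha₂.continuousOn.norm.sub continuousOn_const)
  -- A common field of length at most one gains at most `‖a₁ + a₂‖`, whereas separate fields gain
  -- nearly `‖a₁‖ + ‖a₂‖`; the difference is `d`.
  have hfinal : I - 2 * δ * J ≤ (∫ x, weight x * η x * (‖gradient f₁ x‖ - δ))
      + (∫ x, weight x * η x * (‖gradient f₂ x‖ - δ))
      + ((∫ x, weight x * η x * inner ℝ (gradient f₁ x) (G x))
      + ∫ x, weight x * η x * inner ℝ (gradient f₂ x) (G x)) := by
    have e5 : I - 2 * δ * J = ∫ x, (weight x * η x * d x - 2 * δ * (weight x * η x * 1)) := by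
      rw [integral_sub (hInt d hdc) ((hInt _ continuousOn_const).const_mul _), integral_const_mul]
    have e6 := integral_add (i3.add i4) (i1.add i2)
    simp only [Pi.add_apply] at e6
    rw [e5, ← integral_add i3 i4, ← integral_add i1 i2, ← e6]
    refine integral_mono ((hInt d hdc).sub ((hInt _ continuousOn_const).const_mul _))
      ((i3.add i4).add (i1.add i2)) fun x => ?_
    have hin : -‖a₁ x + a₂ x‖ ≤ inner ℝ (a₁ x) (G x) + inner ℝ (a₂ x) (G x) := by
      rw [← inner_add_left]
      have := abs_real_inner_le_norm (a₁ x + a₂ x) (G x)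
      have h5 := hG.2.2.2 x
      have h6 : ‖a₁ x + a₂ x‖ * ‖G x‖ ≤ ‖a₁ x + a₂ x‖ := mul_le_of_le_one_right (norm_nonneg _) h5
      linarith [neg_abs_le (inner ℝ (a₁ x + a₂ x) (G x))]
    have := mul_le_mul_of_nonneg_left hin (hwη x)
    simp only [hd]
    linarith
  linarith

end RadialGraph
end

noncomputable section
namespace RadialGraph
open Filter Topology

variable {n : ℕ}

/-! ### Averages over the group -/

/-- `b ↦ act b x` as a homeomorphism. -/
def actLeftHomeo (x : Space n) (hx : height x ≠ 0) : Space n ≃ₜ Space n where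
  toFun b := act b x
  invFun c := act c (actInv x)
  left_inv b := act_act_div x b hx
  right_inv c := act_div_act x c hx
  continuous_toFun := continuous_act.comp (continuous_id.prodMk continuous_const)
  continuous_invFun := continuous_act.comp (continuous_id.prodMk continuous_const)

lemma integral_comp_actLeft (F : Space n → ℝ) {x : Space n} (hx : 0 < height x) :
    ∫ b, F (act b x) = (height x)⁻¹ * ∫ y, F y := by
  have h1 := (actLeftHomeo x hx.ne').measurableEmbedding.integral_map (μ := volume) F
  have h2 : Measure.map (actLeftHomeo x hx.ne') volume
      = ENNReal.ofReal |(height x)⁻¹| • (volume : Measure (Space n)) := by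
    have h3 := Measure.map_linearMap_addHaar_eq_smul_addHaar (volume : Measure (Space n))
      (f := actLeft x) (by rw [det_actLeft]; exact hx.ne')
    rw [det_actLeft] at h3
    rw [← h3]
    congr 1
    exact funext fun b => (actLeft_apply x b).symm
  rw [h2, integral_smul_measure, abs_of_pos (inv_pos.2 hx),
    ENNReal.toReal_ofReal (inv_pos.2 hx).le, smul_eq_mul] at h1
  exact h1.symm

/-- The average of the indicator function of `W` over the translates by `ρ`. -/
def average (ρ : Space n → ℝ) (W : Set (Space n)) (x : Space n) : ℝ := ∫ b, ρ b * chi W (act b x)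

/-- Moves the dependence on `x` from the rough function `F` to the smooth kernel `ρ`. -/
lemma integral_mul_comp_actLeft (ρ F : Space n → ℝ) {x : Space n} (hx : 0 < height x) :
    ∫ b, ρ b * F (act b x) = (height x)⁻¹ * ∫ y, ρ (act y (actInv x)) * F y := by
  rw [← integral_comp_actLeft (fun y => ρ (act y (actInv x)) * F y) hx]
  simp only [act_act_div _ _ hx.ne']

/-- Smooth probability densities on a ball. -/
structure IsKernel (b₀ : Space n) (δ : ℝ) (ρ : Space n → ℝ) : Prop where
  contDiff : ContDiff ℝ 2 ρ
  nonneg : ∀ b, 0 ≤ ρ b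
  integral : ∫ b, ρ b = 1
  supp : ∀ b, ρ b ≠ 0 → dist b b₀ < δ

section

variable {b₀ : Space n} {δ : ℝ} {ρ : Space n → ℝ} {W : Set (Space n)}

lemma IsKernel.eq_zero (h : IsKernel b₀ δ ρ) {b : Space n} (hb : ¬ dist b b₀ < δ) : ρ b = 0 :=
  by_contra fun h' => hb (h.supp b h')

lemma IsKernel.mono (h : IsKernel b₀ δ ρ) {b₁ : Space n} {δ₁ : ℝ} (hd : dist b₀ b₁ + δ ≤ δ₁) :
    IsKernel b₁ δ₁ ρ :=
  ⟨h.contDiff, h.nonneg, h.integral, fun b hb => by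
    linarith [h.supp b hb, dist_triangle b b₀ b₁]⟩

lemma IsKernel.hasCompactSupport (h : IsKernel b₀ δ ρ) : HasCompactSupport ρ :=
  HasCompactSupport.of_support_subset_isCompact (isCompact_closedBall b₀ δ) fun b hb =>
    Metric.ball_subset_closedBall (h.supp b hb)

lemma IsKernel.integrable (h : IsKernel b₀ δ ρ) : Integrable ρ volume :=
  h.contDiff.continuous.integrable_of_hasCompactSupport h.hasCompactSupport

lemma exists_isKernel (b₀ : Space n) (hδ : 0 < δ) : ∃ ρ, IsKernel b₀ δ ρ := by
  let φ : ContDiffBump b₀ := ⟨δ / 2, δ, half_pos hδ, half_lt_self hδ⟩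
  refine ⟨φ.normed volume, φ.contDiff_normed, φ.nonneg_normed, φ.integral_normed, fun b hb => ?_⟩
  have : b ∈ Function.support (φ.normed volume) := hb
  rwa [φ.support_normed_eq] at this

lemma IsKernel.average_eq_one (h : IsKernel b₀ δ ρ) {x : Space n}
    (hx : ∀ b, dist b b₀ < δ → act b x ∈ W) : average ρ W x = 1 := by
  rw [average, ← h.integral]
  congr 1
  ext1 b
  by_cases hb : dist b b₀ < δ
  · rw [chi_of_mem (hx b hb), mul_one]
  · rw [h.eq_zero hb, zero_mul]

lemma IsKernel.average_eq_zero (h : IsKernel b₀ δ ρ) {x : Space n}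
    (hx : ∀ b, dist b b₀ < δ → act b x ∉ W) : average ρ W x = 0 := by
  rw [average, ← integral_zero (Space n) ℝ (μ := volume)]
  congr 1
  ext1 b
  by_cases hb : dist b b₀ < δ
  · rw [chi_of_notMem (hx b hb), mul_zero]
  · rw [h.eq_zero hb, zero_mul]

lemma dist_act_self (b k : Space n) : dist (act b k) b = |height b| * ‖k - north n‖ := by
  rw [dist_eq_norm, ← Real.norm_eq_abs, ← norm_smul]
  congr 1
  simp only [act]
  module

/-- The density of the right translate of `ρ`. -/
lemma IsKernel.translate (h : IsKernel b₀ δ ρ) {k : Space n} (hk : 0 < height k) {δ₁ : ℝ}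
    (hδ : (‖b₀‖ + δ) * ‖k - north n‖ + δ ≤ δ₁) :
    IsKernel b₀ δ₁ fun c => (height k)⁻¹ * ρ (act c (actInv k)) where
  contDiff := by
    refine contDiff_const.mul (h.contDiff.comp ?_)
    unfold act
    exact (contDiff_height.smul contDiff_const).add
      (contDiff_id.sub (contDiff_height.smul contDiff_const))
  nonneg c := mul_nonneg (inv_nonneg.2 hk.le) (h.nonneg _)
  integral := by
    have := integral_mul_comp_actLeft ρ (fun _ => 1) hk
    simp only [mul_one] at this
    rw [integral_const_mul, ← this, h.integral]
  supp c hc := by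
    have h1 := h.supp _ (right_ne_zero_of_mul hc)
    set b := act c (actInv k) with hb
    have hcb : c = act b k := (act_div_act k c hk.ne').symm
    have h2 := dist_act_self b k
    have h3 : |height b| ≤ ‖b₀‖ + δ := (abs_height_le b).trans (by
      have := norm_le_norm_add_norm_sub' b b₀
      rw [← dist_eq_norm] at this
      rw [dist_comm] at h1
      linarith [dist_comm b b₀])
    have h4 := dist_triangle (act b k) b b₀
    rw [hcb]
    nlinarith [norm_nonneg (k - north n)]

/-- Moving the base point by `k` amounts to translating the kernel on the right, so averages at
nearby points can all be studied at one point. -/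
lemma average_act (ρ : Space n → ℝ) (W : Set (Space n)) {k : Space n} (hk : 0 < height k)
    (y : Space n) :
    average ρ W (act k y) = average (fun c => (height k)⁻¹ * ρ (act c (actInv k))) W y := by
  simp only [average, mul_assoc, act_act]
  rw [integral_mul_comp_actLeft ρ (fun c => chi W (act c y)) hk, integral_const_mul]

lemma IsKernel.contDiffOn_average (h : IsKernel b₀ δ ρ) (hW : MeasurableSet W) {p : Space n} {r : ℝ}
    (hB : Metric.closedBall p r ⊆ upperHalf n) :
    ContDiffOn ℝ 2 (average ρ W) (Metric.ball p r) := by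
  have hf : LocallyIntegrable (chi W : Space n → ℝ) volume :=
    (locallyIntegrable_const (1 : ℝ)).mono (chi_meas hW.nullMeasurableSet) (ae_of_all _ fun x => by
      simpa using abs_chi_le W x)
  set k : Set (Space n) := (fun z : Space n × Space n => -act z.1 z.2) ''
    (Metric.closedBall b₀ δ ×ˢ Metric.closedBall p r)
  have hk : IsCompact k := ((isCompact_closedBall b₀ δ).prod (isCompact_closedBall p r)).image
    continuous_act.neg
  have hsm : ContDiffOn ℝ ((2 : ℕ∞) : WithTop ℕ∞)
      ↿(fun x t : Space n => (height x)⁻¹ * ρ (act (-t) (actInv x)))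
      (Metric.ball p r ×ˢ univ) := by
    have h1 : ContDiffOn ℝ ((2 : ℕ∞) : WithTop ℕ∞) (fun z : Space n × Space n => (height z.1)⁻¹)
        (Metric.ball p r ×ˢ univ) := by
      refine (contDiff_height.comp contDiff_fst).contDiffOn.inv fun z hz => ?_
      exact ne_of_gt (hB (Metric.ball_subset_closedBall hz.1))
    have h2 : ContDiff ℝ ((2 : ℕ∞) : WithTop ℕ∞) fun z : Space n × Space n => height (-z.2) :=
      contDiff_height.comp contDiff_snd.neg
    have h3 : ContDiffOn ℝ ((2 : ℕ∞) : WithTop ℕ∞)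
        (fun z : Space n × Space n => act (-z.2) (actInv z.1)) (Metric.ball p r ×ˢ univ) := by
      unfold act actInv
      exact (h2.contDiffOn.smul ((h1.smul (contDiff_const.sub contDiff_fst).contDiffOn).add
        contDiffOn_const)).add (contDiff_snd.neg.sub (h2.smul contDiff_const)).contDiffOn
    exact h1.mul (ContDiff.comp_contDiffOn (g := ρ) h.contDiff h3)
  -- The convolution is evaluated at the constant point 0, so the kernel is read at the negative of
  -- the integration variable; this explains the signs in `k` and in the parametrized kernel.
  have := contDiffOn_convolution_right_with_param_comp (μ := volume)
    (ContinuousLinearMap.mul ℝ ℝ) (v := fun _ : Space n => (0 : Space n)) contDiffOn_const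
    Metric.isOpen_ball hk (f := chi W) (g := fun x t => (height x)⁻¹ * ρ (act (-t) (actInv x)))
    (fun x t hx ht => ?_) hf hsm
  · refine this.congr fun x hx => ?_
    have hxu : 0 < height x := hB (Metric.ball_subset_closedBall hx)
    rw [average, integral_mul_comp_actLeft ρ (chi W) hxu, convolution, ← integral_const_mul]
    congr 1
    ext1 y
    simp only [ContinuousLinearMap.mul_apply', zero_sub, neg_neg]
    ring
  · have hxu : 0 < height x := hB (Metric.ball_subset_closedBall hx)
    rw [h.eq_zero, mul_zero]
    intro hd
    refine ht ⟨(act (-t) (actInv x), x), ⟨Metric.mem_closedBall.2 hd.le,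
      Metric.ball_subset_closedBall hx⟩, ?_⟩
    simp only [act_div_act x _ hxu.ne', neg_neg]

end

/-! ### Averages of minimizers -/

section

variable {κ m : ℝ} {A V₁ V₂ : Set (Space n)} {b₀ : Space n} {δ : ℝ} {ρ : Space n → ℝ}

/-- By Fubini each test field sees an average of numbers at most `m`: the relaxed functional is
convex. -/
lemma IsKernel.isRelaxedMin (h : IsKernel b₀ δ ρ) (hA : IsDomain A)
    {𝓔 : Set (Space n × Space n)} (hm : MeasurableSet 𝓔)
    (hE : ∀ b, dist b b₀ < δ → IsSetMin κ A V₁ V₂ m {x | (b, x) ∈ 𝓔}) :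
    IsRelaxedMin κ A V₁ V₂ m fun x => ∫ b, ρ b * chi {x | (b, x) ∈ 𝓔} x := by
  have hmeas : Measurable fun z : Space n × Space n => chi {x | (z.1, x) ∈ 𝓔} z.2 := by
    have : (fun z : Space n × Space n => chi {x | (z.1, x) ∈ 𝓔} z.2)
        = 𝓔.indicator fun _ => (1 : ℝ) := by
      ext1 z
      by_cases hz : z ∈ 𝓔
      · rw [indicator_of_mem hz, chi_of_mem (show z.2 ∈ {x | (z.1, x) ∈ 𝓔} from hz)]
      · rw [indicator_of_notMem hz, chi_of_notMem (show z.2 ∉ {x | (z.1, x) ∈ 𝓔} from hz)]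
    rw [this]
    exact measurable_const.indicator hm
  have hI : ∀ x, Integrable (fun b => ρ b * chi {x | (b, x) ∈ 𝓔} x) volume := fun x =>
    h.integrable.mul_bdd (c := 1) (hmeas.comp (measurable_id.prodMk measurable_const)).aestronglyMeasurable
      (ae_of_all _ fun b => by simpa using abs_chi_le _ x)
  refine ⟨Adm.of_values ?_ (fun x => integral_nonneg fun b =>
      mul_nonneg (h.nonneg b) (chi_nonneg _ x)) (fun x => ?_) (fun x hx => ?_) (fun x hx => ?_), ?_⟩
  · have h1 : StronglyMeasurable fun z : Space n × Space n =>
        ρ z.2 * chi {x | (z.2, x) ∈ 𝓔} z.1 :=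
      ((h.contDiff.continuous.measurable.comp measurable_snd).mul
        (hmeas.comp measurable_swap)).stronglyMeasurable
    exact h1.integral_prod_right.aestronglyMeasurable
  · rw [← h.integral]
    exact integral_mono (hI x) h.integrable fun b =>
      mul_le_of_le_one_right (h.nonneg b) (chi_le_one _ x)
  · rw [← h.integral]
    congr 1
    ext1 b
    by_cases hb : dist b b₀ < δ
    · rw [chi_of_mem ((hE b hb).lower hx), mul_one]
    · rw [h.eq_zero hb, zero_mul]
  · rw [← integral_zero (Space n) ℝ (μ := volume)]
    congr 1
    ext1 b
    by_cases hb : dist b b₀ < δ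
    · rw [chi_of_notMem fun hx' => hx ((hE b hb).upper hx'), mul_zero]
    · rw [h.eq_zero hb, zero_mul]
  · intro g hg
    set K : Space n → ℝ := fun x => wdiv g x + κ * volDensity A x with hK
    have hKi : Integrable K volume := hA.integrable_kernel κ hg
    have hint : Integrable (fun z : Space n × Space n =>
        (ρ z.2 * chi {x | (z.2, x) ∈ 𝓔} z.1) * K z.1) (volume.prod volume) := by
      have h1 : Integrable (fun z : Space n × Space n => (K z.1 * ρ z.2) *
          chi {x | (z.2, x) ∈ 𝓔} z.1) (volume.prod volume) :=
        (hKi.mul_prod h.integrable).mul_bdd (c := 1)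
          (hmeas.comp measurable_swap).aestronglyMeasurable
          (ae_of_all _ fun z => by simpa using abs_chi_le _ z.1)
      exact h1.congr (ae_of_all _ fun z => by ring)
    have e1 : fieldEnergy κ A (fun x => ∫ b, ρ b * chi {x | (b, x) ∈ 𝓔} x) g
        = ∫ b, ρ b * fieldEnergy κ A (chi {x | (b, x) ∈ 𝓔}) g := by
      simp only [fieldEnergy]
      have := integral_integral_swap (f := fun x b => (ρ b * chi {x | (b, x) ∈ 𝓔} x) * K x) hint
      simp only [integral_mul_const] at this
      rw [this]
      congr 1
      ext1 b
      rw [← integral_const_mul]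
      simp only [hK, mul_assoc]
    rw [e1, show m = ∫ b, ρ b * m by rw [integral_mul_const, h.integral, one_mul]]
    refine integral_mono ?_ (h.integrable.mul_const m) fun b => ?_
    · have := hint.integral_prod_right
      refine this.congr (ae_of_all _ fun b => ?_)
      simp only [fieldEnergy]
      rw [← integral_const_mul]
      simp only [hK, mul_assoc]
    · by_cases hb : dist b b₀ < δ
      · exact mul_le_mul_of_nonneg_left ((hE b hb).le g hg) (h.nonneg b)
      · simp [h.eq_zero hb]

/-- The half sum is admissible and cannot go below `m`, so the perimeter bound of the sum is no
smaller than the sum of the separate bounds. -/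
lemma IsRelaxedMin.sameRay (hA : IsDomain A) (hlb : LowerBound κ A V₁ V₂ m) {f₁ f₂ : Space n → ℝ}
    (h₁ : IsRelaxedMin κ A V₁ V₂ m f₁) (h₂ : IsRelaxedMin κ A V₁ V₂ m f₂) {B : Set (Space n)}
    (hB : IsOpen B) (hBA : B ⊆ A) (hs₁ : ContDiffOn ℝ 2 f₁ B) (hs₂ : ContDiffOn ℝ 2 f₂ B)
    {x₀ : Space n} (hx₀ : x₀ ∈ B) : SameRay ℝ (gradient f₁ x₀) (gradient f₂ x₀) := by
  have hE : ∀ f, Adm V₁ V₂ f → ∀ g, IsTestField A g →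
      fieldEnergy κ A f g = pairing f g + κ * ∫ x, f x * volDensity A x := fun f hf g hg =>
    fieldEnergy_eq hA hg hf.meas hf.abs_le
  refine sameRay_gradient hA hB hBA h₁.adm.meas h₂.adm.meas h₁.adm.abs_le h₂.adm.abs_le
    (c₁ := m - κ * ∫ x, f₁ x * volDensity A x) (c₂ := m - κ * ∫ x, f₂ x * volDensity A x)
    (fun g hg => ?_) (fun g hg => ?_) (fun c hc => ?_) hs₁ hs₂ hx₀
  · linarith [h₁.le g hg, hE _ h₁.adm g hg]
  · linarith [h₂.le g hg, hE _ h₂.adm g hg]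
  · have hadm : Adm V₁ V₂ fun x => (1 / 2 : ℝ) * (f₁ x + f₂ x) := by
      refine Adm.of_values ((h₁.adm.meas.add h₂.adm.meas).const_mul _) (fun x => ?_) (fun x => ?_)
        (fun x hx => ?_) fun x hx => ?_
      · linarith [h₁.adm.nonneg x, h₂.adm.nonneg x]
      · linarith [h₁.adm.le_one x, h₂.adm.le_one x]
      · rw [h₁.adm.eq_one hx, h₂.adm.eq_one hx]; norm_num
      · rw [h₁.adm.eq_zero hx, h₂.adm.eq_zero hx]; norm_num
    have hle := hlb _ ((1 / 2 : ℝ) * (c + κ * ((∫ x, f₁ x * volDensity A x)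
      + ∫ x, f₂ x * volDensity A x))) hadm fun g hg => by
        rw [fieldEnergy_smul]
        refine mul_le_mul_of_nonneg_left ?_ (by norm_num)
        rw [fieldEnergy_add hA hg h₁.adm.meas h₁.adm.abs_le h₂.adm.meas h₂.adm.abs_le,
          hE _ h₁.adm g hg, hE _ h₂.adm g hg]
        have := hc g hg
        rw [(hg.isField hA.upper).pairing_add_left h₁.adm.meas h₁.adm.abs_le h₂.adm.meas
          h₂.adm.abs_le] at this
        linarith
    linarith

/-- Frontiers of sets some of whose translates agree with minimizers are planar. -/
theorem exists_planar (hA : IsDomain A) (hlb : LowerBound κ A V₁ V₂ m)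
    {𝓔 : Set (Space n × Space n)} (hm : MeasurableSet 𝓔) {W : Set (Space n)} (hW : MeasurableSet W)
    {b₀ p : Space n} (hp : p ∈ A) {δ : ℝ} (hδ : 0 < δ)
    (hE : ∀ b, dist b b₀ < δ → IsSetMin κ A V₁ V₂ m {x | (b, x) ∈ 𝓔})
    (hEW : ∀ b, dist b b₀ < δ → ∀ x, dist x p < δ → ((b, x) ∈ 𝓔 ↔ act b x ∈ W))
    (hp₁ : act b₀ p ∈ closure (interior W)) (hp₂ : act b₀ p ∈ closure (interior Wᶜ)) :
    ∃ e : Space n, ∃ r > 0, ∀ x, dist x p < r → inner ℝ e (x - p) = 0 → act b₀ x ∈ frontier W := by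
  have hpu := hA.upper hp
  obtain ⟨r, hr, hrB⟩ := Metric.nhds_basis_closedBall.mem_iff.1 (hA.isOpen.mem_nhds hp)
  set r₁ := min r δ with hr₁
  have hr₁0 : 0 < r₁ := lt_min hr hδ
  have hBA : Metric.closedBall p r₁ ⊆ A := (Metric.closedBall_subset_closedBall (min_le_left _ _)).trans hrB
  have hBu := hBA.trans hA.upper
  -- averages agree with minimizers
  have hloc : ∀ ρ, IsKernel b₀ δ ρ → ∀ x ∈ Metric.ball p r₁,
      (∫ b, ρ b * chi {x | (b, x) ∈ 𝓔} x) = average ρ W x := by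
    intro ρ hρ x hx
    rw [average]
    congr 1
    ext1 b
    by_cases hb : dist b b₀ < δ
    · have h := hEW b hb x (lt_of_lt_of_le hx (min_le_right _ _))
      by_cases hxE : (b, x) ∈ 𝓔
      · rw [chi_of_mem (show x ∈ {x | (b, x) ∈ 𝓔} from hxE), chi_of_mem (h.1 hxE)]
      · rw [chi_of_notMem (show x ∉ {x | (b, x) ∈ 𝓔} from hxE),
          chi_of_notMem fun hx' => hxE (h.2 hx')]
    · rw [hρ.eq_zero hb, zero_mul, zero_mul]
  have hray : ∀ ρ ρ', IsKernel b₀ δ ρ → IsKernel b₀ δ ρ' →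
      SameRay ℝ (gradient (average ρ W) p) (gradient (average ρ' W) p) := by
    intro ρ ρ' hρ hρ'
    have hg : ∀ ρ, IsKernel b₀ δ ρ → gradient (fun x => ∫ b, ρ b * chi {x | (b, x) ∈ 𝓔} x) p
        = gradient (average ρ W) p := by
      intro ρ hρ
      have : (fun x => ∫ b, ρ b * chi {x | (b, x) ∈ 𝓔} x) =ᶠ[𝓝 p] average ρ W := by
        filter_upwards [Metric.ball_mem_nhds p hr₁0] with x hx
        exact hloc ρ hρ x hx
      rw [gradient, gradient, this.fderiv_eq]
    rw [← hg ρ hρ, ← hg ρ' hρ']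
    exact (hρ.isRelaxedMin hA hm hE).sameRay hA hlb (hρ'.isRelaxedMin hA hm hE)
      Metric.isOpen_ball (Metric.ball_subset_closedBall.trans hBA)
      ((hρ.contDiffOn_average hW hBu).congr (hloc ρ hρ))
      ((hρ'.contDiffOn_average hW hBu).congr (hloc ρ' hρ')) (Metric.mem_ball_self hr₁0)
  -- Any nonzero gradient serves as `e`, all others being its multiples; if every gradient vanishes,
  -- `e = 0` will do.
  obtain ⟨e, he⟩ : ∃ e : Space n, ∀ ρ, IsKernel b₀ δ ρ → ∀ v, inner ℝ e v = 0 →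
      fderiv ℝ (average ρ W) p v = 0 := by
    by_cases h : ∃ ρ, IsKernel b₀ δ ρ ∧ gradient (average ρ W) p ≠ 0
    · obtain ⟨ρ', hρ', hne⟩ := h
      refine ⟨gradient (average ρ' W) p, fun ρ hρ v hv => ?_⟩
      obtain ⟨t, -, ht⟩ := (hray ρ' ρ hρ' hρ).exists_nonneg_left hne
      rw [← inner_gradient, ← ht, inner_smul_left, hv, mul_zero]
    · push Not at h
      exact ⟨0, fun ρ hρ v _ => by rw [← inner_gradient, h ρ hρ, inner_zero_left]⟩
  -- gradients at nearby points
  obtain ⟨r₂, hr₂0, hr₂⟩ : ∃ r₂ > 0, ∀ x, dist x p < r₂ →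
      (‖b₀‖ + δ / 2) * ‖act x (actInv p) - north n‖ + δ / 2 ≤ δ := by
    have hc : Continuous fun x : Space n => (‖b₀‖ + δ / 2) * ‖act x (actInv p) - north n‖ :=
      continuous_const.mul ((continuous_act.comp
        (continuous_id.prodMk continuous_const)).sub continuous_const).norm
    have h0 : (‖b₀‖ + δ / 2) * ‖act p (actInv p) - north n‖ < δ / 2 := by
      rw [act_actInv (ne_of_gt hpu), sub_self, norm_zero, mul_zero]; positivity
    obtain ⟨r₂, h1, h2⟩ := Metric.mem_nhds_iff.1 ((isOpen_lt hc continuous_const).mem_nhds h0)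
    refine ⟨r₂, h1, fun x hx => ?_⟩
    have h3 := h2 hx
    simp only [mem_ofPred_eq] at h3
    linarith
  set r₃ := min r₁ r₂ with hr₃
  have hr₃0 : 0 < r₃ := lt_min hr₁0 hr₂0
  have hder : ∀ ρ, IsKernel b₀ (δ / 2) ρ → ∀ x, dist x p < r₃ → ∀ v, inner ℝ e v = 0 →
      fderiv ℝ (average ρ W) x v = 0 := by
    intro ρ hρ x hx v hv
    have hx₁ : x ∈ Metric.ball p r₁ := lt_of_lt_of_le hx (min_le_left _ _)
    have hxu : 0 < height x := hBu (Metric.ball_subset_closedBall hx₁)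
    set k := act x (actInv p) with hk
    have hkp : act k p = x := act_div_act p x (ne_of_gt hpu)
    have hk0 : 0 < height k := by
      rw [hk, height_act, height_actInv (ne_of_gt hpu)]
      exact mul_pos hxu (inv_pos.2 hpu)
    -- The gradient at `x = act k p` is read off at `p` for the translated kernel; halving the
    -- radius of `ρ` leaves room for this translation.
    have hρk := hρ.translate hk0 (hr₂ x (lt_of_lt_of_le hx (min_le_right _ _)))
    have h1 := he _ hρk v hv
    have h2 : average (fun c => (height k)⁻¹ * ρ (act c (actInv k))) W
        = fun y => average ρ W (act k y) := funext fun y => (average_act ρ W hk0 y).symm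
    have hd : DifferentiableAt ℝ (average ρ W) (act k p) := by
      rw [hkp]
      exact ((hρ.contDiffOn_average hW hBu).contDiffAt
        (Metric.isOpen_ball.mem_nhds hx₁)).differentiableAt (by norm_num)
    have hdk : HasFDerivAt (act k) (height k • ContinuousLinearMap.id ℝ (Space n)) p :=
      ((hasFDerivAt_id p).const_smul (height k)).add_const _
    have h3 := (hd.hasFDerivAt.comp p hdk).fderiv
    rw [Function.comp_def] at h3
    rw [h2, h3, hkp] at h1
    simp only [ContinuousLinearMap.comp_apply, _root_.smul_apply,
      ContinuousLinearMap.id_apply, map_smul, smul_eq_mul] at h1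
    exact (mul_eq_zero.1 h1).resolve_left hk0.ne'
  have hconst : ∀ ρ, IsKernel b₀ (δ / 2) ρ → ∀ x, dist x p < r₃ → inner ℝ e (x - p) = 0 →
      average ρ W x = average ρ W p := by
    intro ρ hρ x hx hxe
    have hseg : ∀ t ∈ Icc (0 : ℝ) 1, dist (p + t • (x - p)) p < r₃ := by
      intro t ht
      rw [dist_eq_norm, add_sub_cancel_left, norm_smul, Real.norm_of_nonneg ht.1, ← dist_eq_norm]
      exact lt_of_le_of_lt (mul_le_of_le_one_left dist_nonneg ht.2) hx
    have hdt : ∀ t ∈ Icc (0 : ℝ) 1,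
        HasDerivAt (fun t : ℝ => average ρ W (p + t • (x - p))) 0 t := by
      intro t ht
      have hxt := hseg t ht
      have hd : DifferentiableAt ℝ (average ρ W) (p + t • (x - p)) :=
        ((hρ.contDiffOn_average hW hBu).contDiffAt (Metric.isOpen_ball.mem_nhds
          (lt_of_lt_of_le hxt (min_le_left _ _)))).differentiableAt (by norm_num)
      have h1 : HasDerivAt (fun t : ℝ => p + t • (x - p)) (x - p) t := by
        simpa using ((hasDerivAt_id t).smul_const (x - p)).const_add p
      have h2 := hd.hasFDerivAt.comp_hasDerivAt t h1
      rwa [hder ρ hρ _ hxt _ hxe] at h2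
    have := constant_of_has_deriv_right_zero (fun t ht => (hdt t ht).continuousAt.continuousWithinAt)
      (fun t ht => (hdt t (Ico_subset_Icc_self ht)).hasDerivWithinAt) 1 (right_mem_Icc.2 zero_le_one)
    simpa using this
  -- kernels concentrated near suitable points separate the two sides
  have hsep : ∀ (U U' : Set (Space n)), IsOpen U → IsOpen U' → act b₀ p ∈ closure U →
      ∀ x, dist x p < r₃ → act b₀ x ∈ U' → ∃ b₁ ε, 0 < ε ∧ dist b₁ b₀ + ε ≤ δ / 2 ∧
        ∀ b, dist b b₁ < ε → act b p ∈ U ∧ act b x ∈ U' := by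
    intro U U' hU hU' hpU x hx hxU'
    have hcl : ∀ y : Space n, Continuous fun b : Space n => act b y := fun y =>
      continuous_act.comp (continuous_id.prodMk continuous_const)
    set N : Set (Space n) := {b | dist b b₀ < δ / 2} ∩ {b | act b x ∈ U'} with hN
    have hNo : IsOpen N := Metric.isOpen_ball.inter (hU'.preimage (hcl x))
    have hNb : b₀ ∈ N := ⟨by simpa using half_pos hδ, hxU'⟩
    have hcont : Continuous fun y : Space n => act y (actInv p) := hcl _
    obtain ⟨y, hyN, hyU⟩ := mem_closure_iff.1 hpU _ (hNo.preimage hcont)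
      (by rw [mem_preimage, act_act_div p _ (ne_of_gt hpu)]; exact hNb)
    have hyp := act_div_act p y (ne_of_gt hpu)
    obtain ⟨ε, hε, hεN⟩ := Metric.mem_nhds_iff.1
      ((hNo.inter (hU.preimage (hcl p))).mem_nhds (x := act y (actInv p))
        ⟨hyN, by rw [mem_preimage, hyp]; exact hyU⟩)
    have hd : dist (act y (actInv p)) b₀ < δ / 2 := hyN.1
    refine ⟨act y (actInv p), min ε (δ / 2 - dist (act y (actInv p)) b₀),
      lt_min hε (sub_pos.2 hd), ?_, fun b hb => ?_⟩
    · linarith [min_le_right ε (δ / 2 - dist (act y (actInv p)) b₀)]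
    · have := hεN (Metric.mem_ball.2 (lt_of_lt_of_le hb (min_le_left _ _)))
      exact ⟨this.2, this.1.2⟩
  refine ⟨e, r₃, hr₃0, fun x hx hxe => ?_⟩
  rw [frontier, closure_eq_compl_interior_compl]
  refine ⟨fun hxW => ?_, fun hxW => ?_⟩
  rotate_left
  · obtain ⟨b₁, ε, hε, hle, hb⟩ := hsep _ _ isOpen_interior isOpen_interior hp₂ x hx hxW
    obtain ⟨ρ, hρ⟩ := exists_isKernel b₁ hε
    have h := hconst ρ (hρ.mono (by linarith)) x hx hxe
    rw [hρ.average_eq_one fun b hb' => interior_subset (hb b hb').2,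
      hρ.average_eq_zero fun b hb' => interior_subset (hb b hb').1] at h
    exact one_ne_zero h
  · obtain ⟨b₁, ε, hε, hle, hb⟩ := hsep _ _ isOpen_interior isOpen_interior hp₁ x hx hxW
    obtain ⟨ρ, hρ⟩ := exists_isKernel b₁ hε
    have h := hconst ρ (hρ.mono (by linarith)) x hx hxe
    rw [hρ.average_eq_zero fun b hb' => interior_subset (hb b hb').2,
      hρ.average_eq_one fun b hb' => interior_subset (hb b hb').1] at h
    exact zero_ne_one h

end

end RadialGraph
end

noncomputable section
namespace RadialGraph
open Filter Topology

variable {n : ℕ}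

/-! ### The boundary of a subgraph -/

section

variable {Ω : Set (Sphere n)} {T : ℝ} {u : Sphere n → ℝ}

lemma continuous_exp_smul (z : Sphere n) : Continuous fun w : ℝ => Real.exp w • (z : Space n) :=
  Real.continuous_exp.smul continuous_const

lemma mem_closure_subgraph (hT : ∀ z ∈ Ω, |u z| ≤ T) {z : Sphere n} (hz : z ∈ Ω) :
    Real.exp (u z) • (z : Space n) ∈ closure (subgraph Ω T u) := by
  have hb := abs_le.1 (hT z hz)
  refine mem_closure_of_tendsto (((continuous_exp_smul z).tendsto (u z)).mono_left
    (nhdsWithin_le_nhds (s := Iio (u z)))) ?_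
  filter_upwards [Ioo_mem_nhdsLT (show -T - 1 < u z by linarith)] with w hw
  exact mem_subgraph_iff.2 ⟨exp_smul_mem_truncCone hz hw.1 (by linarith [hw.2]), by
    simpa using hw.2⟩

lemma isOpen_gap_pos (hΩ : IsOpen Ω) (hu : ContinuousOn u Ω) :
    IsOpen (truncCone Ω T ∩ gap u ⁻¹' Ioi 0) :=
  ((continuousOn_gap hu).mono truncCone_subset).isOpen_inter_preimage (isOpen_truncCone hΩ)
    isOpen_Ioi

lemma gap_pos_subset_interior (hΩ : IsOpen Ω) (hu : ContinuousOn u Ω) :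
    truncCone Ω T ∩ gap u ⁻¹' Ioi 0 ⊆ interior (subgraph Ω T u)ᶜ :=
  interior_maximal (fun _ hx hx' => lt_asymm (mem_subgraph_iff.1 hx').2 hx.2)
    (isOpen_gap_pos hΩ hu)

lemma mem_closure_interior_compl_subgraph (hΩ : IsOpen Ω) (hu : ContinuousOn u Ω)
    (hT : ∀ z ∈ Ω, |u z| ≤ T) {z : Sphere n} (hz : z ∈ Ω) :
    Real.exp (u z) • (z : Space n) ∈ closure (interior (subgraph Ω T u)ᶜ) := by
  have hb := abs_le.1 (hT z hz)
  refine mem_closure_of_tendsto (((continuous_exp_smul z).tendsto (u z)).mono_left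
    (nhdsWithin_le_nhds (s := Ioi (u z)))) ?_
  filter_upwards [Ioo_mem_nhdsGT (show u z < T + 1 by linarith)] with w hw
  exact gap_pos_subset_interior hΩ hu ⟨exp_smul_mem_truncCone hz (by linarith [hw.1]) hw.2, by
    simpa using hw.1⟩

/-- The boundary of the subgraph of `u` is the radial graph of `u`. -/
theorem frontier_subgraph_inter (hΩ : IsOpen Ω) (hu : ContinuousOn u Ω)
    (hT : ∀ z ∈ Ω, |u z| ≤ T) :
    frontier (subgraph Ω T u) ∩ truncCone Ω T = radialGraph Ω u := by
  have ho : IsOpen (subgraph Ω T u) := isOpen_subgraph hΩ hu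
  ext x
  constructor
  · rintro ⟨hx, hxA⟩
    obtain ⟨h0, h1, -, -⟩ := mem_truncCone_iff.1 hxA
    refine mem_radialGraph_iff.2 ⟨h0, h1, ?_⟩
    rw [ho.frontier_eq] at hx
    rcases lt_trichotomy (gap u x) 0 with h | h | h
    · exact absurd (mem_subgraph_iff.2 ⟨hxA, h⟩) hx.2
    · exact h
    · have := gap_pos_subset_interior hΩ hu ⟨hxA, h⟩
      rw [interior_compl] at this
      exact absurd hx.1 this
  · rintro ⟨z, hz, rfl⟩
    have hb := abs_le.1 (hT z hz)
    refine ⟨?_, exp_smul_mem_truncCone hz (by linarith) (by linarith)⟩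
    rw [ho.frontier_eq]
    exact ⟨mem_closure_subgraph hT hz, fun h => by simpa using (mem_subgraph_iff.1 h).2⟩

end

/-! ### Uniqueness -/

lemma actInv_actInv {b : Space n} (hb : height b ≠ 0) : actInv (actInv b) = b := by
  have h : height (actInv b) ≠ 0 := by rw [height_actInv hb]; exact inv_ne_zero hb
  rw [← act_actInv_act hb (actInv (actInv b)), act_actInv h, act_north]

lemma actInv_exp_north (s : ℝ) : actInv (Real.exp s • north n) = Real.exp (-s) • north n := by
  simp only [actInv, height_smul, height_north, mul_one, Real.exp_neg, smul_sub, smul_smul,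
    inv_mul_cancel₀ (Real.exp_pos s).ne', one_smul, sub_add_cancel]

/-- A radial graph that is planar near a point. -/
lemma exists_inner_eq_exp_neg {u : Sphere n → ℝ} {z₀ : Sphere n} {e : Space n}
    (h : ∀ᶠ y in 𝓝 (Real.exp (u z₀) • (z₀ : Space n)),
      inner ℝ e (y - Real.exp (u z₀) • (z₀ : Space n)) = 0 → gap u y = 0) :
    ∃ k : Space n, ∀ᶠ z : Sphere n in 𝓝 z₀, inner ℝ k (z : Space n) = Real.exp (-u z) := by
  set q := Real.exp (u z₀) • (z₀ : Space n) with hq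
  -- Otherwise the plane would contain the ray through `q`, and slight dilates of `q` would lie on
  -- the graph.
  have hne : inner ℝ e q ≠ 0 := by
    intro h0
    have hc : Tendsto (fun w : ℝ => Real.exp w • q) (𝓝[>] 0) (𝓝 q) := by
      have : Continuous fun w : ℝ => Real.exp w • q := Real.continuous_exp.smul continuous_const
      have h1 := this.tendsto 0
      rw [Real.exp_zero, one_smul] at h1
      exact h1.mono_left nhdsWithin_le_nhds
    obtain ⟨w, hw, hw0⟩ := ((hc.eventually h).and self_mem_nhdsWithin).exists
    have h1 := hw (by rw [inner_sub_right, inner_smul_right, h0]; simp)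
    rw [gap_smul_exp u w (exp_smul_ne_zero _ _), gap_exp_smul] at h1
    have : (0 : ℝ) < w := hw0
    linarith
  set k := (inner ℝ e q)⁻¹ • e with hk
  have hkq : inner ℝ k q = 1 := by
    rw [hk, inner_smul_left, RCLike.conj_to_real, inv_mul_cancel₀ hne]
  have hcont : Continuous fun z : Sphere n => inner ℝ k (z : Space n) :=
    continuous_const.inner continuous_subtype_val
  have hkz : inner ℝ k (z₀ : Space n) = Real.exp (-u z₀) := by
    rw [hq, inner_smul_right] at hkq
    rw [Real.exp_neg]
    exact eq_inv_of_mul_eq_one_right hkq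
  have hpos : 0 < inner ℝ k (z₀ : Space n) := by rw [hkz]; exact Real.exp_pos _
  have hlim : Tendsto (fun z : Sphere n => (inner ℝ k (z : Space n))⁻¹ • (z : Space n)) (𝓝 z₀)
      (𝓝 q) := by
    have : ContinuousAt (fun z : Sphere n => (inner ℝ k (z : Space n))⁻¹ • (z : Space n)) z₀ :=
      (hcont.continuousAt.inv₀ hpos.ne').smul continuous_subtype_val.continuousAt
    rw [hq, show Real.exp (u z₀) = (inner ℝ k (z₀ : Space n))⁻¹ by
      rw [hkz, Real.exp_neg, inv_inv]]
    exact this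
  refine ⟨k, ?_⟩
  filter_upwards [hlim.eventually h, hcont.continuousAt.eventually (lt_mem_nhds hpos)] with z hz hz0
  have h1 : inner ℝ k ((inner ℝ k (z : Space n))⁻¹ • (z : Space n) - q) = 0 := by
    rw [inner_sub_right, inner_smul_right, inv_mul_cancel₀ hz0.ne', hkq, sub_self]
  rw [hk, inner_smul_left, RCLike.conj_to_real, mul_eq_zero] at h1
  have h2 := hz (h1.resolve_left (inv_ne_zero hne))
  have h3 : (inner ℝ k (z : Space n))⁻¹ = Real.exp (-Real.log (inner ℝ k (z : Space n))) := by
    rw [Real.exp_neg, Real.exp_log hz0]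
  rw [h3, gap_exp_smul] at h2
  rw [← Real.exp_log hz0]
  congr 1
  linarith

section

variable {Ω : Set (Sphere n)} {T : ℝ} {v₁ v₂ : Sphere n → ℝ} {κ m : ℝ}

/-- The minimizers need only coincide with copies of the subgraph near one point `p`. Dilating by
`e^s` carries `p` to the graph and planes to planes, so the planarity found at `p` transfers. -/
lemma Obstacles.exists_inner_eq (h : Obstacles Ω T v₁ v₂)
    (hlb : LowerBound κ (truncCone Ω T) (subgraph Ω T v₁) (subgraph Ω T v₂) m)
    {u : Sphere n → ℝ} (hu : ContinuousOn u Ω) (huT : ∀ z ∈ Ω, |u z| ≤ T) {z₀ : Sphere n}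
    (hz₀ : z₀ ∈ Ω) {s : ℝ} (hp : Real.exp (u z₀ - s) • (z₀ : Space n) ∈ truncCone Ω T)
    {𝓔 : Set (Space n × Space n)} (hm : MeasurableSet 𝓔)
    (hE : ∀ᶠ b in 𝓝 (Real.exp s • north n), ObstacleMin κ Ω T v₁ v₂ m {x | (b, x) ∈ 𝓔})
    (hEW : ∀ᶠ z in 𝓝 (Real.exp s • north n, Real.exp (u z₀ - s) • (z₀ : Space n)),
      z ∈ 𝓔 ↔ act z.1 z.2 ∈ subgraph Ω T u) :
    ∃ k : Space n, ∀ᶠ z : Sphere n in 𝓝 z₀, inner ℝ k (z : Space n) = Real.exp (-u z) := by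
  set p := Real.exp (u z₀ - s) • (z₀ : Space n) with hpdef
  set q := Real.exp (u z₀) • (z₀ : Space n) with hq
  have hpq : Real.exp s • p = q := by
    rw [hpdef, hq, smul_smul, ← Real.exp_add, add_sub_cancel]
  have hWo : IsOpen (subgraph Ω T u) := isOpen_subgraph h.isOpen hu
  obtain ⟨δ₁, hδ₁, H₁⟩ := Metric.eventually_nhds_iff.1 hE
  obtain ⟨δ₂, hδ₂, H₂⟩ := Metric.eventually_nhds_iff.1 hEW
  obtain ⟨e, r, hr, H⟩ := exists_planar h.isDomain hlb hm hWo.measurableSet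
    (b₀ := Real.exp s • north n) hp (lt_min hδ₁ hδ₂)
    (fun b hb => H₁ (hb.trans_le (min_le_left _ _)))
    (fun b hb x hx => H₂ (y := (b, x)) (by
      rw [Prod.dist_eq]
      exact max_lt (hb.trans_le (min_le_right _ _)) (hx.trans_le (min_le_right _ _))))
    (by rw [act_exp_north, hpq, hWo.interior_eq]; exact mem_closure_subgraph huT hz₀)
    (by rw [act_exp_north, hpq]; exact mem_closure_interior_compl_subgraph h.isOpen hu huT hz₀)
  refine exists_inner_eq_exp_neg (e := e) ?_
  have hb := abs_le.1 (huT z₀ hz₀)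
  have hqA : q ∈ truncCone Ω T := exp_smul_mem_truncCone hz₀ (by linarith) (by linarith)
  have hlim : Tendsto (fun y : Space n => Real.exp (-s) • y) (𝓝 q) (𝓝 p) := by
    have : Real.exp (-s) • q = p := by
      rw [← hpq, smul_smul, ← Real.exp_add, neg_add_cancel, Real.exp_zero, one_smul]
    rw [← this]
    exact (continuous_const_smul _).tendsto q
  filter_upwards [hlim.eventually (Metric.ball_mem_nhds p hr),
    (isOpen_truncCone h.isOpen).mem_nhds hqA] with y hy hyA hye
  have hsy : Real.exp s • Real.exp (-s) • y = y := by
    rw [smul_smul, ← Real.exp_add, add_neg_cancel, Real.exp_zero, one_smul]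
  have h1 := H _ hy (by
    have : Real.exp (-s) • y - p = Real.exp (-s) • (y - q) := by
      rw [smul_sub, ← hpq, smul_smul (Real.exp (-s)), ← Real.exp_add, neg_add_cancel,
        Real.exp_zero, one_smul]
    rw [this, inner_smul_right, hye, mul_zero])
  rw [act_exp_north, hsy] at h1
  have h2 : y ∈ frontier (subgraph Ω T u) ∩ truncCone Ω T := ⟨h1, hyA⟩
  rw [frontier_subgraph_inter h.isOpen hu huT] at h2
  exact (mem_radialGraph_iff.1 h2).2.2

/-- If both obstacles are minimizers, they are planar wherever they are distinct. -/
lemma Obstacles.exists_inner_eq_of_min (h : Obstacles Ω T v₁ v₂)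
    (hlb : LowerBound κ (truncCone Ω T) (subgraph Ω T v₁) (subgraph Ω T v₂) m)
    (h₁ : ObstacleMin κ Ω T v₁ v₂ m (subgraph Ω T v₁))
    (h₂ : ObstacleMin κ Ω T v₁ v₂ m (subgraph Ω T v₂)) {z₀ : Sphere n} (hz₀ : z₀ ∈ Ω)
    (hlt : v₁ z₀ < v₂ z₀) :
    (∃ k : Space n, ∀ᶠ z : Sphere n in 𝓝 z₀, inner ℝ k (z : Space n) = Real.exp (-v₁ z)) ∧
      ∃ k : Space n, ∀ᶠ z : Sphere n in 𝓝 z₀, inner ℝ k (z : Space n) = Real.exp (-v₂ z) := by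
  have hc₁ : ContinuousOn v₁ Ω := h.cont₁.mono subset_closure
  have hc₂ : ContinuousOn v₂ Ω := h.cont₂.mono subset_closure
  have hA : IsOpen (truncCone Ω T) := isOpen_truncCone h.isOpen
  have hV₁ : IsOpen (subgraph Ω T v₁) := isOpen_subgraph h.isOpen hc₁
  have hV₂ : IsOpen (subgraph Ω T v₂) := isOpen_subgraph h.isOpen hc₂
  have b₁ := abs_le.1 (h.bound₁ z₀ hz₀)
  have b₂ := abs_le.1 (h.bound₂ z₀ hz₀)
  -- Pushing one graph halfway towards the other keeps it strictly away from the second obstacle, so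
  -- near the point considered the glued set is just the displaced copy.
  set s := (v₂ z₀ - v₁ z₀) / 2 with hs
  have hs0 : 0 < s := by rw [hs]; linarith
  have hz : ∀ w, v₁ z₀ ≤ w → w ≤ v₂ z₀ → Real.exp w • (z₀ : Space n) ∈ truncCone Ω T :=
    fun w hw hw' => exp_smul_mem_truncCone hz₀ (by linarith) (by linarith)
  obtain ⟨δ, hδ, H⟩ := h.exists_glue hlb hs0
  constructor
  -- For the lower graph the displacement is upwards: the second set of `exists_glue` is used,
  -- parametrized by `b = actInv c` near the dilation by `e^{-s}`.
  · have hp := hz (v₁ z₀ - -s) (by linarith) (by linarith)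
    refine h.exists_inner_eq hlb hc₁ h.bound₁ hz₀ (s := -s) hp
      (𝓔 := {z | z.2 ∈ subgraph Ω T v₂ ∧
        (act z.1 z.2 ∈ truncCone Ω T → act z.1 z.2 ∈ subgraph Ω T v₁)}) ?_ ?_ ?_
    · have : {z : Space n × Space n | z.2 ∈ subgraph Ω T v₂ ∧
          (act z.1 z.2 ∈ truncCone Ω T → act z.1 z.2 ∈ subgraph Ω T v₁)}
          = Prod.snd ⁻¹' subgraph Ω T v₂ ∩ ((fun z : Space n × Space n => act z.1 z.2) ⁻¹'
            ((truncCone Ω T)ᶜ ∪ subgraph Ω T v₁)) := by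
        ext z
        simp only [mem_ofPred_eq, mem_inter_iff, mem_preimage, mem_union, mem_compl_iff,
          imp_iff_not_or]
      rw [this]
      exact (measurable_snd hV₂.measurableSet).inter (continuous_act.measurable
        (hA.measurableSet.compl.union hV₁.measurableSet))
    · have hnu : Real.exp (-s) • north n ∈ upperHalf n := by
        change 0 < height (Real.exp (-s) • north n)
        rw [height_smul, height_north, mul_one]
        exact Real.exp_pos _
      have hca := continuousOn_actInv.continuousAt (isOpen_upperHalf.mem_nhds hnu)
      have hev := hca.eventually (Metric.ball_mem_nhds _ hδ)
      filter_upwards [hev, isOpen_upperHalf.mem_nhds hnu] with b hb hbu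
      rw [actInv_exp_north, neg_neg] at hb
      have := ((H _ hb).2 _ _ h₁ h₂).2
      rwa [actInv_actInv (ne_of_gt hbu)] at this
    · have h1 : Real.exp (v₁ z₀ - -s) • (z₀ : Space n) ∈ subgraph Ω T v₂ :=
        mem_subgraph_iff.2 ⟨hp, by rw [gap_exp_smul, hs]; linarith⟩
      have h2 : act (Real.exp (-s) • north n) (Real.exp (v₁ z₀ - -s) • (z₀ : Space n))
          ∈ truncCone Ω T := by
        rw [act_exp_north, smul_smul, ← Real.exp_add]
        exact hz _ (by linarith) (by linarith)
      filter_upwards [continuous_snd.continuousAt.preimage_mem_nhds (hV₂.mem_nhds h1),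
        continuous_act.continuousAt.preimage_mem_nhds (hA.mem_nhds h2)] with z hz1 hz2
      exact ⟨fun hz3 => hz3.2 hz2, fun hz3 => ⟨hz1, fun _ => hz3⟩⟩
  -- For the upper graph the first set of `exists_glue` is used, near a point strictly above `v₁`.
  · have hp := hz (v₂ z₀ - s) (by linarith) (by linarith)
    refine h.exists_inner_eq hlb hc₂ h.bound₂ hz₀ (s := s) hp
      (𝓔 := {z | z.2 ∈ subgraph Ω T v₁ ∨
        (z.2 ∈ truncCone Ω T ∧ act z.1 z.2 ∈ subgraph Ω T v₂)}) ?_ ?_ ?_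
    · exact (measurable_snd hV₁.measurableSet).union ((measurable_snd hA.measurableSet).inter
        (continuous_act.measurable hV₂.measurableSet))
    · filter_upwards [Metric.ball_mem_nhds _ hδ] with c hc
      have := ((H c hc).2 _ _ h₁ h₂).1
      convert! this using 1
      ext x
      simp only [mem_ofPred_eq, mem_union]
      tauto
    · have h1 : Real.exp (v₂ z₀ - s) • (z₀ : Space n) ∈ truncCone Ω T ∩ gap v₁ ⁻¹' Ioi 0 :=
        ⟨hp, by rw [mem_preimage, gap_exp_smul, mem_Ioi, hs]; linarith⟩
      filter_upwards [continuous_snd.continuousAt.preimage_mem_nhds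
        ((isOpen_gap_pos h.isOpen hc₁).mem_nhds h1)] with z hz1
      refine ⟨fun hz3 => ?_, fun hz3 => Or.inr ⟨hz1.1, hz3⟩⟩
      rcases hz3 with hz3 | hz3
      · exact absurd (mem_subgraph_iff.1 hz3).2 (lt_asymm hz1.2)
      · exact hz3.2

/-- A linear functional that is nonpositive on the sphere near one of its zeros vanishes. -/
lemma eq_zero_of_inner_nonpos {l : Space n} {z₀ : Sphere n} (h0 : inner ℝ l (z₀ : Space n) = 0)
    (h : ∀ᶠ z : Sphere n in 𝓝 z₀, inner ℝ l (z : Space n) ≤ 0) : l = 0 := by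
  have hz₀ : (z₀ : Space n) ≠ 0 := by
    have := exp_smul_ne_zero 0 z₀
    rwa [Real.exp_zero, one_smul] at this
  have hlim : Tendsto (fun t : ℝ => (z₀ : Space n) + t • l) (𝓝[>] 0) (𝓝 (z₀ : Space n)) := by
    have : Continuous fun t : ℝ => (z₀ : Space n) + t • l :=
      continuous_const.add (continuous_id.smul continuous_const)
    have h1 := this.tendsto 0
    rw [zero_smul, add_zero] at h1
    exact h1.mono_left nhdsWithin_le_nhds
  have hdir : Tendsto (dir : Space n → Sphere n) (𝓝 (z₀ : Space n)) (𝓝 z₀) := by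
    have h1 := (continuousOn_dir (n := n)).continuousAt (isOpen_compl_singleton.mem_nhds hz₀)
    have h2 : dir (z₀ : Space n) = z₀ := by
      have := dir_exp_smul 0 z₀
      rwa [Real.exp_zero, one_smul] at this
    rw [ContinuousAt, h2] at h1
    exact h1
  obtain ⟨t, ⟨ht, htne⟩, ht0⟩ := (((hdir.comp hlim).eventually h).and
    (hlim.eventually (isOpen_compl_singleton.mem_nhds hz₀))).and self_mem_nhdsWithin |>.exists
  have ht0' : (0 : ℝ) < t := ht0
  have htne' : (z₀ : Space n) + t • l ≠ 0 := htne
  simp only [Function.comp_apply, coe_dir htne', inner_smul_right, inner_add_right, h0, zero_add,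
    real_inner_self_eq_norm_sq] at ht
  by_contra hl
  have h1 : 0 < ‖l‖ := norm_pos_iff.2 hl
  have h2 : 0 < ‖(z₀ : Space n) + t • l‖ := norm_pos_iff.2 htne'
  have : 0 < ‖(z₀ : Space n) + t • l‖⁻¹ * (t * ‖l‖ ^ 2) := by positivity
  linarith

/-- If both obstacles are minimizers, they coincide. -/
theorem Obstacles.eq_of_min (hn : 1 ≤ n) (h : Obstacles Ω T v₁ v₂)
    (hlb : LowerBound κ (truncCone Ω T) (subgraph Ω T v₁) (subgraph Ω T v₂) m)
    (h₁ : ObstacleMin κ Ω T v₁ v₂ m (subgraph Ω T v₁))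
    (h₂ : ObstacleMin κ Ω T v₁ v₂ m (subgraph Ω T v₂)) {z : Sphere n} (hz : z ∈ Ω) :
    v₁ z = v₂ z := by
  by_contra hne
  have hlt : v₁ z < v₂ z := (h.le z hz).lt_of_ne hne
  set d : Sphere n → ℝ := fun y => v₂ y - v₁ y with hd
  have hdc : ContinuousOn d (closure Ω) := h.cont₂.sub h.cont₁
  obtain ⟨z₁, hz₁, hmax⟩ := isClosed_closure.isCompact.exists_isMaxOn ⟨z, subset_closure hz⟩ hdc
  have hD : 0 < d z₁ := (sub_pos.2 hlt).trans_le (hmax (subset_closure hz))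
  have hfr : ∀ y ∈ closure Ω, 0 < d y → y ∈ Ω := by
    intro y hy hy0
    by_contra hyΩ
    have := h.eq y ⟨hy, by rwa [h.isOpen.interior_eq]⟩
    simp only [hd, this, sub_self, lt_irrefl] at hy0
  set S : Set (Sphere n) := closure Ω ∩ d ⁻¹' {d z₁} with hS
  have hScl : IsClosed S := hdc.preimage_isClosed_of_isClosed isClosed_closure isClosed_singleton
  have hSo : IsOpen S := by
    rw [isOpen_iff_mem_nhds]
    rintro y ⟨hy, hyd⟩
    have hyd' : d y = d z₁ := hyd
    have hyΩ := hfr y hy (by rw [hyd']; exact hD)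
    obtain ⟨⟨k₁, hk₁⟩, k₂, hk₂⟩ := h.exists_inner_eq_of_min hlb h₁ h₂ hyΩ
      (sub_pos.1 (show 0 < d y by rw [hyd']; exact hD))
    have key : ∀ x : Sphere n, inner ℝ k₁ (x : Space n) = Real.exp (-v₁ x) →
        inner ℝ k₂ (x : Space n) = Real.exp (-v₂ x) →
        inner ℝ (k₁ - Real.exp (d z₁) • k₂) (x : Space n)
          = Real.exp (-v₁ x) - Real.exp (d z₁ - v₂ x) := by
      intro x e₁ e₂
      rw [inner_sub_left, inner_smul_left, RCLike.conj_to_real, e₁, e₂, ← Real.exp_add, sub_eq_add_neg (d z₁)]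
    -- Maximality of `d` makes this functional nonpositive on the sphere near `y`, and it vanishes
    -- at `y`.
    have hl : k₁ - Real.exp (d z₁) • k₂ = 0 := by
      refine eq_zero_of_inner_nonpos (z₀ := y) ?_ ?_
      · rw [key y hk₁.self_of_nhds hk₂.self_of_nhds, sub_eq_zero, ← hyd']
        congr 1
        simp only [hd]
        ring
      · filter_upwards [hk₁, hk₂, h.isOpen.mem_nhds hyΩ] with x e₁ e₂ hx
        rw [key x e₁ e₂, sub_nonpos, Real.exp_le_exp]
        have : d x ≤ d z₁ := hmax (subset_closure hx)
        simp only [hd] at this ⊢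
        linarith
    filter_upwards [hk₁, hk₂, h.isOpen.mem_nhds hyΩ] with x e₁ e₂ hx
    refine ⟨subset_closure hx, ?_⟩
    have := key x e₁ e₂
    rw [hl, inner_zero_left, eq_comm, sub_eq_zero, Real.exp_eq_exp] at this
    rw [mem_preimage, mem_singleton_iff]
    simp only [hd] at this ⊢
    linarith
  -- The hypothesis `1 ≤ n` enters here, through connectedness of the sphere.
  have hrank : 1 < Module.rank ℝ (Space n) := by
    rw [← Module.finrank_eq_rank, finrank_euclideanSpace_fin]
    exact_mod_cast Nat.lt_succ_of_le hn
  have : PreconnectedSpace (Sphere n) :=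
    Subtype.preconnectedSpace (isPreconnected_sphere hrank 0 1)
  have huniv : S = univ := IsClopen.eq_univ ⟨hScl, hSo⟩ ⟨z₁, hz₁, rfl⟩
  have hsouth : (⟨-north n, by simp [norm_north]⟩ : Sphere n) ∈ S := huniv ▸ mem_univ _
  have := h.upper hsouth.1
  have h3 : 0 < height (-north n) := this
  rw [← neg_one_smul ℝ (north n), height_smul, height_north] at h3
  linarith

end

end RadialGraph
end

noncomputable section
namespace RadialGraph
open Filter Topology

variable {n : ℕ}

/-! ### Existence and uniqueness of minimizers -/

lemma IsRelaxedMin.exists_isSetMin {κ m : ℝ} {A V₁ V₂ : Set (Space n)} {f : Space n → ℝ}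
    (hf : IsRelaxedMin κ A V₁ V₂ m f) (hA : IsDomain A) (hlb : LowerBound κ A V₁ V₂ m) :
    ∃ E, IsSetMin κ A V₁ V₂ m E := by
  refine ⟨{x | 1 / 2 < f x}, nullMeasurableSet_lt aemeasurable_const hf.adm.meas.aemeasurable,
    fun x hx => ?_, fun x hx => ?_, (hf.superlevel hA hlb one_half_pos one_half_lt_one).le⟩
  · rw [mem_ofPred_eq, hf.adm.eq_one hx]
    norm_num
  · by_contra h
    rw [mem_ofPred_eq, hf.adm.eq_zero h] at hx
    norm_num at hx

section

variable {Ω : Set (Sphere n)} {T : ℝ} {v₁ v₂ u : Sphere n → ℝ} {κ m : ℝ}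

lemma subgraph_congr {u v : Sphere n → ℝ} (h : ∀ z ∈ Ω, u z = v z) :
    subgraph Ω T u = subgraph Ω T v :=
  (subgraph_mono fun z hz => (h z hz).le).antisymm (subgraph_mono fun z hz => (h z hz).ge)

/-- A function squeezed between the obstacles extends continuously by their boundary values. -/
lemma Obstacles.exists_extension (h : Obstacles Ω T v₁ v₂) (hu : ContinuousOn u Ω)
    (h₁ : ∀ z ∈ Ω, v₁ z ≤ u z) (h₂ : ∀ z ∈ Ω, u z ≤ v₂ z) :
    ∃ u' : Sphere n → ℝ, ContinuousOn u' (closure Ω) ∧ (∀ z ∈ Ω, u' z = u z) ∧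
      ∀ z ∈ frontier Ω, u' z = v₁ z := by
  classical
  have hfr : ∀ z ∈ closure Ω, z ∉ Ω → z ∈ frontier Ω := fun z hz hz' =>
    ⟨hz, by rwa [h.isOpen.interior_eq]⟩
  have hon : ∀ z ∈ Ω, Ω.piecewise u v₁ z = u z := fun z hz => piecewise_eq_of_mem _ _ _ hz
  have hoff : ∀ z, z ∉ Ω → Ω.piecewise u v₁ z = v₁ z := fun z hz =>
    piecewise_eq_of_notMem _ _ _ hz
  refine ⟨Ω.piecewise u v₁, fun z hz => ?_, hon, fun z hz => hoff z fun hz' => hz.2 (by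
    rwa [h.isOpen.interior_eq])⟩
  by_cases hzΩ : z ∈ Ω
  · have : Ω.piecewise u v₁ =ᶠ[𝓝 z] u := by
      filter_upwards [h.isOpen.mem_nhds hzΩ] with y hy
      exact hon y hy
    exact ((hu.continuousAt (h.isOpen.mem_nhds hzΩ)).congr this.symm).continuousWithinAt
  · have e := h.eq z (hfr z hz hzΩ)
    have l₁ := h.cont₁ z hz
    have l₂ := h.cont₂ z hz
    rw [ContinuousWithinAt] at l₁ l₂ ⊢
    rw [hoff z hzΩ]
    rw [← e] at l₂
    refine tendsto_of_tendsto_of_tendsto_of_le_of_le' l₁ l₂ ?_ ?_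
    · filter_upwards with y
      by_cases hy : y ∈ Ω
      · rw [hon y hy]; exact h₁ y hy
      · rw [hoff y hy]
    · filter_upwards [self_mem_nhdsWithin] with y hyc
      by_cases hy : y ∈ Ω
      · rw [hon y hy]; exact h₂ y hy
      · rw [hoff y hy, h.eq y (hfr y hyc hy)]

/-- A measurable superset equal to `E` almost everywhere inherits the pushing property because the
action preserves null sets. The extension to the closure makes `u` usable as an obstacle itself. -/
lemma Obstacles.exists_graph_min (h : Obstacles Ω T v₁ v₂) {E : Set (Space n)}
    (hE : ObstacleMin κ Ω T v₁ v₂ m E)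
    (hpush : ∀ s > 0, ∃ δ > 0, ∀ c, dist c (Real.exp s • north n) < δ → 0 < height c ∧
      volume {x | x ∈ truncCone Ω T ∧ act c x ∈ E ∧ x ∉ E} = 0) :
    ∃ u : Sphere n → ℝ, ContinuousOn u (closure Ω) ∧ (∀ z ∈ Ω, v₁ z ≤ u z) ∧
      (∀ z ∈ Ω, u z ≤ v₂ z) ∧ (∀ z ∈ frontier Ω, u z = v₁ z) ∧
      ObstacleMin κ Ω T v₁ v₂ m (subgraph Ω T u) ∧ E =ᵐ[volume] subgraph Ω T u := by
  obtain ⟨F, hEF, hF, hFE⟩ := hE.meas.exists_measurable_superset_ae_eq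
  have hd : volume (F \ E) = 0 := ae_le_set.1 hFE.le
  obtain ⟨u, hu, hu₁, hu₂, hFu⟩ := exists_subgraph h hF
    (by rw [sdiff_eq_empty.2 (hE.lower.trans hEF), measure_empty])
    (measure_mono_null (sdiff_subset_sdiff_right hE.upper) hd)
    (fun s hs => by
      obtain ⟨δ, hδ, H⟩ := hpush s hs
      refine ⟨δ, hδ, fun c hc => ?_⟩
      obtain ⟨hc0, hnull⟩ := H c hc
      refine measure_mono_null (fun x hx => ?_)
        (measure_union_null hnull ((quasiMeasurePreserving_act hc0).preimage_null hd))
      by_cases hxE : act c x ∈ E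
      · exact Or.inl ⟨hx.1, hxE, fun h' => hx.2.2 (hEF h')⟩
      · exact Or.inr ⟨hx.2.1, hxE⟩)
  obtain ⟨u', hu', he, hfr⟩ := h.exists_extension hu hu₁ hu₂
  have hEu : E =ᵐ[volume] subgraph Ω T u' := by
    rw [subgraph_congr he]
    exact hFE.symm.trans hFu
  have h1 : ∀ z ∈ Ω, v₁ z ≤ u' z := fun z hz => by rw [he z hz]; exact hu₁ z hz
  have h2 : ∀ z ∈ Ω, u' z ≤ v₂ z := fun z hz => by rw [he z hz]; exact hu₂ z hz
  exact ⟨u', hu', h1, h2, hfr, hE.congr_ae hEu (subgraph_mono h1) (subgraph_mono h2), hEu⟩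

/-- If `v < u` somewhere, the region between the graphs contains a nonempty open set, which has
positive measure. -/
lemma le_of_subgraph_ae_le (hΩ : IsOpen Ω) {u v : Sphere n → ℝ} (hu : ContinuousOn u Ω)
    (hv : ContinuousOn v Ω) (huT : ∀ z ∈ Ω, |u z| ≤ T) (hvT : ∀ z ∈ Ω, |v z| ≤ T)
    (h : volume (subgraph Ω T u \ subgraph Ω T v) = 0) {z : Sphere n} (hz : z ∈ Ω) :
    u z ≤ v z := by
  by_contra hcon
  obtain ⟨w, hw1, hw2⟩ := exists_between (not_le.1 hcon)
  have b₁ := abs_le.1 (huT z hz)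
  have b₂ := abs_le.1 (hvT z hz)
  have hA := exp_smul_mem_truncCone (T := T) hz (w := w) (by linarith) (by linarith)
  have hne : (subgraph Ω T u ∩ (truncCone Ω T ∩ gap v ⁻¹' Ioi 0)).Nonempty :=
    ⟨_, mem_subgraph_iff.2 ⟨hA, by simpa using hw2⟩, hA, by simpa using hw1⟩
  refine (((isOpen_subgraph hΩ hu).inter (isOpen_gap_pos hΩ hv)).measure_pos volume hne).ne'
    (measure_mono_null (fun x hx => ?_) h)
  refine ⟨hx.1, fun hx' => ?_⟩
  exact lt_asymm (mem_subgraph_iff.1 hx').2 hx.2.2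

/-- Minimizers agree almost everywhere with the subgraph of a continuous function. -/
theorem Obstacles.exists_unique_min (hn : 1 ≤ n) (h : Obstacles Ω T v₁ v₂)
    (hlb : LowerBound κ (truncCone Ω T) (subgraph Ω T v₁) (subgraph Ω T v₂) m)
    {E : Set (Space n)} (hE : ObstacleMin κ Ω T v₁ v₂ m E) :
    ∃ u : Sphere n → ℝ, ContinuousOn u Ω ∧ (∀ z ∈ Ω, |u z| ≤ T) ∧
      ObstacleMin κ Ω T v₁ v₂ m (subgraph Ω T u) ∧
      ∀ F, ObstacleMin κ Ω T v₁ v₂ m F → F =ᵐ[volume] subgraph Ω T u := by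
  obtain ⟨⟨U, hU, hUmax⟩, I, hI, hImin⟩ :=
    exists_extremal h.isDomain (subgraph_subset v₂) hlb hE
  obtain ⟨u₂, hc₂, h₁₂, h₂₂, hf₂, hm₂, he₂⟩ := h.exists_graph_min hU fun s hs => by
    obtain ⟨δ, hδ, H⟩ := h.exists_glue hlb hs
    refine ⟨δ, hδ, fun c hc => ⟨(H c hc).1, ?_⟩⟩
    -- Gluing `U` to its own copy adds the part sticking out, which must be null as `U` is largest.
    refine measure_mono_null (fun x hx => ?_) (hUmax _ ((H c hc).2 U U hU hU).1)
    exact ⟨Or.inr hx, hx.2.2⟩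
  obtain ⟨u₁, hc₁, h₁₁, h₂₁, hf₁, hm₁, he₁⟩ := h.exists_graph_min hI fun s hs => by
    obtain ⟨δ, hδ, H⟩ := h.exists_glue hlb hs
    refine ⟨δ, hδ, fun c hc => ⟨(H c hc).1, ?_⟩⟩
    -- Gluing `I` to its own copy removes the image of that part, which must be null as `I` is
    -- smallest.
    refine measure_mono_null (fun x hx => ?_) ((quasiMeasurePreserving_act (H c hc).1).preimage_null
      (hImin _ ((H c hc).2 I I hI hI).2))
    refine ⟨hx.2.1, fun hx' => hx.2.2 ?_⟩
    have := hx'.2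
    rw [actInv_act_act (H c hc).1.ne'] at this
    exact this hx.1
  have hb : ∀ u : Sphere n → ℝ, (∀ z ∈ Ω, v₁ z ≤ u z) → (∀ z ∈ Ω, u z ≤ v₂ z) →
      ∀ z ∈ Ω, |u z| ≤ T := fun u hu₁ hu₂ z hz => abs_le.2
    ⟨(abs_le.1 (h.bound₁ z hz)).1.trans (hu₁ z hz), (hu₂ z hz).trans (abs_le.1 (h.bound₂ z hz)).2⟩
  have hlow : ∀ F, ObstacleMin κ Ω T v₁ v₂ m F → subgraph Ω T u₁ ≤ᵐ[volume] F := fun F hF =>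
    he₁.symm.le.trans (ae_le_set.2 (hImin F hF))
  have hup : ∀ F, ObstacleMin κ Ω T v₁ v₂ m F → F ≤ᵐ[volume] subgraph Ω T u₂ := fun F hF =>
    (ae_le_set.2 (hUmax F hF)).trans he₂.le
  have hle : ∀ z ∈ Ω, u₁ z ≤ u₂ z := fun z hz =>
    le_of_subgraph_ae_le h.isOpen (hc₁.mono subset_closure) (hc₂.mono subset_closure)
      (hb u₁ h₁₁ h₂₁) (hb u₂ h₁₂ h₂₂) (ae_le_set.1 (hlow _ hm₂)) hz
  -- Both extremal graphs take the same boundary values, so they are themselves obstacles; `m`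
  -- remains a lower bound because the class has shrunk.
  have hobs : Obstacles Ω T u₁ u₂ :=
    ⟨h.isOpen, h.upper, hc₁, hc₂, hle, fun z hz => by rw [hf₁ z hz, hf₂ z hz],
      hb u₁ h₁₁ h₂₁, hb u₂ h₁₂ h₂₂⟩
  have hlb' : LowerBound κ (truncCone Ω T) (subgraph Ω T u₁) (subgraph Ω T u₂) m :=
    fun f c hf hc => hlb f c ⟨hf.meas, fun x => (chi_mono hm₁.lower x).trans (hf.lower x),
      fun x => (hf.upper x).trans (chi_mono hm₂.upper x)⟩ hc
  have heq : ∀ z ∈ Ω, u₁ z = u₂ z := fun z hz => hobs.eq_of_min hn hlb'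
    ⟨hm₁.meas, subset_rfl, subgraph_mono hle, hm₁.le⟩
    ⟨hm₂.meas, subgraph_mono hle, subset_rfl, hm₂.le⟩ hz
  refine ⟨u₂, hc₂.mono subset_closure, hb u₂ h₁₂ h₂₂, hm₂, fun F hF => ?_⟩
  have := hlow F hF
  rw [subgraph_congr heq] at this
  exact (hup F hF).antisymm this

/-- Since `E₀` attains the relaxed minimal value `m`, minimizing among sets is the same as having
energy at most `m`. Competitors of infinite energy are covered by comparing only with real numbers
above the energy. -/
lemma Obstacles.isMinimizer_iff {H : ℝ} (h : Obstacles Ω T v₁ v₂)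
    (hlb : LowerBound ((n : ℝ) * H) (truncCone Ω T) (subgraph Ω T v₁) (subgraph Ω T v₂) m)
    {E₀ : Set (Space n)} (hE₀ : ObstacleMin ((n : ℝ) * H) Ω T v₁ v₂ m E₀) {E : Set (Space n)} :
    IsMinimizer H Ω T v₁ v₂ E ↔ ObstacleMin ((n : ℝ) * H) Ω T v₁ v₂ m E := by
  constructor
  · rintro ⟨⟨-, hm, hl, hu⟩, hmin⟩
    refine ⟨hm, hl, hu, (energy_le_iff h.isDomain hm).1 ?_⟩
    exact (hmin E₀ ⟨hE₀.upper.trans (subgraph_subset v₂), hE₀.meas, hE₀.lower, hE₀.upper⟩).trans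
      ((energy_le_iff h.isDomain hE₀.meas).2 hE₀.le)
  · intro hE
    refine ⟨⟨hE.upper.trans (subgraph_subset v₂), hE.meas, hE.lower, hE.upper⟩, ?_⟩
    rintro E' ⟨-, hm, hl, hu⟩
    refine ((energy_le_iff h.isDomain hE.meas).2 hE.le).trans
      (EReal.le_of_forall_lt_iff_le.1 fun c hc => EReal.coe_le_coe_iff.2 ?_)
    exact hlb _ c (adm_chi hm hl hu) ((energy_le_iff h.isDomain hm).1 hc.le)

end

end RadialGraph
end

/-! ### The theorem. -/

theorem mainTheorem9 (n : ℕ) (hn : 1 ≤ n) (H : ℝ) (hH : |H| < 1)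
    (Ω : Set (RadialGraph.Sphere n)) (hΩo : IsOpen Ω) (hΩc : IsConnected Ω)
    (hΩs : closure Ω ⊆ RadialGraph.upperHemisphere n)
    (T : ℝ) (hT : 0 < T)
    (v₁ v₂ : RadialGraph.Sphere n → ℝ)
    (hv₁ : ContinuousOn v₁ (closure Ω)) (hv₂ : ContinuousOn v₂ (closure Ω))
    (hle : ∀ z ∈ Ω, v₁ z ≤ v₂ z) (hbd : ∀ z ∈ frontier Ω, v₁ z = v₂ z)
    (hT₁ : ∀ z ∈ Ω, |v₁ z| ≤ T) (hT₂ : ∀ z ∈ Ω, |v₂ z| ≤ T)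
    (hfin : ∃ E₀ ∈ RadialGraph.competitors Ω T v₁ v₂,
      RadialGraph.perimeter (RadialGraph.truncCone Ω T) E₀ < ⊤) :
    ∃ E : Set (RadialGraph.Space n),
      RadialGraph.IsMinimizer H Ω T v₁ v₂ E ∧
      (∀ E' : Set (RadialGraph.Space n), RadialGraph.IsMinimizer H Ω T v₁ v₂ E' →
        E' =ᵐ[MeasureTheory.volume] E) ∧
      ∃ u : RadialGraph.Sphere n → ℝ,
        E = RadialGraph.subgraph Ω T u ∧
        frontier E ∩ RadialGraph.truncCone Ω T = RadialGraph.radialGraph Ω u := by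
  have h : RadialGraph.Obstacles Ω T v₁ v₂ := ⟨hΩo, hΩs, hv₁, hv₂, hle, hbd, hT₁, hT₂⟩
  obtain ⟨E₀, ⟨-, hm₀, hl₀, hu₀⟩, hP⟩ := hfin
  obtain ⟨c, hc⟩ : ∃ c : ℝ, RadialGraph.energy H (RadialGraph.truncCone Ω T) E₀ ≤ (c : EReal) := by
    obtain ⟨r, hr, -⟩ := EReal.lt_iff_exists_real_btwn.1 hP
    refine ⟨r + n * H * RadialGraph.vol (RadialGraph.truncCone Ω T) E₀, ?_⟩
    rw [EReal.coe_add]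
    exact add_le_add hr.le le_rfl
  obtain ⟨m, f, hf, hlb⟩ := RadialGraph.exists_relaxed_min h.isDomain
    (RadialGraph.isOpen_subgraph hΩo (hv₁.mono subset_closure)).measurableSet
    (RadialGraph.isOpen_subgraph hΩo (hv₂.mono subset_closure)).measurableSet
    (RadialGraph.subgraph_mono hle) (RadialGraph.subgraph_subset v₂) (n * H)
    (RadialGraph.adm_chi hm₀ hl₀ hu₀) ((RadialGraph.energy_le_iff h.isDomain hm₀).1 hc)
  obtain ⟨E₁, hE₁⟩ := hf.exists_isSetMin h.isDomain hlb
  obtain ⟨u, hu, huT, hmin, huniq⟩ := h.exists_unique_min hn hlb hE₁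
  exact ⟨RadialGraph.subgraph Ω T u, (h.isMinimizer_iff hlb hE₁).2 hmin,
    fun E' hE' => huniq E' ((h.isMinimizer_iff hlb hE₁).1 hE'), u, rfl,
    RadialGraph.frontier_subgraph_inter hΩo hu huT⟩
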